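/- Let $d\in\{2,3\}$, $\kappa>0$, $\theta\in\mathbb{R}^d$ with $\|\theta\|_2=1$, and let $(\Omega,\mathcal{A},\mathbb{P})$ be a probability space (for instance the parameter space $\square=[-1,1]^{\mathbb{N}}$ with the product of the uniform measures). Let $(D(\omega))_{\omega\in\Omega}$ be random obstacles in $\mathbb{R}^d$, and let $R>0$ be such that almost surely $\overline{D(\omega)}\subset B_R(0)=\{\|{\bf x}\|_2<R\}$. Put $\Sigma=\partial B_R(0)$ with outward unit normal ${\bf n}={\bf z}/\|{\bf z}\|_2$ and surface measure $\sigma$. For almost every $\omega$ let $u_s(\omega)$ be the scattered wave of the sound-soft obstacle $D(\omega)$ for the incident wave $u_{\rm inc}({\bf x})=e^{i\kappa\langle\theta,{\bf x}\rangle}$: $u_s$ is $C^2$ in $\mathbb{R}^d\setminus\overline{D(\omega)}$ and continuous up to $\partial D(\omega)$, and $$\Delta u_s+\kappa^2u_s=0\ \text{ in }\mathbb{R}^d\setminus\overline{D(\omega)},\qquad u_{\rm inc}+u_s=0\ \text{ on }\partial D(\omega),\qquad r^{\frac{d-1}{2}}\Big(\frac{\partial u_s}{\partial r}-i\kappa u_s\Big)\to0\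 \text{ as } r=\|{\bf x}\|_2\to\infty,$$ the last limit being uniform in all directions. Assume that the Cauchy data $u_s$ and $\partial u_s/\partial{\bf n}$ on $\Sigma$ are integrable random fields, i.e. they belong to $L^1(\Omega\times\Sigma,\mathbb{P}\otimes\sigma)$. Let $$\Phi({\bf x},{\bf z})=\begin{cases}\frac i4H_0^{(1)}(\kappa\|{\bf x}-{\bf z}\|_2),&d=2,\\[1ex]\dfrac{e^{i\kappa\|{\bf x}-{\bf z}\|_2}}{4\pi\|{\bf x}-{\bf z}\|_2},&d=3,\end{cases}\qquad \Phi_\infty(\hat{\bf x},{\bf z})=\begin{cases}\dfrac{e^{i\pi/4}}{\sqrt{8\pi\kappa}}\,e^{-i\kappa\langle\hat{\bf x},{\bf z}\rangle},&d=2,\\[1ex]\dfrac1{4\pi}\,e^{-i\kappa\langle\hat{\bf x},{\bf z}\rangle},&d=3.\end{cases}$$ (a) For every ${\bf x}$ with $\|{\bf x}\|_2>R$, the random variable $u_s({\bf x})$ is integrable, the integrand below is integrable over $\Sigma$, and $$\mathbb{E}[u_s]({\bf x})=\int_\Sigma\Big\{\frac{\partial\Phi({\bf x},{\bf z})}{\partial{\bf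 n}_{\bf z}}\,\mathbb{E}[u_s]({\bf z})-\Phi({\bf x},{\bf z})\,\mathbb{E}\Big[\frac{\partial u_s}{\partial{\bf n}}\Big]({\bf z})\Big\}\,d\sigma_{\bf z}.$$ (b) Almost surely $u_s$ has the far-field pattern $u_\infty(\hat{\bf x})=\lim_{r\to\infty}r^{\frac{d-1}2}e^{-i\kappa r}u_s(r\hat{\bf x})$, in the sense that $$u_s({\bf x})=\frac{e^{i\kappa r}}{r^{(d-1)/2}}\Big\{u_\infty\Big(\frac{{\bf x}}{r}\Big)+\mathcal{O}\Big(\frac1r\Big)\Big\},\qquad r=\|{\bf x}\|_2\to\infty,$$ uniformly in all directions. For every $\hat{\bf x}$ with $\|\hat{\bf x}\|_2=1$, the random variable $u_\infty(\hat{\bf x})$ is integrable, the integrand below is integrable over $\Sigma$, and $$\mathbb{E}[u_\infty](\hat{\bf x})=\int_\Sigma\Big\{\frac{\partial\Phi_\infty(\hat{\bf x},{\bf z})}{\partial{\bf n}_{\bf z}}\,\mathbb{E}[u_s]({\bf z})-\Phi_\infty(\hat{\bf x},{\bf z})\,\mathbb{E}\Big[\frac{\partial u_s}{\partial{\bf n}}\Big]({\bf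 z})\Big\}\,d\sigma_{\bf z}.$$ -/

import Mathlib

open MeasureTheory Filter Topology

noncomputable section

namespace Scattering

/-- The space `ℝ^d` with its Euclidean norm. -/
abbrev Space (d : ℕ) : Type := EuclideanSpace ℝ (Fin d)

/-- The Hankel function of the first kind and order zero at a real argument `r > 0`, by Hankel's
integral
`H₀⁽¹⁾(r) = √(2 / (π r)) e^{i (r - π/4)} Γ(1/2)⁻¹ ∫₀^∞ e^{-t} t^{-1/2} (1 + i t / (2 r))^{-1/2} dt`,
where `Γ(1/2) = √π` and the last power is the principal branch (its base has real part `1`).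
For every `r > 0` this equals `J₀(r) + i Y₀(r)`. -/
def hankelH0 (r : ℝ) : ℂ :=
  (Real.sqrt (2 / (Real.pi * r)) : ℂ) * Complex.exp (Complex.I * (r - Real.pi / 4))
    * (Real.sqrt Real.pi : ℂ)⁻¹
    * ∫ t in Set.Ioi (0 : ℝ), (Real.exp (-t) * t ^ (-(1 / 2) : ℝ) : ℝ)
        * (1 + Complex.I * t / (2 * r)) ^ (-(1 / 2) : ℂ)

/-- The fundamental solution of the Helmholtz equation with the outgoing radiation condition:
`(i/4) H₀⁽¹⁾(κ |x - z|)` for `d = 2` and `e^{iκ|x-z|} / (4π |x-z|)` for `d = 3`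
(the second formula is used as a dummy value for the remaining `d`). -/
def fundamentalSolution {d : ℕ} (κ : ℝ) (x z : Space d) : ℂ :=
  if d = 2 then Complex.I / 4 * hankelH0 (κ * ‖x - z‖)
  else Complex.exp (Complex.I * (κ * ‖x - z‖ : ℝ)) / (4 * Real.pi * ‖x - z‖ : ℝ)

/-- The far-field kernel `Φ_∞(x̂, z)`: `e^{iπ/4} / √(8πκ) · e^{-iκ⟨x̂,z⟩}` for `d = 2` and
`1 / (4π) · e^{-iκ⟨x̂,z⟩}` for `d = 3` (dummy value for the remaining `d`). -/
def farFieldKernel {d : ℕ} (κ : ℝ) (xhat z : Space d) : ℂ :=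
  if d = 2 then
    Complex.exp (Complex.I * Real.pi / 4) / (Real.sqrt (8 * Real.pi * κ) : ℝ)
      * Complex.exp (-Complex.I * (κ * inner ℝ xhat z : ℝ))
  else 1 / (4 * Real.pi : ℝ) * Complex.exp (-Complex.I * (κ * inner ℝ xhat z : ℝ))

/-- The derivative of `v` at `z` in the direction `z / |z|`. This is `∂v/∂r`, and on a sphere
centred at the origin it is the derivative `∂v/∂n` along the outward unit normal. -/
def radialDeriv {d : ℕ} (v : Space d → ℂ) (z : Space d) : ℂ :=
  fderiv ℝ v z (‖z‖⁻¹ • z)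

/-- The incident plane wave `e^{iκ⟨θ,x⟩}` with direction `θ`. -/
def planeWave {d : ℕ} (κ : ℝ) (θ x : Space d) : ℂ :=
  Complex.exp (Complex.I * (κ * inner ℝ θ x : ℝ))

/-- The Sommerfeld radiation condition `r^{(d-1)/2} (∂v/∂r - iκ v) → 0` as `r = |x| → ∞`,
uniformly in all directions. -/
def SommerfeldRadiation {d : ℕ} (κ : ℝ) (v : Space d → ℂ) : Prop :=
  Tendsto (fun x : Space d =>
      ((‖x‖ ^ (((d : ℝ) - 1) / 2) : ℝ) : ℂ) * (radialDeriv v x - Complex.I * κ * v x))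
    (Bornology.cobounded (Space d)) (𝓝 0)

/-- `v` is the scattered wave of the sound-soft obstacle `D` for the incident plane wave with
wavenumber `κ` and direction `θ`: it is a classical solution of the Helmholtz equation in the
exterior of `D`, continuous up to the boundary, where the total wave vanishes, and it satisfies
the Sommerfeld radiation condition. -/
structure IsScatteredWave {d : ℕ} (κ : ℝ) (θ : Space d) (D : Set (Space d))
    (v : Space d → ℂ) : Prop where
  contDiffOn : ContDiffOn ℝ 2 v (closure D)ᶜ
  helmholtz : ∀ x ∈ (closure D)ᶜ, Laplacian.laplacian v x + (κ : ℂ) ^ 2 * v x = 0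
  continuousOn : ContinuousOn v ((closure D)ᶜ ∪ frontier D)
  boundary : ∀ x ∈ frontier D, planeWave κ θ x + v x = 0
  radiation : SommerfeldRadiation κ v

/-- The surface measure on the sphere `{z | |z| = R}`, as a measure on `ℝ^d`: the image under
`ω ↦ R ω` of `R^{d-1}` times the surface measure of the unit sphere. -/
def sphereSurface (d : ℕ) (R : ℝ) : Measure (Space d) :=
  ENNReal.ofReal (R ^ (d - 1)) •
    ((volume : Measure (Space d)).toSphere.map
      (fun ω : Metric.sphere (0 : Space d) 1 => R • (ω : Space d)))

/-- The far-field pattern of `v` in the direction `x̂`: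
the limit of `r^{(d-1)/2} e^{-iκr} v(r x̂)` as `r → ∞`. -/
def farField {d : ℕ} (κ : ℝ) (v : Space d → ℂ) (xhat : Space d) : ℂ :=
  limUnder atTop (fun r : ℝ =>
    ((r ^ (((d : ℝ) - 1) / 2) : ℝ) : ℂ) * Complex.exp (-Complex.I * (κ * r : ℝ)) * v (r • xhat))

/-- `w` is the far-field pattern of `v`, i.e.
`v(x) = e^{iκr} / r^{(d-1)/2} · (w(x/r) + O(1/r))` as `r = |x| → ∞`, uniformly in all
directions. -/
def HasFarField {d : ℕ} (κ : ℝ) (v w : Space d → ℂ) : Prop :=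
  (fun x : Space d => v x
      - Complex.exp (Complex.I * (κ * ‖x‖ : ℝ)) / ((‖x‖ ^ (((d : ℝ) - 1) / 2) : ℝ) : ℂ)
        * w (‖x‖⁻¹ • x))
    =O[Bornology.cobounded (Space d)]
  (fun x : Space d => ‖x‖ ^ (-(((d : ℝ) + 1) / 2)))

end Scattering

end

open Scattering

/-! Almost surely the obstacle lies in a ball of radius `ρ < R`, so `u_s` is a radiating Helmholtz
solution on a neighbourhood of `‖z‖ ≥ R`. Green's representation formula then writes `u_s(x)`, and
its far-field pattern, as a linear integral of the Cauchy data on the fixed sphere Σ against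
deterministic kernels. These kernels are continuous on Σ, hence bounded there, and the data are
integrable on `Ω × Σ`, so Fubini exchanges expectation and surface integral
(`integral_boundary_operator`).

The work is the representation formula (`IsOutgoingProfile.flux_eq`). For two Helmholtz solutions
the field `v∇w - w∇v` is divergence free. Tested with smooth radial cutoffs and written in polar
coordinates, this says that averages of fluxes over thin spherical shells balance; shrinking the
shells gives the balance of the fluxes themselves (`flux_zero_eq`, `flux_zero_sub`). With `w =
Φ(x,·)` the small spheres around `x` contribute `-v(x)`, by the normalised singularity of `Φ`.
Spheres tending to infinity contribute nothing: conservation of the flux of `v` against its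
conjugate, together with the radiation condition, bounds the `L²` norm of `v` on large spheres
(`exists_sphere_sq_bound`), and both radiation conditions then kill the flux of `v` against `Φ`
(`tendsto_flux_atTop`).

Everything needed about `Φ` is collected in `IsOutgoingProfile`: the radial ODE, the strength of the
singularity, and first-order asymptotics at infinity. For `d = 3` this is explicit. For `d = 2` the
substitution `t = rs` turns Hankel's integral into a Laplace integral in which `r` enters only
through `e^{r(i-s)}` and an outer constant; Bessel's equation, the singularity and the asymptotics
are read off from it.

For (b), the expansion of `Φ(x,z)` for large `x`, uniform in `z` on Σ (`exists_farField_bounds`), is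
inserted in the representation formula. -/

namespace Scattering

/-! ### Green's second identity against test functions -/

/-- A continuous compactly supported function times a function that is continuous on an open
neighbourhood of its support is integrable. -/
lemma integrable_smul_of_tsupport_subset {d : ℕ} {U : Set (Space d)} (hU : IsOpen U)
    {φ : Space d → ℝ} (hφ : Continuous φ) (hc : HasCompactSupport φ) (hsub : tsupport φ ⊆ U)
    {F : Space d → ℂ} (hF : ContinuousOn F U) : Integrable (fun z => φ z • F z) := by
  have hts : tsupport (fun z => φ z • F z) ⊆ tsupport φ := tsupport_smul_subset_left φ F
  refine Continuous.integrable_of_hasCompactSupport ?_ (hc.smul_right (f' := F))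
  refine continuous_of_tsupport fun x hx => ?_
  exact hφ.continuousAt.smul (hF.continuousAt (hU.mem_nhds (hsub (hts hx))))

lemma laplacian_eq_sum_fderiv {d : ℕ} (v : Space d → ℂ) (x : Space d) :
    Laplacian.laplacian v x = ∑ i, fderiv ℝ (fderiv ℝ v) x (EuclideanSpace.basisFun (Fin d) ℝ i)
      (EuclideanSpace.basisFun (Fin d) ℝ i) := by
  rw [InnerProductSpace.laplacian_eq_iteratedFDeriv_orthonormalBasis v
    (EuclideanSpace.basisFun (Fin d) ℝ)]
  simp [iteratedFDeriv_two_apply]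

/-- The classical solutions of the Helmholtz equation `Δv + κ²v = 0` on an open set `U`. -/
structure IsHelmholtzOn {d : ℕ} (κ : ℝ) (U : Set (Space d)) (v : Space d → ℂ) : Prop where
  contDiffOn : ContDiffOn ℝ 2 v U
  helmholtz : ∀ x ∈ U, Laplacian.laplacian v x + (κ : ℂ) ^ 2 * v x = 0

lemma IsHelmholtzOn.mono {d : ℕ} {κ : ℝ} {U V : Set (Space d)} {v : Space d → ℂ}
    (h : IsHelmholtzOn κ U v) (hVU : V ⊆ U) : IsHelmholtzOn κ V v :=
  ⟨h.contDiffOn.mono hVU, fun x hx => h.helmholtz x (hVU hx)⟩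

/-- The Green vector field `v ∇w - w ∇v`, evaluated in a direction `y`. -/
noncomputable def greenField {d : ℕ} (v w : Space d → ℂ) (z y : Space d) : ℂ :=
  v z * fderiv ℝ w z y - w z * fderiv ℝ v z y

lemma continuousOn_fderiv_apply {d : ℕ} {U : Set (Space d)} (hU : IsOpen U) {v : Space d → ℂ}
    (hv : ContDiffOn ℝ 2 v U) :
    ContinuousOn (fun p : Space d × Space d => fderiv ℝ v p.1 p.2) (U ×ˢ Set.univ) := by
  have h1 : ContinuousOn (fun p : Space d × Space d => fderiv ℝ v p.1) (U ×ˢ Set.univ) :=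
    (hv.continuousOn_fderiv_of_isOpen hU (by norm_num)).comp continuousOn_fst
      (fun p hp => hp.1)
  exact h1.clm_apply continuousOn_snd

lemma continuousOn_greenField {d : ℕ} {U : Set (Space d)} (hU : IsOpen U) {v w : Space d → ℂ}
    (hv : ContDiffOn ℝ 2 v U) (hw : ContDiffOn ℝ 2 w U) :
    ContinuousOn (fun p : Space d × Space d => greenField v w p.1 p.2) (U ×ˢ Set.univ) := by
  have hv0 : ContinuousOn (fun p : Space d × Space d => v p.1) (U ×ˢ Set.univ) :=
    hv.continuousOn.comp continuousOn_fst (fun p hp => hp.1)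
  have hw0 : ContinuousOn (fun p : Space d × Space d => w p.1) (U ×ˢ Set.univ) :=
    hw.continuousOn.comp continuousOn_fst (fun p hp => hp.1)
  exact (hv0.mul (continuousOn_fderiv_apply hU hw)).sub (hw0.mul (continuousOn_fderiv_apply hU hv))

lemma continuousOn_greenField_left {d : ℕ} {U : Set (Space d)} (hU : IsOpen U) {v w : Space d → ℂ}
    (hv : ContDiffOn ℝ 2 v U) (hw : ContDiffOn ℝ 2 w U) (y : Space d) :
    ContinuousOn (fun z => greenField v w z y) U :=
  (continuousOn_greenField hU hv hw).comp (f := fun z => (z, y)) (by fun_prop)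
    (fun z hz => ⟨hz, trivial⟩)

/-- The two products of first derivatives cancel, so only second derivatives survive. Summed over an
orthonormal basis this makes the divergence of the Green field `v Δw - w Δv`. -/
lemma fderiv_greenField {d : ℕ} {U : Set (Space d)} (hU : IsOpen U) {v w : Space d → ℂ}
    (hv : ContDiffOn ℝ 2 v U) (hw : ContDiffOn ℝ 2 w U) (y : Space d) {z : Space d} (hz : z ∈ U) :
    DifferentiableAt ℝ (fun z => greenField v w z y) z ∧
    fderiv ℝ (fun z => greenField v w z y) z y =
      v z * fderiv ℝ (fderiv ℝ w) z y y - w z * fderiv ℝ (fderiv ℝ v) z y y := by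
  have key : ∀ {f : Space d → ℂ}, ContDiffOn ℝ 2 f U → HasFDerivAt f (fderiv ℝ f z) z ∧
      HasFDerivAt (fun z => fderiv ℝ f z y) ((fderiv ℝ (fderiv ℝ f) z).flip y) z := by
    intro f hf
    have h2 : ContDiffAt ℝ 2 f z := hf.contDiffAt (hU.mem_nhds hz)
    refine ⟨(h2.differentiableAt (by norm_num)).hasFDerivAt, ?_⟩
    have h3 : DifferentiableAt ℝ (fderiv ℝ f) z :=
      (h2.fderiv_right (m := 1) (by norm_num)).differentiableAt (by norm_num)
    have h4 := h3.hasFDerivAt.clm_apply (hasFDerivAt_const y z)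
    simpa using h4
  obtain ⟨v1, v2⟩ := key hv
  obtain ⟨w1, w2⟩ := key hw
  have h := (v1.mul w2).sub (w1.mul v2)
  refine ⟨h.differentiableAt, ?_⟩
  have h' : fderiv ℝ (fun z => greenField v w z y) z = _ := h.fderiv
  rw [h']
  simp
  ring

/-- Green's second identity, tested with a compactly supported function. -/
lemma integral_fderiv_smul_greenField_eq_zero {d : ℕ} {κ : ℝ} {U : Set (Space d)} (hU : IsOpen U)
    {v w : Space d → ℂ} (hv : IsHelmholtzOn κ U v) (hw : IsHelmholtzOn κ U w)
    {ψ : Space d → ℝ} (hψ : ContDiff ℝ 1 ψ) (hc : HasCompactSupport ψ) (hsub : tsupport ψ ⊆ U) :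
    ∫ z, ∑ i, fderiv ℝ ψ z (EuclideanSpace.basisFun (Fin d) ℝ i) •
      greenField v w z (EuclideanSpace.basisFun (Fin d) ℝ i) = 0 := by
  set b := EuclideanSpace.basisFun (Fin d) ℝ
  have hdF : ∀ i, ContinuousOn (fun z => fderiv ℝ (fun z => greenField v w z (b i)) z (b i)) U := by
    intro i
    have h2 : ∀ {f : Space d → ℂ}, ContDiffOn ℝ 2 f U →
        ContinuousOn (fun z => fderiv ℝ (fderiv ℝ f) z (b i) (b i)) U := by
      intro f hf
      have h3 : ContDiffOn ℝ 1 (fderiv ℝ f) U := hf.fderiv_of_isOpen hU (by norm_num)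
      have h4 := h3.continuousOn_fderiv_of_isOpen hU (by norm_num)
      exact (h4.clm_apply continuousOn_const).clm_apply continuousOn_const
    refine ContinuousOn.congr (f := fun z => v z * fderiv ℝ (fderiv ℝ w) z (b i) (b i)
      - w z * fderiv ℝ (fderiv ℝ v) z (b i) (b i)) ?_ fun z hz =>
        (fderiv_greenField hU hv.contDiffOn hw.contDiffOn (b i) hz).2
    exact (hv.contDiffOn.continuousOn.mul (h2 hw.contDiffOn)).sub
      (hw.contDiffOn.continuousOn.mul (h2 hv.contDiffOn))
  have hI0 : ∀ i, Integrable (fun z => ψ z • greenField v w z (b i)) := fun i =>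
    integrable_smul_of_tsupport_subset hU hψ.continuous hc hsub
      (continuousOn_greenField_left hU hv.contDiffOn hw.contDiffOn _)
  have hI1 : ∀ i, Integrable (fun z => ψ z • fderiv ℝ (fun z => greenField v w z (b i)) z (b i)) :=
    fun i => integrable_smul_of_tsupport_subset hU hψ.continuous hc hsub (hdF i)
  have hts : ∀ i, tsupport (fun z => fderiv ℝ ψ z (b i)) ⊆ tsupport ψ := fun i =>
    tsupport_fderiv_apply_subset ℝ (b i)
  have hI2 : ∀ i, Integrable (fun z => fderiv ℝ ψ z (b i) • greenField v w z (b i)) := fun i =>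
    integrable_smul_of_tsupport_subset hU
      ((hψ.continuous_fderiv (by norm_num)).clm_apply continuous_const)
      (hc.fderiv_apply ℝ (b i)) ((hts i).trans hsub)
      (continuousOn_greenField_left hU hv.contDiffOn hw.contDiffOn _)
  -- Integration by parts asks for differentiability of the Green field only on the support of `ψ`,
  -- so its behaviour outside `U` is irrelevant.
  have hparts : ∀ i, ∫ z, fderiv ℝ ψ z (b i) • greenField v w z (b i) =
      - ∫ z, ψ z • fderiv ℝ (fun z => greenField v w z (b i)) z (b i) := by
    intro i
    have := integral_smul_fderiv_eq_neg_fderiv_smul_of_integrable (hI2 i) (hI1 i) (hI0 i)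
      (fun x _ => (hψ.differentiable (by norm_num)) x)
      (fun x hx => (fderiv_greenField hU hv.contDiffOn hw.contDiffOn (b i) (hsub hx)).1)
    rw [this, neg_neg]
  rw [integral_finsetSum _ fun i _ => hI2 i, Finset.sum_congr rfl fun i _ => hparts i,
    Finset.sum_neg_distrib, ← integral_finsetSum _ fun i _ => hI1 i, neg_eq_zero]
  refine integral_eq_zero_of_ae (Eventually.of_forall fun z => ?_)
  by_cases hz : z ∈ U
  · have hV := hv.helmholtz z hz
    have hW := hw.helmholtz z hz
    rw [laplacian_eq_sum_fderiv] at hV hW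
    simp only [Pi.zero_apply, ← Finset.smul_sum]
    rw [Finset.sum_congr rfl fun i _ =>
      (fderiv_greenField hU hv.contDiffOn hw.contDiffOn (b i) hz).2,
      Finset.sum_sub_distrib, ← Finset.mul_sum, ← Finset.mul_sum]
    -- The terms `κ² v w` cancel: the divergence vanishes because both functions have the same
    -- wavenumber.
    have : v z * (∑ i, fderiv ℝ (fderiv ℝ w) z (b i) (b i)) -
      w z * (∑ i, fderiv ℝ (fderiv ℝ v) z (b i) (b i)) = 0 := by
      linear_combination v z * hW - w z * hV
    rw [this, smul_zero]
  · have : ψ z = 0 := image_eq_zero_of_notMem_tsupport fun h => hz (hsub h)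
    simp [this]

/-! ### Smooth steps and averages over thin shells -/

/-- A smooth monotone function that is `0` up to `a` and `1` from `a + ε` on. -/
noncomputable def smoothStep (a ε r : ℝ) : ℝ := Real.smoothTransition ((r - a) / ε)

lemma contDiff_smoothStep (a ε : ℝ) : ContDiff ℝ 1 (smoothStep a ε) :=
  Real.smoothTransition.contDiff.comp (by fun_prop)

lemma smoothStep_of_le {a ε r : ℝ} (hε : 0 < ε) (h : r ≤ a) : smoothStep a ε r = 0 :=
  Real.smoothTransition.zero_of_nonpos (div_nonpos_of_nonpos_of_nonneg (by linarith) hε.le)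

lemma smoothStep_of_ge {a ε r : ℝ} (hε : 0 < ε) (h : a + ε ≤ r) : smoothStep a ε r = 1 :=
  Real.smoothTransition.one_of_one_le (by rw [le_div_iff₀ hε]; linarith)

lemma monotone_smoothStep {a ε : ℝ} (hε : 0 < ε) : Monotone (smoothStep a ε) := fun r s h =>
  Real.smoothTransition.monotone (by gcongr)

lemma hasDerivAt_smoothStep (a ε r : ℝ) :
    HasDerivAt (smoothStep a ε) (deriv (smoothStep a ε) r) r :=
  ((contDiff_smoothStep a ε).differentiable (by norm_num) r).hasDerivAt

lemma continuous_deriv_smoothStep (a ε : ℝ) : Continuous (deriv (smoothStep a ε)) :=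
  (contDiff_smoothStep a ε).continuous_deriv (by norm_num)

lemma deriv_smoothStep_nonneg {a ε : ℝ} (hε : 0 < ε) (r : ℝ) : 0 ≤ deriv (smoothStep a ε) r :=
  (monotone_smoothStep hε).deriv_nonneg

lemma deriv_smoothStep_eq_zero {a ε r : ℝ} (hε : 0 < ε) (hr : r ∉ Set.Icc a (a + ε)) :
    deriv (smoothStep a ε) r = 0 := by
  rw [Set.mem_Icc, not_and_or, not_le, not_le] at hr
  rcases hr with hr | hr
  · have : smoothStep a ε =ᶠ[𝓝 r] fun _ => 0 := by
      filter_upwards [Iio_mem_nhds hr] with s hs using smoothStep_of_le hε (le_of_lt hs)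
    rw [this.deriv_eq, deriv_const]
  · have : smoothStep a ε =ᶠ[𝓝 r] fun _ => 1 := by
      filter_upwards [Ioi_mem_nhds hr] with s hs using smoothStep_of_ge hε (le_of_lt hs)
    rw [this.deriv_eq, deriv_const]

lemma integral_deriv_smoothStep {a ε : ℝ} (hε : 0 < ε) :
    ∫ r in Set.Icc a (a + ε), deriv (smoothStep a ε) r = 1 := by
  rw [integral_Icc_eq_integral_Ioc, ← intervalIntegral.integral_of_le (by linarith),
    intervalIntegral.integral_eq_sub_of_hasDerivAt (fun r _ => hasDerivAt_smoothStep a ε r)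
      ((continuous_deriv_smoothStep a ε).intervalIntegrable _ _),
    smoothStep_of_ge hε le_rfl, smoothStep_of_le hε le_rfl, sub_zero]

/-- The average of `W` near `a` with respect to the weight given by a smooth step. -/
noncomputable def stepAverage (a ε : ℝ) (W : ℝ → ℂ) : ℂ :=
  ∫ r in Set.Ioi (0 : ℝ), deriv (smoothStep a ε) r • W r

lemma stepAverage_eq {a ε : ℝ} (ha : 0 < a) (hε : 0 < ε) (W : ℝ → ℂ) :
    stepAverage a ε W = ∫ r in Set.Icc a (a + ε), deriv (smoothStep a ε) r • W r := by
  refine setIntegral_eq_of_subset_of_forall_sdiff_eq_zero measurableSet_Ioi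
    (fun r hr => lt_of_lt_of_le ha hr.1) fun r hr => ?_
  rw [deriv_smoothStep_eq_zero hε hr.2, zero_smul]

/-- The derivative of a step is a nonnegative weight of total mass one, carried by `[a, a + ε]`. -/
lemma norm_stepAverage_sub_le {a ε δ : ℝ} (ha : 0 < a) (hε : 0 < ε) {W : ℝ → ℂ} {L : ℂ}
    (hW : ContinuousOn W (Set.Icc a (a + ε))) (h : ∀ r ∈ Set.Icc a (a + ε), ‖W r - L‖ ≤ δ) :
    ‖stepAverage a ε W - L‖ ≤ δ := by
  have hc := (continuous_deriv_smoothStep a ε).continuousOn (s := Set.Icc a (a + ε))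
  have hL : ∫ r in Set.Icc a (a + ε), deriv (smoothStep a ε) r • L = L := by
    rw [integral_smul_const, integral_deriv_smoothStep hε, one_smul]
  rw [stepAverage_eq ha hε, ← hL, ← integral_sub]
  · calc _ ≤ ∫ r in Set.Icc a (a + ε), deriv (smoothStep a ε) r * δ := by
          refine norm_integral_le_of_norm_le ?_ ?_
          · exact (hc.mul continuousOn_const).integrableOn_compact isCompact_Icc
          · filter_upwards [ae_restrict_mem measurableSet_Icc] with r hr
            rw [← smul_sub, norm_smul, Real.norm_of_nonneg (deriv_smoothStep_nonneg hε r)]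
            exact mul_le_mul_of_nonneg_left (h r hr) (deriv_smoothStep_nonneg hε r)
      _ = δ := by rw [integral_mul_const, integral_deriv_smoothStep hε, one_mul]
  · exact (hc.smul hW).integrableOn_compact isCompact_Icc
  · exact (hc.smul continuousOn_const).integrableOn_compact isCompact_Icc

/-- The weights concentrate at `a` from the right. This is how an identity for smoothed fluxes
becomes one for the flux through a single sphere. -/
lemma tendsto_stepAverage {a ε₀ : ℝ} (ha : 0 < a) (hε₀ : 0 < ε₀) {W : ℝ → ℂ}
    (hW : ContinuousOn W (Set.Icc a (a + ε₀))) :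
    Tendsto (fun ε => stepAverage a ε W) (𝓝[>] 0) (𝓝 (W a)) := by
  rw [Metric.tendsto_nhds]
  intro δ hδ
  have hWa : ContinuousWithinAt W (Set.Icc a (a + ε₀)) a := hW a ⟨le_rfl, by linarith⟩
  obtain ⟨η, hη, hη'⟩ := Metric.continuousWithinAt_iff.1 hWa (δ / 2) (by linarith)
  filter_upwards [Ioo_mem_nhdsGT (show (0 : ℝ) < min (η / 2) ε₀ by positivity)] with ε hε
  have h1 := hε.2.trans_le (min_le_left _ _)
  have h2 := hε.2.trans_le (min_le_right _ _)
  rw [dist_eq_norm]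
  refine lt_of_le_of_lt (norm_stepAverage_sub_le ha hε.1 (δ := δ / 2)
    (hW.mono (Set.Icc_subset_Icc_right (by linarith))) fun r hr => ?_) (by linarith)
  rw [← dist_eq_norm]
  refine (hη' ⟨hr.1, by linarith [hr.2]⟩ ?_).le
  rw [Real.dist_eq, abs_lt]
  constructor <;> linarith [hr.1, hr.2]

/-! ### Polar coordinates and fluxes through spheres -/

/-- Integration in polar coordinates around `c`. -/
lemma integral_polar {d : ℕ} [NeZero d] {G : Space d → ℂ} (hG : Integrable G) (c : Space d) :
    ∫ z, G z = ∫ r in Set.Ioi (0 : ℝ), (r ^ (d - 1) : ℝ) •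
      ∫ ω : Metric.sphere (0 : Space d) 1, G (c + r • (ω : Space d))
        ∂(volume : Measure (Space d)).toSphere := by
  have : Nontrivial (Space d) :=
    Module.nontrivial_of_finrank_pos (R := ℝ) (by simpa using Nat.pos_of_ne_zero (NeZero.ne d))
  set μ : Measure (Space d) := volume
  have hG' : Integrable (fun z => G (c + z)) μ := hG.comp_add_left c
  have hmp := μ.measurePreserving_homeomorphUnitSphereProd
  have hemb := Homeomorph.measurableEmbedding (homeomorphUnitSphereProd (Space d))
  let g : Metric.sphere (0 : Space d) 1 × Set.Ioi (0 : ℝ) → ℂ :=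
    fun p => G (c + p.2.1 • (p.1 : Space d))
  have hgcomp : ∀ z : ({0}ᶜ : Set (Space d)), g (homeomorphUnitSphereProd _ z) = G (c + z) := by
    intro z
    have hz : ‖(z : Space d)‖ ≠ 0 := norm_ne_zero_iff.2 z.2
    simp [g, smul_smul, hz]
  have hgint : Integrable g (μ.toSphere.prod (.volumeIoiPow (Module.finrank ℝ (Space d) - 1))) := by
    rw [← hmp.integrable_comp_emb hemb]
    have : g ∘ (homeomorphUnitSphereProd (Space d)) =
        (fun z => G (c + z)) ∘ (Subtype.val : ({0}ᶜ : Set (Space d)) → Space d) :=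
      funext hgcomp
    rw [this, ← integrableOn_iff_comap_subtypeVal (measurableSet_singleton _).compl]
    exact hG'.integrableOn
  calc ∫ z, G z ∂μ = ∫ z, G (c + z) ∂μ := (integral_add_left_eq_self G c).symm
    _ = ∫ z : ({(0)}ᶜ : Set (Space d)), G (c + z.1) ∂(μ.comap (↑)) := by
      rw [integral_subtype_comap (measurableSet_singleton _).compl fun z => G (c + z),
        restrict_compl_singleton]
    _ = ∫ p, g p ∂(μ.toSphere.prod (.volumeIoiPow (Module.finrank ℝ (Space d) - 1))) := by
      rw [← hmp.integral_comp hemb]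
      exact integral_congr_ae (Eventually.of_forall fun z => (hgcomp z).symm)
    _ = ∫ r : Set.Ioi (0 : ℝ), (∫ ω, G (c + r.1 • (ω : Space d)) ∂μ.toSphere)
          ∂(.volumeIoiPow (Module.finrank ℝ (Space d) - 1)) := integral_prod_symm _ hgint
    _ = _ := by
      simp only [Measure.volumeIoiPow, ENNReal.ofReal]
      rw [integral_withDensity_eq_integral_smul,
        integral_subtype_comap measurableSet_Ioi fun a : ℝ =>
          Real.toNNReal (a ^ (Module.finrank ℝ (Space d) - 1)) •
            ∫ ω : Metric.sphere (0 : Space d) 1, G (c + a • (ω : Space d)) ∂μ.toSphere]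
      · refine setIntegral_congr_fun measurableSet_Ioi fun x hx => ?_
        simp only [finrank_euclideanSpace, Fintype.card_fin]
        rw [NNReal.smul_def, Real.coe_toNNReal _ (pow_nonneg hx.out.le _)]
      · exact (measurable_subtype_coe.pow_const _).real_toNNReal

/-- The flux of `v ∇w - w ∇v` through the sphere of radius `r` around `c`. -/
noncomputable def flux {d : ℕ} (v w : Space d → ℂ) (c : Space d) (r : ℝ) : ℂ :=
  (r ^ (d - 1) : ℝ) • ∫ ω : Metric.sphere (0 : Space d) 1,
    greenField v w (c + r • (ω : Space d)) ω ∂(volume : Measure (Space d)).toSphere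

lemma continuousOn_flux {d : ℕ} {U : Set (Space d)} (hU : IsOpen U) {v w : Space d → ℂ}
    (hv : ContDiffOn ℝ 2 v U) (hw : ContDiffOn ℝ 2 w U) (c : Space d) {s : Set ℝ} (hloc : IsLocallyClosed s)
    (hs : ∀ r ∈ s, ∀ ω ∈ Metric.sphere (0 : Space d) 1, c + r • ω ∈ U) :
    ContinuousOn (flux v w c) s := by
  refine ContinuousOn.smul (f := fun r : ℝ => r ^ (d - 1)) (by fun_prop) ?_
  have := hloc.locallyCompactSpace
  rw [continuousOn_iff_continuous_domRestrict]
  refine (continuous_parametric_integral_of_continuous (μ := (volume : Measure (Space d)).toSphere)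
    (f := fun (r : s) (ω : Metric.sphere (0 : Space d) 1) =>
      greenField v w (c + r.1 • (ω : Space d)) ω) ?_ (s := Set.univ) isCompact_univ).congr ?_
  · refine (continuousOn_greenField hU hv hw).comp_continuous
      (f := fun p : s × Metric.sphere (0 : Space d) 1 => (c + p.1.1 • (p.2 : Space d), (p.2 : Space d)))
      (by fun_prop) fun p => ⟨hs _ p.1.2 _ p.2.2, trivial⟩
  · intro r
    simp [Set.domRestrict]

/-- A smooth radial cutoff around `c`. -/
noncomputable def radialStep {d : ℕ} (c : Space d) (a ε : ℝ) (z : Space d) : ℝ :=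
  smoothStep a ε ‖z - c‖

lemma radialStep_eventually_zero {d : ℕ} (c : Space d) {a ε : ℝ} (ha : 0 < a) (hε : 0 < ε) :
    radialStep c a ε =ᶠ[𝓝 c] fun _ => 0 := by
  filter_upwards [Metric.ball_mem_nhds c ha] with z hz
  exact smoothStep_of_le hε (by rw [← dist_eq_norm]; exact (Metric.mem_ball.1 hz).le)

/-- The norm is not differentiable at the centre, but the cutoff vanishes identically near it
because `a > 0`. -/
lemma contDiff_radialStep {d : ℕ} (c : Space d) {a ε : ℝ} (ha : 0 < a) (hε : 0 < ε) :
    ContDiff ℝ 1 (radialStep c a ε) := by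
  rw [contDiff_iff_contDiffAt]
  intro z
  by_cases hz : z = c
  · subst hz
    exact contDiffAt_const.congr_of_eventuallyEq (radialStep_eventually_zero z ha hε)
  · exact (contDiff_smoothStep a ε).contDiffAt.comp z
      ((contDiffAt_id.sub contDiffAt_const).norm ℝ (sub_ne_zero.2 hz))

lemma hasFDerivAt_norm_sub {d : ℕ} {c z : Space d} (hz : z ≠ c) :
    HasFDerivAt (fun z => ‖z - c‖) (‖z - c‖⁻¹ • innerSL ℝ (z - c)) z := by
  have hne : ‖z - c‖ ≠ 0 := norm_ne_zero_iff.2 (sub_ne_zero.2 hz)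
  have h1 : HasFDerivAt (fun z : Space d => ‖z - c‖ ^ 2) _ z :=
    ((hasFDerivAt_id z).sub_const c).norm_sq
  have h2 := h1.sqrt (by positivity)
  refine (h2.congr_fderiv ?_).congr_of_eventuallyEq
    (Eventually.of_forall fun y => (Real.sqrt_sq (norm_nonneg _)).symm)
  ext y
  simp [Real.sqrt_sq (norm_nonneg _)]
  field_simp

lemma fderiv_radialStep {d : ℕ} (c : Space d) {a ε : ℝ} (ha : 0 < a) (hε : 0 < ε)
    (z y : Space d) :
    fderiv ℝ (radialStep c a ε) z y =
      deriv (smoothStep a ε) ‖z - c‖ * inner ℝ (‖z - c‖⁻¹ • (z - c)) y := by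
  by_cases hz : z = c
  · subst hz
    rw [(radialStep_eventually_zero z ha hε).fderiv_eq]
    simp
  · have h := (hasDerivAt_smoothStep a ε ‖z - c‖).comp_hasFDerivAt z (hasFDerivAt_norm_sub hz)
    have h' : fderiv ℝ (radialStep c a ε) z = _ := h.fderiv
    rw [h']
    simp [inner_smul_left, inner_sub_left]

lemma tsupport_fderiv_radialStep_subset {d : ℕ} (c : Space d) {a ε : ℝ} (ha : 0 < a)
    (hε : 0 < ε) (y : Space d) :
    tsupport (fun z => fderiv ℝ (radialStep c a ε) z y) ⊆ {z | ‖z - c‖ ∈ Set.Icc a (a + ε)} := by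
  refine closure_minimal (fun z hz => ?_) (isClosed_Icc.preimage (by fun_prop))
  by_contra h
  exact hz (by simp only; rw [fderiv_radialStep c ha hε, deriv_smoothStep_eq_zero hε h, zero_mul])

lemma integrable_fderiv_radialStep_smul_greenField {d : ℕ} {U : Set (Space d)} (hU : IsOpen U)
    {v w : Space d → ℂ} (hv : ContDiffOn ℝ 2 v U) (hw : ContDiffOn ℝ 2 w U)
    {c : Space d} {a ε : ℝ} (ha : 0 < a) (hε : 0 < ε)
    (hsub : ∀ z, ‖z - c‖ ∈ Set.Icc a (a + ε) → z ∈ U) :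
    Integrable (fun z => ∑ i, fderiv ℝ (radialStep c a ε) z (EuclideanSpace.basisFun (Fin d) ℝ i) •
      greenField v w z (EuclideanSpace.basisFun (Fin d) ℝ i)) := by
  refine integrable_finsetSum _ fun i _ => ?_
  have hs := tsupport_fderiv_radialStep_subset c ha hε (EuclideanSpace.basisFun (Fin d) ℝ i)
  refine integrable_smul_of_tsupport_subset hU
    (((contDiff_radialStep c ha hε).continuous_fderiv (by norm_num)).clm_apply continuous_const)
    (HasCompactSupport.of_support_subset_isCompact (isCompact_closedBall c (a + ε)) ?_)
    (hs.trans hsub) (continuousOn_greenField_left hU hv hw _)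
  intro z hz
  rw [Metric.mem_closedBall, dist_eq_norm]
  exact (hs (subset_tsupport _ hz)).2

/-- The gradient of a radial cutoff points along the unit normal, so pairing it with the coordinate
components of the Green field recombines, by linearity, into the normal component. -/
lemma greenField_eq_sum {d : ℕ} (v w : Space d → ℂ) (z n : Space d) :
    ∑ i, inner ℝ n (EuclideanSpace.basisFun (Fin d) ℝ i) •
      greenField v w z (EuclideanSpace.basisFun (Fin d) ℝ i) = greenField v w z n := by
  set b := EuclideanSpace.basisFun (Fin d) ℝ
  have key : ∀ L : Space d →L[ℝ] ℂ, ∑ i, inner ℝ n (b i) • L (b i) = L n := by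
    intro L
    conv_rhs => rw [← b.sum_repr' n]
    simp [map_sum, real_inner_comm]
  simp only [greenField, smul_sub, Finset.sum_sub_distrib]
  rw [← key (fderiv ℝ w z), ← key (fderiv ℝ v z), Finset.mul_sum, Finset.mul_sum]
  simp only [mul_smul_comm]

/-- The integral of the Green vector field against the gradient of a radial cutoff is an average
of fluxes. -/
lemma integral_fderiv_radialStep_smul_greenField {d : ℕ} [NeZero d] {U : Set (Space d)}
    (hU : IsOpen U) {v w : Space d → ℂ} (hv : ContDiffOn ℝ 2 v U) (hw : ContDiffOn ℝ 2 w U)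
    {c : Space d} {a ε : ℝ} (ha : 0 < a) (hε : 0 < ε)
    (hsub : ∀ z, ‖z - c‖ ∈ Set.Icc a (a + ε) → z ∈ U) :
    ∫ z, ∑ i, fderiv ℝ (radialStep c a ε) z (EuclideanSpace.basisFun (Fin d) ℝ i) •
      greenField v w z (EuclideanSpace.basisFun (Fin d) ℝ i) = stepAverage a ε (flux v w c) := by
  rw [integral_polar (integrable_fderiv_radialStep_smul_greenField hU hv hw ha hε hsub) c,
    stepAverage]
  refine setIntegral_congr_fun measurableSet_Ioi fun r (hr : 0 < r) => ?_
  -- On a fixed sphere the derivative of the cutoff is a constant factor, and what remains is the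
  -- flux density.
  rw [flux, smul_comm, ← integral_smul (deriv (smoothStep a ε) r)]
  congr 1
  refine integral_congr_ae (Eventually.of_forall fun ω => ?_)
  have hω : ‖(ω : Space d)‖ = 1 := by simp
  simp only [fderiv_radialStep c ha hε, add_sub_cancel_left, norm_smul, hω, mul_one,
    Real.norm_of_nonneg hr.le, smul_smul, inv_mul_cancel₀ hr.ne', one_smul]
  rw [← greenField_eq_sum, Finset.smul_sum]
  simp only [smul_smul]

/-! ### Conservation of the flux and its jump at a singularity -/

lemma isOpen_exterior {d : ℕ} (ρ : ℝ) : IsOpen {z : Space d | ρ < ‖z‖} :=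
  isOpen_lt continuous_const continuous_norm

lemma norm_smul_sphere {d : ℕ} {r : ℝ} (hr : 0 ≤ r) (ω : Metric.sphere (0 : Space d) 1) :
    ‖r • (ω : Space d)‖ = r := by
  have hω : ‖(ω : Space d)‖ = 1 := by simp
  rw [norm_smul, hω, mul_one, Real.norm_of_nonneg hr]

lemma tsupport_subset_of_isClosed {d : ℕ} {ψ : Space d → ℝ} {K : Set (Space d)} (hK : IsClosed K)
    (h : ∀ z ∉ K, ψ z = 0) : tsupport ψ ⊆ K :=
  closure_minimal (fun z hz => by by_contra hzK; exact hz (h z hzK)) hK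

lemma hasCompactSupport_of_norm_le {d : ℕ} {ψ : Space d → ℝ} {r : ℝ}
    (h : ∀ z, r < ‖z‖ → ψ z = 0) : HasCompactSupport ψ :=
  HasCompactSupport.of_support_subset_isCompact (isCompact_closedBall 0 r) fun z hz => by
    rw [mem_closedBall_zero_iff]
    by_contra hzr
    exact hz (h z (not_le.1 hzr))

/-- The flux through spheres around the origin does not depend on the radius. -/
lemma flux_zero_eq {d : ℕ} [NeZero d] {κ ρ : ℝ} (hρ : 0 ≤ ρ) {v w : Space d → ℂ}
    (hv : IsHelmholtzOn κ {z : Space d | ρ < ‖z‖} v)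
    (hw : IsHelmholtzOn κ {z : Space d | ρ < ‖z‖} w) {a b : ℝ} (ha : ρ < a) (hab : a < b) :
    flux v w 0 a = flux v w 0 b := by
  have hU := isOpen_exterior (d := d) ρ
  have ha0 : 0 < a := hρ.trans_lt ha
  have hb0 : 0 < b := ha0.trans hab
  have hcont : ∀ t, ρ < t → ContinuousOn (flux v w 0) (Set.Icc t (t + 1)) := fun t ht =>
    continuousOn_flux hU hv.contDiffOn hw.contDiffOn 0 isClosed_Icc.isLocallyClosed
      fun r hr ω hω => by
        have : ‖r • ω‖ = r := norm_smul_sphere (by linarith [hr.1]) ⟨ω, hω⟩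
        simp only [zero_add, Set.mem_ofPred_eq, this]
        linarith [hr.1]
  -- The difference of the steps at `a` and `b` is an admissible test function: it vanishes for `‖z‖
  -- < a`, and both steps equal one beyond `b + ε`.
  have key : ∀ ε > 0, stepAverage a ε (flux v w 0) - stepAverage b ε (flux v w 0) = 0 := by
    intro ε hε
    have hsub : ∀ t, ρ < t → ∀ z : Space d, ‖z - 0‖ ∈ Set.Icc t (t + ε) → ρ < ‖z‖ := by
      intro t ht z hz
      rw [sub_zero] at hz
      exact ht.trans_le hz.1
    have hφa := contDiff_radialStep (0 : Space d) ha0 hε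
    have hφb := contDiff_radialStep (0 : Space d) hb0 hε
    rw [← integral_fderiv_radialStep_smul_greenField hU hv.contDiffOn hw.contDiffOn ha0 hε
        (hsub a ha),
      ← integral_fderiv_radialStep_smul_greenField hU hv.contDiffOn hw.contDiffOn hb0 hε
        (hsub b (ha.trans hab)),
      ← integral_sub
        (integrable_fderiv_radialStep_smul_greenField hU hv.contDiffOn hw.contDiffOn ha0 hε
          (hsub a ha))
        (integrable_fderiv_radialStep_smul_greenField hU hv.contDiffOn hw.contDiffOn hb0 hε
          (hsub b (ha.trans hab)))]
    have hvan : ∀ z : Space d, b + ε < ‖z‖ → (radialStep (0 : Space d) a ε - radialStep 0 b ε : Space d → ℝ) z = 0 := by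
      intro z hz
      simp only [Pi.sub_apply, radialStep, sub_zero]
      rw [smoothStep_of_ge hε (by linarith), smoothStep_of_ge hε (by linarith), sub_self]
    have hts : tsupport (radialStep (0 : Space d) a ε - radialStep 0 b ε) ⊆ {z | a ≤ ‖z‖} := by
      refine tsupport_subset_of_isClosed (isClosed_le continuous_const continuous_norm)
        fun z hz => ?_
      have hz : ‖z‖ < a := not_le.1 hz
      simp only [Pi.sub_apply, radialStep, sub_zero]
      rw [smoothStep_of_le hε hz.le, smoothStep_of_le hε (by linarith), sub_self]
    have := integral_fderiv_smul_greenField_eq_zero hU hv hw (hφa.sub hφb)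
      (hasCompactSupport_of_norm_le hvan) (hts.trans fun z hz => ha.trans_le hz)
    rw [← this]
    congr 1
    ext z
    rw [fderiv_fun_sub (hφa.differentiable (by norm_num) z) (hφb.differentiable (by norm_num) z)]
    simp [sub_smul, Finset.sum_sub_distrib]
  have hlim := (tendsto_stepAverage ha0 one_pos (hcont a ha)).sub
    (tendsto_stepAverage hb0 one_pos (hcont b (ha.trans hab)))
  have hlim' : Tendsto (fun ε => stepAverage a ε (flux v w 0) - stepAverage b ε (flux v w 0))
      (𝓝[>] 0) (𝓝 0) :=
    tendsto_const_nhds.congr' (by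
      filter_upwards [self_mem_nhdsWithin] with ε hε using (key ε hε).symm)
  exact sub_eq_zero.1 (tendsto_nhds_unique hlim hlim')

/-- The jump of the flux across a point singularity `x` of the second function. -/
lemma flux_zero_sub {d : ℕ} [NeZero d] {κ ρ : ℝ} (hρ : 0 ≤ ρ) {x : Space d} {v w : Space d → ℂ}
    (hv : IsHelmholtzOn κ {z : Space d | ρ < ‖z‖} v)
    (hw : IsHelmholtzOn κ {x}ᶜ w) {a b s : ℝ} (ha : ρ < a) (hs : 0 < s) (hax : a < ‖x‖ - s)
    (hxb : ‖x‖ + s < b) :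
    flux v w 0 a - flux v w 0 b + flux v w x s = 0 := by
  set U : Set (Space d) := {z : Space d | ρ < ‖z‖} ∩ {x}ᶜ
  have hU : IsOpen U := (isOpen_exterior ρ).inter isOpen_compl_singleton
  replace hv : IsHelmholtzOn κ U v := hv.mono Set.inter_subset_left
  replace hw : IsHelmholtzOn κ U w := hw.mono Set.inter_subset_right
  have ha0 : 0 < a := hρ.trans_lt ha
  have hb0 : 0 < b := by linarith
  -- Shells of this thickness do not interfere: the one around `x` lies between the centred shells
  -- at `a` and `b`. The factor `1/2` leaves room for both the shell at `a` and the shell around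
  -- `x`.
  set ε₀ : ℝ := min ((‖x‖ - s - a) / 2) (b - (‖x‖ + s)) with hε₀def
  have hε₀ : 0 < ε₀ := lt_min (by linarith) (by linarith)
  have hε₁ : ε₀ ≤ (‖x‖ - s - a) / 2 := min_le_left _ _
  have hε₂ : ε₀ ≤ b - (‖x‖ + s) := min_le_right _ _
  have hsuba : ∀ z : Space d, ‖z - 0‖ ∈ Set.Icc a (a + ε₀) → z ∈ U := by
    intro z hz
    rw [sub_zero] at hz
    refine ⟨ha.trans_le hz.1, fun h => ?_⟩
    rw [Set.mem_singleton_iff.1 h] at hz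
    linarith [hz.2]
  have hsubb : ∀ z : Space d, ‖z - 0‖ ∈ Set.Icc b (b + ε₀) → z ∈ U := by
    intro z hz
    rw [sub_zero] at hz
    refine ⟨show ρ < ‖z‖ by linarith [hz.1], fun h => ?_⟩
    rw [Set.mem_singleton_iff.1 h] at hz
    linarith [hz.1]
  have hsubx : ∀ z : Space d, ‖z - x‖ ∈ Set.Icc s (s + ε₀) → z ∈ U := by
    intro z hz
    refine ⟨show ρ < ‖z‖ by linarith [hz.2, norm_sub_norm_le x z, norm_sub_rev x z], fun h => ?_⟩
    rw [Set.mem_singleton_iff.1 h, sub_self, norm_zero] at hz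
    linarith [hz.1]
  have hcont : ∀ (c : Space d) (t : ℝ), 0 < t →
      (∀ z : Space d, ‖z - c‖ ∈ Set.Icc t (t + ε₀) → z ∈ U) →
      ContinuousOn (flux v w c) (Set.Icc t (t + ε₀)) := fun c t ht h =>
    continuousOn_flux hU hv.contDiffOn hw.contDiffOn c isClosed_Icc.isLocallyClosed
      fun r hr ω hω => h _ (by
        rwa [add_sub_cancel_left, norm_smul_sphere (by linarith [hr.1]) ⟨ω, hω⟩])
  have key : ∀ ε, 0 < ε → ε ≤ ε₀ → stepAverage a ε (flux v w 0) - stepAverage b ε (flux v w 0)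
      + stepAverage s ε (flux v w x) = 0 := by
    intro ε hε hle
    have hmono : ∀ (c : Space d) (t : ℝ),
      (∀ z : Space d, ‖z - c‖ ∈ Set.Icc t (t + ε₀) → z ∈ U) →
      (∀ z : Space d, ‖z - c‖ ∈ Set.Icc t (t + ε) → z ∈ U) := fun c t h z hz =>
        h z ⟨hz.1, by linarith [hz.2]⟩
    have hφa := contDiff_radialStep (0 : Space d) ha0 hε
    have hφb := contDiff_radialStep (0 : Space d) hb0 hε
    have hφx := contDiff_radialStep x hs hε
    have hIa := integrable_fderiv_radialStep_smul_greenField hU hv.contDiffOn hw.contDiffOn ha0 hε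
        (hmono 0 a hsuba)
    have hIb := integrable_fderiv_radialStep_smul_greenField hU hv.contDiffOn hw.contDiffOn hb0 hε
        (hmono 0 b hsubb)
    have hIx := integrable_fderiv_radialStep_smul_greenField hU hv.contDiffOn hw.contDiffOn hs hε
        (hmono x s hsubx)
    rw [← integral_fderiv_radialStep_smul_greenField hU hv.contDiffOn hw.contDiffOn ha0 hε
        (hmono 0 a hsuba),
      ← integral_fderiv_radialStep_smul_greenField hU hv.contDiffOn hw.contDiffOn hb0 hε
        (hmono 0 b hsubb),
      ← integral_fderiv_radialStep_smul_greenField hU hv.contDiffOn hw.contDiffOn hs hε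
        (hmono x s hsubx), ← integral_sub' hIa hIb,
      ← integral_add' (hIa.sub hIb) hIx]
    -- A smoothed, negated indicator of the excluded regions would be noncompact, so the steps are
    -- combined with signs: the sum is `0 - 0 + 1 - 1` near the origin, `1 - 0 + 0 - 1` near `x` and
    -- `1 - 1 + 1 - 1` far out. Thus `ψ` is compactly supported away from the singularity, and
    -- subtracting `1` does not affect the gradient.
    set ψ : Space d → ℝ := fun z =>
      radialStep 0 a ε z - radialStep 0 b ε z + radialStep x s ε z - 1 with hψdef
    have hψ : ContDiff ℝ 1 ψ := ((hφa.sub hφb).add hφx).sub contDiff_const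
    have hvan : ∀ z : Space d, b + ε < ‖z‖ → ψ z = 0 := by
      intro z hz
      have h1 := norm_sub_norm_le z x
      simp only [hψdef, radialStep, sub_zero]
      rw [smoothStep_of_ge hε (by linarith), smoothStep_of_ge hε (by linarith),
        smoothStep_of_ge hε (by linarith)]
      ring
    have hts : tsupport ψ ⊆ {z | a ≤ ‖z‖ ∧ s ≤ ‖z - x‖} := by
      refine tsupport_subset_of_isClosed ((isClosed_le continuous_const continuous_norm).inter
        (isClosed_le continuous_const (continuous_id.sub continuous_const).norm)) fun z hz => ?_
      have h1 := norm_sub_norm_le x z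
      have h2 := norm_sub_norm_le z x
      have h3 := norm_sub_rev x z
      rw [Set.mem_ofPred_eq, not_and_or, not_le, not_le] at hz
      simp only [hψdef, radialStep, sub_zero]
      rcases hz with hz | hz
      · rw [smoothStep_of_le hε hz.le, smoothStep_of_le hε (by linarith),
          smoothStep_of_ge hε (by linarith)]
        ring
      · rw [smoothStep_of_ge hε (by linarith), smoothStep_of_le hε (by linarith),
          smoothStep_of_le hε hz.le]
        ring
    have := integral_fderiv_smul_greenField_eq_zero hU hv hw hψ
      (hasCompactSupport_of_norm_le hvan) (hts.trans fun z hz => ⟨ha.trans_le hz.1, fun h => by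
        have := hz.2
        rw [Set.mem_singleton_iff.1 h, sub_self, norm_zero] at this
        linarith⟩)
    rw [← this]
    congr 1
    ext z
    have hd : fderiv ℝ ψ z = fderiv ℝ (radialStep 0 a ε) z - fderiv ℝ (radialStep 0 b ε) z
        + fderiv ℝ (radialStep x s ε) z :=
      ((((hφa.differentiable (by norm_num) z).hasFDerivAt.sub
        (hφb.differentiable (by norm_num) z).hasFDerivAt).add
        (hφx.differentiable (by norm_num) z).hasFDerivAt).sub_const 1).fderiv
    rw [hd]
    simp [sub_smul, add_smul, Finset.sum_sub_distrib, Finset.sum_add_distrib]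
  have hlim := ((tendsto_stepAverage ha0 hε₀ (hcont 0 a ha0 hsuba)).sub
    (tendsto_stepAverage hb0 hε₀ (hcont 0 b hb0 hsubb))).add
    (tendsto_stepAverage hs hε₀ (hcont x s hs hsubx))
  refine tendsto_nhds_unique hlim (tendsto_const_nhds.congr' ?_)
  filter_upwards [Ioo_mem_nhdsGT hε₀] with ε hε using (key ε hε.1 hε.2.le).symm

/-! ### Radiating solutions on large spheres -/

/-- The complex conjugate of a solution of the Helmholtz equation is a solution. -/
lemma IsHelmholtzOn.conj {d : ℕ} {κ : ℝ} {U : Set (Space d)} {v : Space d → ℂ} (hU : IsOpen U)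
    (h : IsHelmholtzOn κ U v) : IsHelmholtzOn κ U (fun z => (starRingEnd ℂ) (v z)) := by
  refine ⟨Complex.conjCLE.contDiff.comp_contDiffOn h.contDiffOn, fun x hx => ?_⟩
  have h1 := (h.contDiffOn.contDiffAt (hU.mem_nhds hx)).laplacian_CLM_comp_left
    (l := (Complex.conjCLE : ℂ →L[ℝ] ℂ))
  have h2 : Laplacian.laplacian (fun z => (starRingEnd ℂ) (v z)) x =
    (starRingEnd ℂ) (Laplacian.laplacian v x) := h1
  rw [h2]
  have h3 := congrArg (starRingEnd ℂ) (h.helmholtz x hx)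
  simpa using h3

/-- The total surface measure of the unit sphere. -/
noncomputable def sphereArea (d : ℕ) : ℝ :=
  (volume : Measure (Space d)).toSphere.real Set.univ

lemma radialDeriv_smul_sphere {d : ℕ} (v : Space d → ℂ) {r : ℝ} (hr : 0 < r)
    (ω : Metric.sphere (0 : Space d) 1) :
    radialDeriv v (r • (ω : Space d)) = fderiv ℝ v (r • (ω : Space d)) ω := by
  rw [radialDeriv, norm_smul_sphere hr.le, smul_smul, inv_mul_cancel₀ hr.ne', one_smul]

lemma flux_zero_eq_integral {d : ℕ} (v w : Space d → ℂ) {r : ℝ} (hr : 0 < r) :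
    flux v w 0 r = (r ^ (d - 1) : ℝ) • ∫ ω : Metric.sphere (0 : Space d) 1,
      (v (r • (ω : Space d)) * radialDeriv w (r • (ω : Space d))
        - w (r • (ω : Space d)) * radialDeriv v (r • (ω : Space d)))
        ∂(volume : Measure (Space d)).toSphere := by
  simp only [flux, zero_add, greenField, radialDeriv_smul_sphere _ hr]

lemma continuous_sphere_of_mem {d : ℕ} {U : Set (Space d)} (hU : IsOpen U) {v : Space d → ℂ}
    (hv : ContDiffOn ℝ 2 v U) {r : ℝ} (hr : 0 < r)
    (hmem : ∀ ω : Metric.sphere (0 : Space d) 1, r • (ω : Space d) ∈ U) :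
    Continuous (fun ω : Metric.sphere (0 : Space d) 1 => v (r • (ω : Space d))) ∧
    Continuous (fun ω : Metric.sphere (0 : Space d) 1 => radialDeriv v (r • (ω : Space d))) := by
  refine ⟨hv.continuousOn.comp_continuous (by fun_prop) hmem, ?_⟩
  simp only [radialDeriv_smul_sphere _ hr]
  exact (continuousOn_fderiv_apply hU hv).comp_continuous
    (f := fun ω : Metric.sphere (0 : Space d) 1 => (r • (ω : Space d), (ω : Space d)))
    (by fun_prop) fun ω => ⟨hmem ω, trivial⟩

lemma continuous_sphere {d : ℕ} {ρ : ℝ} {v : Space d → ℂ}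
    (hv : ContDiffOn ℝ 2 v {z : Space d | ρ < ‖z‖}) {r : ℝ} (hr : 0 < r) (hρ : ρ < r) :
    Continuous (fun ω : Metric.sphere (0 : Space d) 1 => v (r • (ω : Space d))) ∧
    Continuous (fun ω : Metric.sphere (0 : Space d) 1 => radialDeriv v (r • (ω : Space d))) :=
  continuous_sphere_of_mem (isOpen_exterior ρ) hv hr fun ω => by
    rwa [Set.mem_ofPred_eq, norm_smul_sphere hr.le]

lemma integrable_sphere {d : ℕ} {E : Type*} [NormedAddCommGroup E]
    {g : Metric.sphere (0 : Space d) 1 → E} (hg : Continuous g) :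
    Integrable g (volume : Measure (Space d)).toSphere :=
  hg.integrable_of_hasCompactSupport (HasCompactSupport.of_compactSpace g)

lemma rpow_half_mul_self {d : ℕ} [NeZero d] {r : ℝ} (hr : 0 < r) :
    r ^ (((d : ℝ) - 1) / 2) * r ^ (((d : ℝ) - 1) / 2) = r ^ (d - 1) := by
  rw [← Real.rpow_add hr, add_halves, ← Real.rpow_natCast,
    Nat.cast_sub (Nat.one_le_iff_ne_zero.2 (NeZero.ne d)), Nat.cast_one]

/-- With `p = v` and `q = ∂v/∂r`, the cross term is the imaginary part of the flux density of `v`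
against its conjugate. Its integral over spheres is conserved, so smallness of the left side
controls `‖v‖²`. -/
lemma norm_sub_I_mul_sq (κ : ℝ) (p q : ℂ) :
    ‖q - Complex.I * κ * p‖ ^ 2 = ‖q‖ ^ 2 + κ ^ 2 * ‖p‖ ^ 2
      + κ * (p * (starRingEnd ℂ) q - (starRingEnd ℂ) p * q).im := by
  simp only [← Complex.normSq_eq_norm_sq, Complex.normSq_apply]
  simp
  ring

lemma radialDeriv_conj {d : ℕ} (v : Space d → ℂ) (z : Space d) :
    radialDeriv (fun z => (starRingEnd ℂ) (v z)) z = (starRingEnd ℂ) (radialDeriv v z) := by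
  have : fderiv ℝ (fun z => (starRingEnd ℂ) (v z)) z = _ :=
    Complex.conjCLE.comp_fderiv (f := v) (x := z)
  rw [radialDeriv, this]
  rfl

/-- A function that satisfies the Sommerfeld radiation condition satisfies it quantitatively on
large spheres. -/
lemma SommerfeldRadiation.eventually_sphere {d : ℕ} {κ : ℝ} {v : Space d → ℂ}
    (h : SommerfeldRadiation κ v) {δ : ℝ} (hδ : 0 < δ) :
    ∀ᶠ r : ℝ in atTop, ∀ ω : Metric.sphere (0 : Space d) 1, r ^ (((d : ℝ) - 1) / 2) *
      ‖radialDeriv v (r • (ω : Space d)) - Complex.I * κ * v (r • (ω : Space d))‖ ≤ δ := by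
  have h1 := (Metric.tendsto_nhds.1 h δ hδ)
  rw [← comap_norm_atTop, eventually_comap] at h1
  filter_upwards [h1, eventually_ge_atTop 0] with r hr hr0 ω
  have := hr _ (norm_smul_sphere hr0 ω)
  rw [dist_zero_right, norm_mul, norm_smul_sphere hr0, Complex.norm_real, Real.norm_of_nonneg
    (by positivity)] at this
  exact this.le

/-- The `L²` norms on large spheres of a radiating solution of the Helmholtz equation are
bounded. -/
lemma exists_sphere_sq_bound {d : ℕ} [NeZero d] {κ ρ : ℝ} (hκ : 0 < κ) (hρ : 0 ≤ ρ)
    {v : Space d → ℂ} (hv : IsHelmholtzOn κ {z : Space d | ρ < ‖z‖} v)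
    (hrad : SommerfeldRadiation κ v) :
    ∃ C, ∀ᶠ r : ℝ in atTop, ∫ ω : Metric.sphere (0 : Space d) 1,
      r ^ (d - 1) * ‖v (r • (ω : Space d))‖ ^ 2 ∂(volume : Measure (Space d)).toSphere ≤ C := by
  set w : Space d → ℂ := fun z => (starRingEnd ℂ) (v z) with hw_def
  have hw : IsHelmholtzOn κ {z : Space d | ρ < ‖z‖} w := hv.conj (isOpen_exterior ρ)
  set F := flux v w 0 (ρ + 1)
  -- This is the integral over the unit sphere of the pointwise bound `hpt`. It does not depend on
  -- `r`, because the flux `F` does not.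
  refine ⟨(κ ^ 2)⁻¹ * (sphereArea d - κ * F.im), ?_⟩
  filter_upwards [hrad.eventually_sphere one_pos, eventually_gt_atTop (ρ + 1)] with r h1 hr
  have hr0 : 0 < r := by linarith
  obtain ⟨cv, cdv⟩ := continuous_sphere hv.contDiffOn hr0 (by linarith)
  have hF : F = flux v w 0 r := flux_zero_eq hρ hv hw (by linarith) hr
  rw [flux_zero_eq_integral v w hr0] at hF
  set G : Metric.sphere (0 : Space d) 1 → ℂ := fun ω =>
    v (r • (ω : Space d)) * radialDeriv w (r • (ω : Space d))
        - w (r • (ω : Space d)) * radialDeriv v (r • (ω : Space d)) with hG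
  have hGc : Continuous G := by
    obtain ⟨cw, cdw⟩ := continuous_sphere hw.contDiffOn hr0 (by linarith)
    exact (cv.mul cdw).sub (cw.mul cdv)
  have hFim : F.im = ∫ ω, r ^ (d - 1) * (G ω).im ∂(volume : Measure (Space d)).toSphere := by
    rw [hF, integral_const_mul, Complex.smul_im, smul_eq_mul]
    congr 1
    exact (integral_im (𝕜 := ℂ) (integrable_sphere hGc)).symm
  have hpt : ∀ ω : Metric.sphere (0 : Space d) 1, r ^ (d - 1) * ‖v (r • (ω : Space d))‖ ^ 2 ≤
      (κ ^ 2)⁻¹ * (1 - κ * (r ^ (d - 1) * (G ω).im)) := by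
    intro ω
    have h2 := norm_sub_I_mul_sq κ (v (r • (ω : Space d))) (radialDeriv v (r • (ω : Space d)))
    have h3 : (r ^ (((d : ℝ) - 1) / 2) * ‖radialDeriv v (r • (ω : Space d))
        - Complex.I * κ * v (r • (ω : Space d))‖) ^ 2 ≤ 1 :=
      pow_le_one₀ (by positivity) (h1 ω)
    rw [mul_pow, h2, sq (r ^ _), rpow_half_mul_self hr0] at h3
    have h4 : (G ω).im = (v (r • (ω : Space d)) *
        (starRingEnd ℂ) (radialDeriv v (r • (ω : Space d))) -
        (starRingEnd ℂ) (v (r • (ω : Space d))) * radialDeriv v (r • (ω : Space d))).im := by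
      simp only [hG, hw_def, radialDeriv_conj]
    rw [← h4] at h3
    have h5 : 0 ≤ r ^ (d - 1) * ‖radialDeriv v (r • (ω : Space d))‖ ^ 2 := by positivity
    rw [le_inv_mul_iff₀ (by positivity)]
    linarith
  have hGim : Continuous fun ω => (G ω).im := Complex.continuous_im.comp hGc
  calc _ ≤ ∫ ω, (κ ^ 2)⁻¹ * (1 - κ * (r ^ (d - 1) * (G ω).im))
        ∂(volume : Measure (Space d)).toSphere :=
        integral_mono (integrable_sphere (continuous_const.mul (cv.norm.pow 2)))
          (integrable_sphere (by fun_prop)) hpt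
    _ = _ := by
        rw [integral_const_mul, integral_sub (integrable_const _)
          (integrable_sphere (by fun_prop)), integral_const_mul, ← hFim]
        simp [sphereArea]

/-- The flux between a radiating solution and a radiating kernel vanishes at infinity. -/
lemma tendsto_flux_atTop {d : ℕ} [NeZero d] {κ ρ : ℝ} (hκ : 0 < κ) (hρ : 0 ≤ ρ)
    {v w : Space d → ℂ} (hv : IsHelmholtzOn κ {z : Space d | ρ < ‖z‖} v)
    (hrad : SommerfeldRadiation κ v) {C r₀ : ℝ}
    (hw : ∀ z, r₀ ≤ ‖z‖ → ‖w z‖ ≤ C * ‖z‖ ^ (-(((d : ℝ) - 1) / 2)))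
    (hw' : ∀ z, r₀ ≤ ‖z‖ →
      ‖radialDeriv w z - Complex.I * κ * w z‖ ≤ C * ‖z‖ ^ (-(((d : ℝ) + 1) / 2))) :
    Tendsto (flux v w 0) atTop (𝓝 0) := by
  obtain ⟨B, hB⟩ := exists_sphere_sq_bound hκ hρ hv hrad
  have hA : 0 ≤ sphereArea d := measureReal_nonneg
  rw [Metric.tendsto_nhds]
  intro η hη
  set C' := max C 0 with hC'
  have hC'0 : 0 ≤ C' := le_max_right _ _
  -- Chosen so that the term carrying the radiation condition of `v` integrates to less than `η /
  -- 2`; the `+ 1` keeps the denominator positive.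
  set δ := η / 2 / (C' * sphereArea d + 1) with hδ
  have hden : 0 < C' * sphereArea d + 1 := by positivity
  have hδ0 : 0 < δ := by positivity
  have hlim : Tendsto (fun r : ℝ => C' * (sphereArea d + B) * r⁻¹) atTop (𝓝 0) := by
    simpa using tendsto_inv_atTop_zero.const_mul (C' * (sphereArea d + B))
  filter_upwards [hB, hrad.eventually_sphere hδ0, eventually_gt_atTop (max ρ (max r₀ 0)),
    hlim.eventually_lt_const (show (0 : ℝ) < η / 2 by linarith)] with r hBr hδr hr hsmall
  have hrρ : ρ < r := (le_max_left _ _).trans_lt hr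
  have hrr₀ : r₀ < r := ((le_max_left _ _).trans (le_max_right _ _)).trans_lt hr
  have hr0 : 0 < r := hρ.trans_lt hrρ
  obtain ⟨cv, cdv⟩ := continuous_sphere hv.contDiffOn hr0 hrρ
  set p := r ^ (((d : ℝ) - 1) / 2) with hp
  have hp0 : 0 < p := by positivity
  have hpp : p * p = r ^ (d - 1) := rpow_half_mul_self hr0
  have hneg : r ^ (-(((d : ℝ) - 1) / 2)) = p⁻¹ := Real.rpow_neg hr0.le _
  have hneg' : r ^ (-(((d : ℝ) + 1) / 2)) = p⁻¹ * r⁻¹ := by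
    rw [← hneg, ← Real.rpow_neg_one r, ← Real.rpow_add hr0]
    congr 1
    ring
  rw [dist_zero_right, flux_zero_eq_integral v w hr0, ← integral_smul]
  have hpt : ∀ ω : Metric.sphere (0 : Space d) 1,
      ‖(r ^ (d - 1) : ℝ) • (v (r • (ω : Space d)) * radialDeriv w (r • (ω : Space d))
        - w (r • (ω : Space d)) * radialDeriv v (r • (ω : Space d)))‖ ≤
      C' * r⁻¹ * (1 + r ^ (d - 1) * ‖v (r • (ω : Space d))‖ ^ 2) + C' * δ := by
    intro ω
    have hn := norm_smul_sphere hr0.le ω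
    have h1 := hw (r • (ω : Space d)) (by rw [hn]; exact hrr₀.le)
    have h2 := hw' (r • (ω : Space d)) (by rw [hn]; exact hrr₀.le)
    have h3 := hδr ω
    rw [hn, hneg] at h1
    rw [hn, hneg'] at h2
    set V := v (r • (ω : Space d))
    set W := w (r • (ω : Space d))
    set V' := radialDeriv v (r • (ω : Space d))
    set W' := radialDeriv w (r • (ω : Space d))
    -- Adding and subtracting `iκVW` exposes both radiation defects. After multiplication by `p²`,
    -- the first product is of order `r⁻¹ · p‖V‖`, which the `L²` bound controls, and the second is
    -- at most a multiple of `δ`.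
    have hid : V * W' - W * V' =
        V * (W' - Complex.I * κ * W) - W * (V' - Complex.I * κ * V) := by ring
    have h1' : ‖W‖ ≤ C' * p⁻¹ := h1.trans (by gcongr; exact le_max_left _ _)
    have h2' : ‖W' - Complex.I * κ * W‖ ≤ C' * (p⁻¹ * r⁻¹) :=
      h2.trans (by gcongr; exact le_max_left _ _)
    rw [norm_smul, Real.norm_of_nonneg (by positivity), hid, ← hpp]
    calc p * p * ‖V * (W' - Complex.I * κ * W) - W * (V' - Complex.I * κ * V)‖
        ≤ p * p * (‖V‖ * (C' * (p⁻¹ * r⁻¹)) + (C' * p⁻¹) * ‖V' - Complex.I * κ * V‖) := by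
          gcongr
          refine (norm_sub_le _ _).trans ?_
          rw [norm_mul, norm_mul]
          gcongr
      _ = C' * r⁻¹ * (p * ‖V‖) + C' * (p * ‖V' - Complex.I * κ * V‖) := by
          field_simp
      _ ≤ C' * r⁻¹ * (1 + p * p * ‖V‖ ^ 2) + C' * δ := by
          gcongr
          -- The bound `t ≤ 1 + t²` with `t = p‖V‖` trades the first power for the square, whose
          -- integral is bounded.
          nlinarith [sq_nonneg (p * ‖V‖ - 1), sq_nonneg (p * ‖V‖)]
  have hcont : Continuous (fun ω : Metric.sphere (0 : Space d) 1 =>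
      r ^ (d - 1) * ‖v (r • (ω : Space d))‖ ^ 2) := continuous_const.mul (cv.norm.pow 2)
  have hcont₂ : Continuous (fun ω : Metric.sphere (0 : Space d) 1 =>
      C' * r⁻¹ * (1 + r ^ (d - 1) * ‖v (r • (ω : Space d))‖ ^ 2)) :=
    continuous_const.mul (continuous_const.add hcont)
  have hcont₃ : Continuous (fun ω : Metric.sphere (0 : Space d) 1 =>
      C' * r⁻¹ * (1 + r ^ (d - 1) * ‖v (r • (ω : Space d))‖ ^ 2) + C' * δ) :=
    hcont₂.add continuous_const
  refine lt_of_le_of_lt (norm_integral_le_of_norm_le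
    (integrable_sphere hcont₃)
    (Eventually.of_forall hpt)) ?_
  rw [integral_add (integrable_sphere hcont₂) (integrable_const _), integral_const_mul,
    integral_add (integrable_const _) (integrable_sphere hcont)]
  have hc : ∀ t : ℝ, ∫ _ : Metric.sphere (0 : Space d) 1, t
      ∂(volume : Measure (Space d)).toSphere = sphereArea d * t := fun t => by
    simp [sphereArea]
  rw [hc, hc]
  have h6 : sphereArea d * (C' * δ) < η / 2 := by
    rw [hδ, mul_div_assoc', mul_div_assoc', div_lt_iff₀ hden]
    nlinarith
  have h7 : C' * r⁻¹ * (sphereArea d * 1 + ∫ ω : Metric.sphere (0 : Space d) 1,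
      r ^ (d - 1) * ‖v (r • (ω : Space d))‖ ^ 2 ∂(volume : Measure (Space d)).toSphere) ≤
      C' * (sphereArea d + B) * r⁻¹ := by
    rw [mul_one, mul_right_comm C' r⁻¹]
    gcongr
  linarith

/-! ### Radial fundamental solutions -/

/-- The radial profile `f`, with derivative `f'`, of an outgoing fundamental solution
`z ↦ f |z - x|` of the Helmholtz equation with far-field constant `c`. -/
structure IsOutgoingProfile (d : ℕ) (κ : ℝ) (c : ℂ) (f f' : ℝ → ℂ) : Prop where
  hasDerivAt : ∀ r, 0 < r → HasDerivAt f (f' r) r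
  hasDerivAt_deriv : ∀ r, 0 < r →
    HasDerivAt f' (-(((d - 1) / r : ℝ) * f' r) - (κ : ℂ) ^ 2 * f r) r
  tendsto_zero : Tendsto (fun r => (r ^ (d - 1) : ℝ) • f r) (𝓝[>] 0) (𝓝 0)
  tendsto_deriv_zero : Tendsto (fun r => (sphereArea d * r ^ (d - 1) : ℝ) • f' r) (𝓝[>] 0) (𝓝 (-1))
  asymptotics : ∃ C, ∀ r, 0 < r →
    ‖f r - c * (Complex.exp (Complex.I * (κ * r : ℝ)) * (r ^ (-(((d : ℝ) - 1) / 2)) : ℝ))‖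
      ≤ C * r ^ (-(((d : ℝ) + 1) / 2))
  asymptotics_deriv : ∃ C, ∀ r, 0 < r →
    ‖f' r - Complex.I * κ * f r‖ ≤ C * r ^ (-(((d : ℝ) + 1) / 2))

namespace IsOutgoingProfile

variable {d : ℕ} {κ : ℝ} {c : ℂ} {f f' : ℝ → ℂ}

/-- The differential equation bootstraps regularity: it expresses the derivative of `f'` through the
continuous functions `f` and `f'`. -/
lemma contDiffOn (h : IsOutgoingProfile d κ c f f') : ContDiffOn ℝ 2 f (Set.Ioi 0) := by
  have hd : ∀ r, 0 < r → DifferentiableAt ℝ f' r := fun r hr => (h.hasDerivAt_deriv r hr).differentiableAt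
  have hfc : ContinuousOn f (Set.Ioi 0) := fun r hr =>
    (h.hasDerivAt r hr).continuousAt.continuousWithinAt
  have hfc' : ContinuousOn f' (Set.Ioi 0) := fun r hr =>
    (hd r hr).continuousAt.continuousWithinAt
  have h1 : ContDiffOn ℝ 1 f' (Set.Ioi 0) := by
    rw [show (1 : WithTop ℕ∞) = 0 + 1 from rfl, contDiffOn_succ_iff_deriv_of_isOpen isOpen_Ioi]
    refine ⟨fun r hr => (hd r hr).differentiableWithinAt, by simp, contDiffOn_zero.2 ?_⟩
    refine ContinuousOn.congr (f := fun r : ℝ => -(((d - 1) / r : ℝ) * f' r) - (κ : ℂ) ^ 2 * f r)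
      ?_ fun r hr => (h.hasDerivAt_deriv r hr).deriv
    refine ContinuousOn.sub (ContinuousOn.neg (ContinuousOn.mul ?_ hfc'))
      (continuousOn_const.mul hfc)
    exact Complex.continuous_ofReal.comp_continuousOn
      (continuousOn_const.div continuousOn_id fun r hr => (ne_of_gt hr))
  rw [show (2 : WithTop ℕ∞) = 1 + 1 from one_add_one_eq_two.symm,
    contDiffOn_succ_iff_deriv_of_isOpen isOpen_Ioi]
  refine ⟨fun r hr => (h.hasDerivAt r hr).differentiableAt.differentiableWithinAt, by simp, ?_⟩
  exact h1.congr fun r hr => (h.hasDerivAt r hr).deriv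

lemma fderiv_comp_norm (h : IsOutgoingProfile d κ c f f') {x z : Space d} (hz : z ≠ x)
    (y : Space d) : fderiv ℝ (fun z => f ‖z - x‖) z y =
      f' ‖z - x‖ * (inner ℝ (‖z - x‖⁻¹ • (z - x)) y : ℝ) := by
  have hρ : 0 < ‖z - x‖ := norm_pos_iff.2 (sub_ne_zero.2 hz)
  have h1 := (h.hasDerivAt _ hρ).hasFDerivAt.comp z (hasFDerivAt_norm_sub hz)
  have h' : fderiv ℝ (fun z => f ‖z - x‖) z = _ := h1.fderiv
  rw [h']
  simp [inner_smul_left, inner_sub_left]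
  ring

/-- With `ρ = ‖z - x‖` and `g = f'/ρ`, the derivative along `y` is `g(ρ)⟨z - x, y⟩`. Differentiating
again and summing over an orthonormal basis gives `d g + ρ g' = f'' + (d-1)/ρ · f'`, which the
radial equation identifies with `-κ² f`. -/
lemma isHelmholtzOn (h : IsOutgoingProfile d κ c f f') (x : Space d) :
    IsHelmholtzOn κ {x}ᶜ (fun z => f ‖z - x‖) := by
  have hCD : ContDiffOn ℝ 2 (fun z => f ‖z - x‖) {x}ᶜ := by
    refine h.contDiffOn.comp (f := fun z => ‖z - x‖) ?_ fun z hz =>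
      norm_pos_iff.2 (sub_ne_zero.2 hz)
    exact fun z hz => ((contDiffAt_id.sub contDiffAt_const).norm ℝ
      (sub_ne_zero.2 hz)).contDiffWithinAt
  refine ⟨hCD, fun z hz => ?_⟩
  have hz : z ≠ x := hz
  have hρ : 0 < ‖z - x‖ := norm_pos_iff.2 (sub_ne_zero.2 hz)
  set ρ := ‖z - x‖ with hρdef
  have hρC : (ρ : ℂ) ≠ 0 := Complex.ofReal_ne_zero.2 hρ.ne'
  set b := EuclideanSpace.basisFun (Fin d) ℝ
  set g : ℝ → ℂ := fun r => f' r * (r⁻¹ : ℝ) with hg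
  set g' : ℂ := (-(((d - 1) / ρ : ℝ) * f' ρ) - (κ : ℂ) ^ 2 * f ρ) * (ρ⁻¹ : ℝ)
    + f' ρ * ((-(ρ ^ 2)⁻¹ : ℝ) : ℂ) with hg'
  have hgd : HasDerivAt g g' ρ :=
    (h.hasDerivAt_deriv ρ hρ).mul (hasDerivAt_inv hρ.ne').ofReal_comp
  have hsecond : ∀ y : Space d, fderiv ℝ (fderiv ℝ (fun z => f ‖z - x‖)) z y y =
      g ρ * (inner ℝ y y : ℝ) + g' * (ρ⁻¹ * (inner ℝ (z - x) y) ^ 2 : ℝ) := by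
    intro y
    have h2 : ContDiffAt ℝ 2 (fun z => f ‖z - x‖) z :=
      hCD.contDiffAt (isOpen_compl_singleton.mem_nhds hz)
    have h3 : DifferentiableAt ℝ (fderiv ℝ (fun z => f ‖z - x‖)) z :=
      (h2.fderiv_right (m := 1) (by norm_num)).differentiableAt (by norm_num)
    have h4 : fderiv ℝ (fun u => fderiv ℝ (fun z => f ‖z - x‖) u y) z y =
        fderiv ℝ (fderiv ℝ (fun z => f ‖z - x‖)) z y y := by
      rw [fderiv_clm_apply h3 (differentiableAt_const y)]
      simp
    have h5 : (fun u => fderiv ℝ (fun z => f ‖z - x‖) u y) =ᶠ[𝓝 z]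
        fun u => g ‖u - x‖ * ((inner ℝ (u - x) y : ℝ) : ℂ) := by
      filter_upwards [isOpen_compl_singleton.mem_nhds hz] with u hu
      rw [h.fderiv_comp_norm hu, hg, inner_smul_left]
      simp [mul_assoc]
    have h6 : HasFDerivAt (fun u : Space d => ((inner ℝ (u - x) y : ℝ) : ℂ))
        (Complex.ofRealCLM.comp (innerSL ℝ y)) z := by
      refine Complex.ofRealCLM.hasFDerivAt.comp z (f := fun u : Space d => inner ℝ (u - x) y) ?_
      have := (innerSL ℝ y).hasFDerivAt.comp z ((hasFDerivAt_id z).sub_const x)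
      simp only [ContinuousLinearMap.comp_id] at this
      refine this.congr_of_eventuallyEq (Eventually.of_forall fun u => ?_)
      exact real_inner_comm _ _
    have h7 := (hgd.hasFDerivAt.comp z (hasFDerivAt_norm_sub hz)).mul h6
    have h8 : fderiv ℝ (fun u => g ‖u - x‖ * ((inner ℝ (u - x) y : ℝ) : ℂ)) z = _ := h7.fderiv
    rw [← h4, h5.fderiv_eq, h8]
    simp [inner_sub_left]
    ring
  rw [laplacian_eq_sum_fderiv, Finset.sum_congr rfl fun i _ => hsecond (b i),
    Finset.sum_add_distrib, ← Finset.mul_sum, ← Finset.mul_sum, ← Complex.ofReal_sum,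
    ← Complex.ofReal_sum, ← Finset.mul_sum]
  have hs1 : ∑ i, inner ℝ (b i) (b i) = (d : ℝ) := by simp
  have hs2 : ∑ i, inner ℝ (z - x) (b i) ^ 2 = ρ ^ 2 := by
    rw [hρdef, ← b.sum_sq_norm_inner_left (z - x)]
    simp
  rw [hs1, hs2, hg, hg']
  push_cast
  field_simp
  ring

/-- On a small sphere the profile and its derivative are constants. The area factor times `f'` tends
to `-1` and multiplies the mean of `v`, which tends to `v x`; the factor `r^{d-1} f` tends to `0`
and multiplies a convergent integral. -/
lemma tendsto_flux [NeZero d] (h : IsOutgoingProfile d κ c f f') {x : Space d} {v : Space d → ℂ}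
    {U : Set (Space d)} (hU : IsOpen U) (hx : x ∈ U) (hv : ContDiffOn ℝ 2 v U) :
    Tendsto (flux v (fun z => f ‖z - x‖) x) (𝓝[>] 0) (𝓝 (-v x)) := by
  obtain ⟨δ, hδ, hball⟩ := Metric.nhds_basis_closedBall.mem_iff.1 (hU.mem_nhds hx)
  set μ := (volume : Measure (Space d)).toSphere
  have hmem : ∀ (s : Set.Icc 0 δ) (ω : Metric.sphere (0 : Space d) 1),
      x + s.1 • (ω : Space d) ∈ U := fun s ω => hball (by
    rw [mem_closedBall_iff_norm, add_sub_cancel_left, norm_smul_sphere s.2.1]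
    exact s.2.2)
  have hlim : ∀ F : ℝ → Metric.sphere (0 : Space d) 1 → ℂ,
      Continuous (fun p : Set.Icc 0 δ × Metric.sphere (0 : Space d) 1 => F p.1 p.2) →
      Tendsto (fun s => ∫ ω, F s ω ∂μ) (𝓝[>] 0) (𝓝 (∫ ω, F 0 ω ∂μ)) := by
    intro F hF
    have hc := continuous_parametric_integral_of_continuous (μ := μ)
      (f := fun (s : Set.Icc 0 δ) ω => F s ω) hF (s := Set.univ) isCompact_univ
    simp only [Measure.restrict_univ] at hc
    have hc' : ContinuousOn (fun s => ∫ ω, F s ω ∂μ) (Set.Icc 0 δ) := by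
      rw [continuousOn_iff_continuous_domRestrict]
      exact hc
    exact (hc' 0 ⟨le_rfl, hδ.le⟩).mono_left (by
      rw [← nhdsWithin_Ioo_eq_nhdsGT hδ]
      exact nhdsWithin_mono _ Set.Ioo_subset_Icc_self)
  have h1 := hlim (fun s ω => v (x + s • (ω : Space d)))
    (hv.continuousOn.comp_continuous (by fun_prop) fun p => hmem p.1 p.2)
  have h2 := hlim (fun s ω => fderiv ℝ v (x + s • (ω : Space d)) ω)
    ((continuousOn_fderiv_apply hU hv).comp_continuous
      (f := fun p : Set.Icc 0 δ × Metric.sphere (0 : Space d) 1 =>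
        (x + p.1.1 • (p.2 : Space d), (p.2 : Space d)))
      (by fun_prop) fun p => ⟨hmem p.1 p.2, trivial⟩)
  have hS : 0 < sphereArea d := by
    have : Nontrivial (Space d) :=
      Module.nontrivial_of_finrank_pos (R := ℝ) (by simpa using Nat.pos_of_ne_zero (NeZero.ne d))
    exact ENNReal.toReal_pos (Measure.measure_univ_ne_zero.2 (Measure.toSphere_ne_zero _))
      (measure_ne_top _ _)
  have h3 := ((h.tendsto_deriv_zero.mul h1).const_mul ((sphereArea d : ℂ)⁻¹)).sub
    (h.tendsto_zero.mul h2)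
  have hval : (sphereArea d : ℂ)⁻¹ * (-1 * ∫ ω : Metric.sphere (0 : Space d) 1,
      v (x + (0 : ℝ) • (ω : Space d)) ∂μ) - 0 * ∫ ω : Metric.sphere (0 : Space d) 1,
      fderiv ℝ v (x + (0 : ℝ) • (ω : Space d)) ω ∂μ = -v x := by
    have : μ.real Set.univ = sphereArea d := rfl
    have hSC : (sphereArea d : ℂ) ≠ 0 := Complex.ofReal_ne_zero.2 hS.ne'
    simp only [zero_smul, add_zero, integral_const, this]
    simp [hSC]
  rw [hval] at h3
  refine h3.congr' ?_
  filter_upwards [Ioo_mem_nhdsGT hδ] with s hs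
  have hs0 : 0 < s := hs.1
  have hne : ∀ ω : Metric.sphere (0 : Space d) 1, x + s • (ω : Space d) ≠ x := by
    intro ω hω
    have := norm_smul_sphere hs0.le ω
    rw [add_eq_left.1 hω, norm_zero] at this
    exact hs0.ne this
  have hG : ∀ ω : Metric.sphere (0 : Space d) 1,
      greenField v (fun z => f ‖z - x‖) (x + s • (ω : Space d)) ω =
        v (x + s • (ω : Space d)) * f' s - f s * fderiv ℝ v (x + s • (ω : Space d)) ω := by
    intro ω
    rw [greenField, h.fderiv_comp_norm (hne ω), add_sub_cancel_left, norm_smul_sphere hs0.le,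
      smul_smul, inv_mul_cancel₀ hs0.ne', one_smul, real_inner_self_eq_norm_sq]
    simp
  have hc1 : Continuous fun ω : Metric.sphere (0 : Space d) 1 => v (x + s • (ω : Space d)) :=
    hv.continuousOn.comp_continuous (by fun_prop) fun ω => hmem ⟨s, hs.1.le, hs.2.le⟩ ω
  have hc2 : Continuous fun ω : Metric.sphere (0 : Space d) 1 =>
      fderiv ℝ v (x + s • (ω : Space d)) ω :=
    (continuousOn_fderiv_apply hU hv).comp_continuous
      (f := fun ω : Metric.sphere (0 : Space d) 1 => (x + s • (ω : Space d), (ω : Space d)))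
      (by fun_prop) fun ω => ⟨hmem ⟨s, hs.1.le, hs.2.le⟩ ω, trivial⟩
  rw [flux]
  simp only [hG]
  rw [integral_sub ((integrable_sphere hc1).mul_const _) ((integrable_sphere hc2).const_mul _),
    integral_mul_const, integral_const_mul]
  have hSC : (sphereArea d : ℂ) ≠ 0 := Complex.ofReal_ne_zero.2 hS.ne'
  simp only [Complex.real_smul]
  push_cast
  field_simp
  rfl

end IsOutgoingProfile

/-! ### Expansions of the profile far from the source -/

lemma abs_rpow_sub_one_le {t p : ℝ} (ht : 0 < t) (hp0 : 0 ≤ p) (hp1 : p ≤ 1) :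
    |t ^ p - 1| ≤ |t - 1| := by
  rcases le_total 1 t with h | h
  · have h1 : 1 ≤ t ^ p := Real.one_le_rpow h hp0
    have h2 : t ^ p ≤ t ^ (1 : ℝ) := Real.rpow_le_rpow_of_exponent_le h hp1
    rw [Real.rpow_one] at h2
    rw [abs_of_nonneg (by linarith), abs_of_nonneg (by linarith)]
    linarith
  · have h1 : t ^ p ≤ 1 := Real.rpow_le_one ht.le h hp0
    have h2 : t ^ (1 : ℝ) ≤ t ^ p := Real.rpow_le_rpow_of_exponent_ge ht h hp1
    rw [Real.rpow_one] at h2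
    rw [abs_of_nonpos (by linarith), abs_of_nonpos (by linarith)]
    linarith

lemma norm_exp_I_mul_ofReal (t : ℝ) : ‖Complex.exp (Complex.I * (t : ℝ))‖ = 1 := by
  rw [mul_comm, Complex.norm_exp_ofReal_mul_I]

lemma norm_exp_I_mul_sub_le (s t : ℝ) :
    ‖Complex.exp (Complex.I * (s : ℝ)) - Complex.exp (Complex.I * (t : ℝ))‖ ≤ |s - t| := by
  have h : Complex.exp (Complex.I * (s : ℝ)) - Complex.exp (Complex.I * (t : ℝ)) =
      Complex.exp (Complex.I * (t : ℝ)) * (Complex.exp (Complex.I * ((s - t : ℝ))) - 1) := by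
    rw [mul_sub, ← Complex.exp_add, mul_one]
    congr 2
    push_cast
    ring
  rw [h, norm_mul, norm_exp_I_mul_ofReal, one_mul]
  exact Real.norm_exp_I_mul_ofReal_sub_one_le

/-- The first-order expansion of `|z - x|` for `x` far away from `z`. -/
lemma abs_norm_sub_sub_le {d : ℕ} {x z : Space d} (hx : 0 < ‖x‖) (hxz : 2 * ‖z‖ ≤ ‖x‖) :
    |‖z - x‖ - (‖x‖ - inner ℝ (‖x‖⁻¹ • x) z)| ≤ 2 * ‖z‖ ^ 2 / ‖x‖ := by
  set s := inner ℝ (‖x‖⁻¹ • x) z with hs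
  have hsz : |s| ≤ ‖z‖ := by
    refine (abs_real_inner_le_norm _ _).trans ?_
    rw [norm_smul, norm_inv, norm_norm, inv_mul_cancel₀ hx.ne', one_mul]
  have hsx : inner ℝ z x = ‖x‖ * s := by
    rw [hs, inner_smul_left, real_inner_comm x z]
    simp [hx.ne']
  have hsq : ‖z - x‖ ^ 2 = ‖z‖ ^ 2 - 2 * (‖x‖ * s) + ‖x‖ ^ 2 := by
    rw [norm_sub_sq_real, hsx]
  obtain ⟨h1, h2⟩ := abs_le.1 hsz
  have hpos : ‖x‖ / 2 ≤ ‖z - x‖ + (‖x‖ - s) := by linarith [norm_nonneg (z - x)]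
  -- A difference of squares: the numerator stays bounded by `‖z‖²` while the conjugate factor is at
  -- least `‖x‖ / 2`, which gives the gain `1 / ‖x‖`.
  have hprod : (‖z - x‖ - (‖x‖ - s)) * (‖z - x‖ + (‖x‖ - s)) = ‖z‖ ^ 2 - s ^ 2 := by
    linear_combination hsq
  rw [le_div_iff₀ hx]
  have h3 : |‖z - x‖ - (‖x‖ - s)| * (‖z - x‖ + (‖x‖ - s)) ≤ ‖z‖ ^ 2 := by
    rw [← abs_of_nonneg (show 0 ≤ ‖z - x‖ + (‖x‖ - s) by linarith), ← abs_mul, hprod, abs_le]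
    constructor <;> nlinarith
  nlinarith [abs_nonneg (‖z - x‖ - (‖x‖ - s))]

lemma far_bounds {d : ℕ} {x z : Space d} (hxz : 2 * ‖z‖ ≤ ‖x‖) :
    ‖x‖ / 2 ≤ ‖z - x‖ ∧ |‖z - x‖ - ‖x‖| ≤ ‖z‖ := by
  have h1 := norm_sub_norm_le x z
  have h2 := norm_sub_rev x z
  have h3 := norm_sub_le z x
  refine ⟨by linarith, abs_le.2 ⟨by linarith, by linarith⟩⟩

namespace IsOutgoingProfile

variable {d : ℕ} {κ : ℝ} {c : ℂ} {f f' : ℝ → ℂ}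

lemma exists_norm_le (h : IsOutgoingProfile d κ c f f') : ∃ C, 0 ≤ C ∧ ∀ r, 1 ≤ r →
    ‖f r‖ ≤ C * r ^ (-(((d : ℝ) - 1) / 2)) := by
  obtain ⟨C, hC⟩ := h.asymptotics
  refine ⟨max C 0 + ‖c‖, by positivity, fun r hr => ?_⟩
  have hr0 : 0 < r := by linarith
  have h1 := hC r hr0
  have h2 : r ^ (-(((d : ℝ) + 1) / 2)) ≤ r ^ (-(((d : ℝ) - 1) / 2)) :=
    Real.rpow_le_rpow_of_exponent_le hr (by linarith)
  have h3 : ‖c * (Complex.exp (Complex.I * (κ * r : ℝ)) * (r ^ (-(((d : ℝ) - 1) / 2)) : ℝ))‖ =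
      ‖c‖ * r ^ (-(((d : ℝ) - 1) / 2)) := by
    rw [norm_mul, norm_mul, norm_exp_I_mul_ofReal, Complex.norm_real,
      Real.norm_of_nonneg (by positivity), one_mul]
  calc ‖f r‖ ≤ C * r ^ (-(((d : ℝ) + 1) / 2)) + ‖c‖ * r ^ (-(((d : ℝ) - 1) / 2)) := by
        rw [← h3]
        exact (norm_le_norm_sub_add _ _).trans (by gcongr)
    _ ≤ max C 0 * r ^ (-(((d : ℝ) - 1) / 2)) + ‖c‖ * r ^ (-(((d : ℝ) - 1) / 2)) := by
        gcongr
        exact le_max_left _ _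
    _ = _ := by ring

lemma radialDeriv_comp_norm (h : IsOutgoingProfile d κ c f f') {x z : Space d} (hz : z ≠ x) :
    radialDeriv (fun z => f ‖z - x‖) z =
      f' ‖z - x‖ * (inner ℝ (‖z - x‖⁻¹ • (z - x)) (‖z‖⁻¹ • z) : ℝ) :=
  h.fderiv_comp_norm hz _

/-- All three bounds come from the ratio `t = ‖x‖ / ‖z - x‖`, which is at most `2` and differs from
`1` by `O(‖z‖ / ‖x‖)`. Since `1 ≤ d ≤ 3`, the exponent `p = (d-1)/2` lies in `[0, 1]`, so `t ^ p` is
no farther from `1` than `t` is. -/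
lemma rpow_neg_far_le [NeZero d] {x z : Space d} (hd : d ≤ 3) (hx : 0 < ‖x‖)
    (hxz : 2 * ‖z‖ ≤ ‖x‖) :
    ‖z - x‖ ^ (-(((d : ℝ) - 1) / 2)) ≤ 2 * ‖x‖ ^ (-(((d : ℝ) - 1) / 2)) ∧
    ‖z - x‖ ^ (-(((d : ℝ) + 1) / 2)) ≤ 4 * (‖x‖ ^ (-(((d : ℝ) - 1) / 2)) * ‖x‖⁻¹) ∧
    |‖z - x‖ ^ (-(((d : ℝ) - 1) / 2)) - ‖x‖ ^ (-(((d : ℝ) - 1) / 2))| ≤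
      ‖x‖ ^ (-(((d : ℝ) - 1) / 2)) * (2 * ‖z‖ * ‖x‖⁻¹) := by
  obtain ⟨h1, h2⟩ := far_bounds hxz
  have hρ : 0 < ‖z - x‖ := by linarith
  have hd1 : (1 : ℝ) ≤ d := by exact_mod_cast Nat.one_le_iff_ne_zero.2 (NeZero.ne d)
  have hd3 : (d : ℝ) ≤ 3 := by exact_mod_cast hd
  set p := ((d : ℝ) - 1) / 2 with hp
  have hp0 : 0 ≤ p := by linarith
  have hp1 : p ≤ 1 := by linarith
  set ρ := ‖z - x‖
  set r := ‖x‖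
  set t := r / ρ with ht
  have ht0 : 0 < t := by positivity
  have ht2 : t ≤ 2 := by rw [ht, div_le_iff₀ hρ]; linarith
  have hρt : ρ = r / t := by rw [ht]; field_simp
  have hpow : ρ ^ (-p) = r ^ (-p) * t ^ p := by
    rw [hρt, Real.div_rpow hx.le ht0.le, Real.rpow_neg ht0.le, div_inv_eq_mul]
  have htp : t ^ p ≤ 2 := by
    refine (Real.rpow_le_rpow ht0.le ht2 hp0).trans ?_
    calc (2 : ℝ) ^ p ≤ 2 ^ (1 : ℝ) := Real.rpow_le_rpow_of_exponent_le (by norm_num) hp1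
      _ = 2 := Real.rpow_one 2
  have hrp : 0 < r ^ (-p) := by positivity
  have hA : ρ ^ (-p) ≤ 2 * r ^ (-p) := by rw [hpow]; nlinarith
  refine ⟨hA, ?_, ?_⟩
  · have : ρ ^ (-(((d : ℝ) + 1) / 2)) = ρ ^ (-p) * ρ⁻¹ := by
      rw [← Real.rpow_neg_one ρ, ← Real.rpow_add hρ]
      congr 1
      rw [hp]
      ring
    rw [this]
    have hinv : ρ⁻¹ ≤ 2 * r⁻¹ := by
      rw [inv_le_comm₀ hρ (by positivity), mul_inv, inv_inv]
      linarith
    calc ρ ^ (-p) * ρ⁻¹ ≤ (2 * r ^ (-p)) * (2 * r⁻¹) := by gcongr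
      _ = _ := by ring
  · rw [hpow, show r ^ (-p) * t ^ p - r ^ (-p) = r ^ (-p) * (t ^ p - 1) by ring, abs_mul,
      abs_of_pos hrp]
    gcongr
    refine (abs_rpow_sub_one_le ht0 hp0 hp1).trans ?_
    have : t - 1 = -((ρ - r) / ρ) := by rw [ht]; field_simp; ring
    rw [this, abs_neg, abs_div, abs_of_pos hρ, div_le_iff₀ hρ]
    calc |ρ - r| ≤ ‖z‖ * 1 := by rw [mul_one]; exact h2
      _ ≤ ‖z‖ * (2 * r⁻¹ * ρ) := by
        gcongr
        rw [mul_assoc, ← div_eq_inv_mul, mul_div_assoc', le_div_iff₀ hx]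
        linarith
      _ = _ := by ring

lemma rpow_neg_succ {r : ℝ} (hr : 0 < r) :
    r ^ (-(((d : ℝ) + 1) / 2)) = r ^ (-(((d : ℝ) - 1) / 2)) * r⁻¹ := by
  rw [← Real.rpow_neg_one r, ← Real.rpow_add hr]
  congr 1
  ring

lemma abs_inner_le_one {x z : Space d} :
    |inner ℝ (‖z - x‖⁻¹ • (z - x)) (‖z‖⁻¹ • z)| ≤ 1 := by
  have key : ∀ y : Space d, ‖‖y‖⁻¹ • y‖ ≤ 1 := by
    intro y
    rw [norm_smul, norm_inv, norm_norm]
    exact inv_mul_le_one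
  refine (abs_real_inner_le_norm _ _).trans ?_
  exact mul_le_one₀ (key _) (norm_nonneg _) (key _)

/-- The fundamental solution satisfies the radiation condition in its second argument. -/
lemma exists_radiation_bounds [NeZero d] (hd : d ≤ 3) (h : IsOutgoingProfile d κ c f f')
    (x : Space d) : ∃ C r₀ : ℝ,
      (∀ z, r₀ ≤ ‖z‖ → ‖f ‖z - x‖‖ ≤ C * ‖z‖ ^ (-(((d : ℝ) - 1) / 2))) ∧
      (∀ z, r₀ ≤ ‖z‖ → ‖radialDeriv (fun z => f ‖z - x‖) z - Complex.I * κ * f ‖z - x‖‖ ≤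
        C * ‖z‖ ^ (-(((d : ℝ) + 1) / 2))) := by
  obtain ⟨C₁, hC₁, hf⟩ := h.exists_norm_le
  obtain ⟨C₂, hf'⟩ := h.asymptotics_deriv
  -- One constant serves both bounds: `2 * C₁` covers the size of `f`, the rest covers the radiation
  -- defect.
  refine ⟨2 * C₁ + (4 * max C₂ 0 + |κ| * (2 * C₁ * (4 * ‖x‖))), max 2 (2 * ‖x‖), fun z hz => ?_,
    fun z hz => ?_⟩ <;>
  · have hz2 : 2 ≤ ‖z‖ := (le_max_left _ _).trans hz
    have hzx : 2 * ‖x‖ ≤ ‖z‖ := (le_max_right _ _).trans hz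
    have hz0 : 0 < ‖z‖ := by linarith
    -- Here `z` is the far point and `x` the near one, so the estimates are used with the roles
    -- exchanged.
    obtain ⟨h1, h2⟩ := far_bounds hzx
    obtain ⟨h3, h4, -⟩ := rpow_neg_far_le hd hz0 hzx
    rw [norm_sub_rev x z] at h1 h2 h3 h4
    have hρ1 : 1 ≤ ‖z - x‖ := by linarith
    have hρ0 : 0 < ‖z - x‖ := by linarith
    set P := ‖z‖ ^ (-(((d : ℝ) - 1) / 2))
    have hP : 0 < P := by positivity
    have hfP : ‖f ‖z - x‖‖ ≤ C₁ * (2 * P) := (hf _ hρ1).trans (by gcongr)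
    first
    | refine hfP.trans ?_
      have : 0 ≤ 4 * max C₂ 0 + |κ| * (2 * C₁ * (4 * ‖x‖)) := by positivity
      nlinarith
    | have hne : z ≠ x := fun hne => by simp [hne] at hρ0
      rw [h.radialDeriv_comp_norm hne, rpow_neg_succ hz0]
      set q := inner ℝ (‖z - x‖⁻¹ • (z - x)) (‖z‖⁻¹ • z) with hq
      have hq1 : |q| ≤ 1 := abs_inner_le_one
      have hxz : |inner ℝ x z| ≤ ‖x‖ * ‖z‖ := abs_real_inner_le_norm _ _
      have hq2 : |q - 1| ≤ 4 * ‖x‖ * ‖z‖⁻¹ := by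
        have hqe : q - 1 = ((‖z‖ - ‖z - x‖) - inner ℝ x z * ‖z‖⁻¹) * ‖z - x‖⁻¹ := by
          rw [hq, inner_smul_left, inner_smul_right, inner_sub_left, real_inner_self_eq_norm_sq]
          simp
          field_simp
          ring
        rw [hqe, abs_mul, abs_of_pos (inv_pos.2 hρ0)]
        have hb : |(‖z‖ - ‖z - x‖) - inner ℝ x z * ‖z‖⁻¹| ≤ 2 * ‖x‖ := by
          refine (abs_sub _ _).trans ?_
          have : |inner ℝ x z * ‖z‖⁻¹| ≤ ‖x‖ := by
            rw [abs_mul, abs_of_pos (inv_pos.2 hz0), ← div_eq_mul_inv, div_le_iff₀ hz0]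
            exact hxz
          rw [abs_sub_comm] at h2
          linarith
        have hinv : ‖z - x‖⁻¹ ≤ 2 * ‖z‖⁻¹ := by
          rw [inv_le_comm₀ hρ0 (by positivity), mul_inv, inv_inv]
          linarith
        calc _ ≤ 2 * ‖x‖ * (2 * ‖z‖⁻¹) := by gcongr
          _ = _ := by ring
      -- The radial derivatives about `x` and about the origin differ by the cosine `q` between the
      -- two directions, and `q - 1 = O(1/‖z‖)`.
      have hid : f' ‖z - x‖ * (q : ℝ) - Complex.I * κ * f ‖z - x‖ =
          (f' ‖z - x‖ - Complex.I * κ * f ‖z - x‖) * (q : ℝ) +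
            Complex.I * κ * (f ‖z - x‖ * ((q - 1 : ℝ) : ℂ)) := by
        push_cast
        ring
      have hf'P : ‖f' ‖z - x‖ - Complex.I * κ * f ‖z - x‖‖ ≤ max C₂ 0 * (4 * (P * ‖z‖⁻¹)) := by
        refine (hf' _ hρ0).trans ?_
        gcongr
        exact le_max_left _ _
      rw [hid]
      calc _ ≤ max C₂ 0 * (4 * (P * ‖z‖⁻¹)) * 1 +
            1 * |κ| * (C₁ * (2 * P) * (4 * ‖x‖ * ‖z‖⁻¹)) := by
            refine (norm_add_le _ _).trans ?_
            rw [norm_mul, norm_mul, norm_mul, norm_mul, Complex.norm_real, Complex.norm_real,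
              Complex.norm_real, Complex.norm_I, Real.norm_eq_abs, Real.norm_eq_abs,
              Real.norm_eq_abs]
            gcongr
        _ ≤ 2 * C₁ * (P * ‖z‖⁻¹) + (max C₂ 0 * (4 * (P * ‖z‖⁻¹)) * 1 +
            1 * |κ| * (C₁ * (2 * P) * (4 * ‖x‖ * ‖z‖⁻¹))) := by
            have : 0 ≤ 2 * C₁ * (P * ‖z‖⁻¹) := by positivity
            linarith
        _ = _ := by ring

/-- The far-field expansion of the fundamental solution and of its radial derivative, uniformly
on a sphere. -/
lemma exists_farField_bounds [NeZero d] (hd : d ≤ 3) (h : IsOutgoingProfile d κ c f f')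
    {R : ℝ} (hR : 0 < R) : ∃ C r₀ : ℝ, ∀ x z : Space d, r₀ ≤ ‖x‖ → ‖z‖ = R →
      ‖f ‖z - x‖ - Complex.exp (Complex.I * (κ * ‖x‖ : ℝ)) * (‖x‖ ^ (-(((d : ℝ) - 1) / 2)) : ℝ) *
        (c * Complex.exp (-Complex.I * (κ * inner ℝ (‖x‖⁻¹ • x) z : ℝ)))‖ ≤
        C * ‖x‖ ^ (-(((d : ℝ) + 1) / 2)) ∧
      ‖radialDeriv (fun z => f ‖z - x‖) z -
        Complex.exp (Complex.I * (κ * ‖x‖ : ℝ)) * (‖x‖ ^ (-(((d : ℝ) - 1) / 2)) : ℝ) *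
        (-Complex.I * (κ * inner ℝ (‖x‖⁻¹ • x) (‖z‖⁻¹ • z) : ℝ) *
          (c * Complex.exp (-Complex.I * (κ * inner ℝ (‖x‖⁻¹ • x) z : ℝ))))‖ ≤
        C * ‖x‖ ^ (-(((d : ℝ) + 1) / 2)) := by
  obtain ⟨C₁, hC₁, hf⟩ := h.exists_norm_le
  obtain ⟨C₂, hf'⟩ := h.asymptotics_deriv
  obtain ⟨C₃, hfa⟩ := h.asymptotics
  set M := 4 * max C₃ 0 + ‖c‖ * (|κ| * (2 * R ^ 2) * 2 + 2 * R) with hM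
  have hM0 : 0 ≤ M := by positivity
  refine ⟨M + (4 * max C₂ 0 + |κ| * (2 * C₁ * (4 * R)) + |κ| * M), max 2 (2 * R),
    fun x z hx hz => ?_⟩
  have hx2 : 2 ≤ ‖x‖ := (le_max_left _ _).trans hx
  have hxz : 2 * ‖z‖ ≤ ‖x‖ := by rw [hz]; exact (le_max_right _ _).trans hx
  have hx0 : 0 < ‖x‖ := by linarith
  obtain ⟨h1, h2⟩ := far_bounds hxz
  obtain ⟨h3, h4, h5⟩ := rpow_neg_far_le hd hx0 hxz
  have h6 := abs_norm_sub_sub_le hx0 hxz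
  have hρ1 : 1 ≤ ‖z - x‖ := by linarith
  have hρ0 : 0 < ‖z - x‖ := by linarith
  rw [rpow_neg_succ hx0]
  set P := ‖x‖ ^ (-(((d : ℝ) - 1) / 2))
  have hP : 0 < P := by positivity
  set s := inner ℝ (‖x‖⁻¹ • x) z with hs
  set E := Complex.exp (Complex.I * (κ * ‖x‖ : ℝ))
  have hE : E * Complex.exp (-Complex.I * (κ * s : ℝ)) =
      Complex.exp (Complex.I * ((κ * (‖x‖ - s) : ℝ))) := by
    rw [← Complex.exp_add]
    congr 1
    push_cast
    ring
  set T := E * (P : ℝ) * (c * Complex.exp (-Complex.I * (κ * s : ℝ))) with hT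
  have hTE : T = c * (Complex.exp (Complex.I * ((κ * (‖x‖ - s) : ℝ))) * (P : ℝ)) := by
    rw [← hE, hT]
    ring
  have hfirst : ‖f ‖z - x‖ - T‖ ≤ M * (P * ‖x‖⁻¹) := by
    set ρ := ‖z - x‖
    set Q := ρ ^ (-(((d : ℝ) - 1) / 2))
    have hQ : 0 < Q := by positivity
    -- Three errors, each of order `P / ‖x‖`: the remainder of the profile, the phase `κρ` against
    -- `κ(‖x‖ - s)`, and the amplitude `Q` against `P`. The three summands of `M` match them.
    have hid : f ρ - T = (f ρ - c * (Complex.exp (Complex.I * (κ * ρ : ℝ)) * (Q : ℝ))) +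
        c * ((Complex.exp (Complex.I * (κ * ρ : ℝ)) -
          Complex.exp (Complex.I * ((κ * (‖x‖ - s) : ℝ)))) * (Q : ℝ) +
          Complex.exp (Complex.I * ((κ * (‖x‖ - s) : ℝ))) * ((Q - P : ℝ) : ℂ)) := by
      rw [hTE]
      push_cast
      ring
    have ha : ‖f ρ - c * (Complex.exp (Complex.I * (κ * ρ : ℝ)) * (Q : ℝ))‖ ≤
        max C₃ 0 * (4 * (P * ‖x‖⁻¹)) := by
      refine (hfa ρ hρ0).trans ?_
      gcongr
      exact le_max_left _ _
    have hb : ‖Complex.exp (Complex.I * (κ * ρ : ℝ)) -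
          Complex.exp (Complex.I * ((κ * (‖x‖ - s) : ℝ)))‖ ≤ |κ| * (2 * R ^ 2 * ‖x‖⁻¹) := by
      refine (norm_exp_I_mul_sub_le _ _).trans ?_
      rw [← mul_sub, abs_mul]
      gcongr
      rw [← hz, ← div_eq_mul_inv]
      exact h6
    rw [hz] at h5
    rw [hid]
    calc _ ≤ max C₃ 0 * (4 * (P * ‖x‖⁻¹)) + ‖c‖ * (|κ| * (2 * R ^ 2 * ‖x‖⁻¹) * (2 * P) +
          1 * (P * (2 * R * ‖x‖⁻¹))) := by
          refine (norm_add_le _ _).trans ?_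
          rw [norm_mul c]
          gcongr
          refine (norm_add_le _ _).trans ?_
          rw [norm_mul, norm_mul, norm_exp_I_mul_ofReal, Complex.norm_real, Complex.norm_real,
            Real.norm_of_nonneg hQ.le, Real.norm_eq_abs]
          gcongr
      _ = _ := by rw [hM]; ring
  refine ⟨hfirst.trans ?_, ?_⟩
  · have : 0 ≤ (4 * max C₂ 0 + |κ| * (2 * C₁ * (4 * R)) + |κ| * M) * (P * ‖x‖⁻¹) := by positivity
    linarith
  have hne : z ≠ x := fun hne => by simp [hne] at hρ0
  rw [h.radialDeriv_comp_norm hne]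
  set q := inner ℝ (‖z - x‖⁻¹ • (z - x)) (‖z‖⁻¹ • z) with hq
  set σ := inner ℝ (‖x‖⁻¹ • x) (‖z‖⁻¹ • z) with hσ
  have hq1 : |q| ≤ 1 := abs_inner_le_one
  have hσ1 : |σ| ≤ 1 := by
    refine (abs_real_inner_le_norm _ _).trans (le_of_eq ?_)
    rw [norm_smul, norm_smul, norm_inv, norm_norm, norm_inv, norm_norm, inv_mul_cancel₀ hx0.ne',
      hz, inv_mul_cancel₀ hR.ne', one_mul]
  have hinv : ‖z - x‖⁻¹ ≤ 2 * ‖x‖⁻¹ := by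
    rw [inv_le_comm₀ hρ0 (by positivity), mul_inv, inv_inv]
    linarith
  -- Seen from `z` near the origin, `z - x` points nearly along `-x`, so `q` is close to `-σ`. This
  -- is the source of the minus sign in the derivative of the far-field kernel.
  have hqσ : |q + σ| ≤ 4 * R * ‖x‖⁻¹ := by
    have hqe : q + σ = (R + σ * (‖z - x‖ - ‖x‖)) * ‖z - x‖⁻¹ := by
      rw [hq, hσ]
      simp only [inner_smul_left, inner_smul_right, inner_sub_left, real_inner_self_eq_norm_sq, hz]
      simp
      field_simp
      ring
    rw [hqe, abs_mul, abs_of_pos (inv_pos.2 hρ0)]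
    have hb : |R + σ * (‖z - x‖ - ‖x‖)| ≤ 2 * R := by
      refine (abs_add_le _ _).trans ?_
      rw [abs_mul, abs_of_pos hR]
      rw [hz] at h2
      nlinarith [abs_nonneg σ, abs_nonneg (‖z - x‖ - ‖x‖)]
    calc _ ≤ 2 * R * (2 * ‖x‖⁻¹) := by gcongr
      _ = _ := by ring
  have hid : f' ‖z - x‖ * (q : ℝ) -
      E * (P : ℝ) * (-Complex.I * (κ * σ : ℝ) * (c * Complex.exp (-Complex.I * (κ * s : ℝ)))) =
      (f' ‖z - x‖ - Complex.I * κ * f ‖z - x‖) * (q : ℝ) +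
        Complex.I * κ * (f ‖z - x‖ * ((q + σ : ℝ) : ℂ)) -
        Complex.I * κ * ((σ : ℝ) * (f ‖z - x‖ - T)) := by
    rw [hT]
    push_cast
    ring
  have hf'P : ‖f' ‖z - x‖ - Complex.I * κ * f ‖z - x‖‖ ≤ max C₂ 0 * (4 * (P * ‖x‖⁻¹)) := by
    refine (hf' _ hρ0).trans ?_
    gcongr
    exact le_max_left _ _
  have hfP : ‖f ‖z - x‖‖ ≤ C₁ * (2 * P) := (hf _ hρ1).trans (by gcongr)
  rw [hid]
  calc _ ≤ max C₂ 0 * (4 * (P * ‖x‖⁻¹)) * 1 + 1 * |κ| * (C₁ * (2 * P) * (4 * R * ‖x‖⁻¹)) +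
        1 * |κ| * (1 * (M * (P * ‖x‖⁻¹))) := by
        refine (norm_sub_le _ _).trans (add_le_add ((norm_add_le _ _).trans ?_) ?_)
        · rw [norm_mul, norm_mul, norm_mul, norm_mul, Complex.norm_real, Complex.norm_real,
            Complex.norm_real, Complex.norm_I, Real.norm_eq_abs, Real.norm_eq_abs,
            Real.norm_eq_abs]
          gcongr
        · rw [norm_mul, norm_mul, norm_mul, Complex.norm_real, Complex.norm_real, Complex.norm_I,
            Real.norm_eq_abs, Real.norm_eq_abs]
          gcongr
    _ ≤ M * (P * ‖x‖⁻¹) + (max C₂ 0 * (4 * (P * ‖x‖⁻¹)) * 1 +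
        1 * |κ| * (C₁ * (2 * P) * (4 * R * ‖x‖⁻¹)) + 1 * |κ| * (1 * (M * (P * ‖x‖⁻¹)))) := by
        have : 0 ≤ M * (P * ‖x‖⁻¹) := by positivity
        linarith
    _ = _ := by ring

/-! ### Green's representation formula -/

/-- Green's representation formula for radiating solutions of the Helmholtz equation. -/
lemma flux_eq [NeZero d] (hd : d ≤ 3) (hκ : 0 < κ) (h : IsOutgoingProfile d κ c f f')
    {ρ R : ℝ} (hρ : 0 ≤ ρ) (hρR : ρ < R) {v : Space d → ℂ}
    (hv : IsHelmholtzOn κ {z : Space d | ρ < ‖z‖} v) (hrad : SommerfeldRadiation κ v)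
    {x : Space d} (hx : R < ‖x‖) : flux v (fun z => f ‖z - x‖) 0 R = v x := by
  have hw := h.isHelmholtzOn x
  obtain ⟨C, r₀, hb1, hb2⟩ := h.exists_radiation_bounds hd x
  have h1 := tendsto_flux_atTop hκ hρ hv hrad hb1 hb2
  -- Letting the small sphere around `x` shrink in the jump relation replaces its flux by `-v x`.
  -- The left side is then independent of `b`, while the right side tends to `0`.
  have h2 : ∀ᶠ b : ℝ in atTop,
      flux v (fun z => f ‖z - x‖) 0 R - v x = flux v (fun z => f ‖z - x‖) 0 b := by
    filter_upwards [eventually_gt_atTop ‖x‖] with b hb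
    have h3 := h.tendsto_flux (isOpen_exterior ρ) (hρR.trans hx) hv.contDiffOn
    have h4 : ∀ᶠ s in 𝓝[>] (0 : ℝ), flux v (fun z => f ‖z - x‖) x s =
        flux v (fun z => f ‖z - x‖) 0 b - flux v (fun z => f ‖z - x‖) 0 R := by
      filter_upwards [Ioo_mem_nhdsGT (show 0 < min (‖x‖ - R) (b - ‖x‖) from
        lt_min (by linarith) (by linarith))] with s hs
      have hs1 := hs.2.trans_le (min_le_left _ _)
      have hs2 := hs.2.trans_le (min_le_right _ _)
      linear_combination flux_zero_sub hρ hv hw hρR hs.1 (by linarith : R < ‖x‖ - s)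
        (by linarith : ‖x‖ + s < b)
    have h5 := tendsto_nhds_unique h3 (tendsto_const_nhds.congr' (h4.mono fun _ h => h.symm))
    linear_combination h5
  have h6 := tendsto_nhds_unique h1 (tendsto_const_nhds.congr' h2)
  exact sub_eq_zero.1 h6.symm

end IsOutgoingProfile

/-! ### The Hankel function as a Laplace integral -/

lemma one_add_I_mul_mem_slitPlane (s : ℝ) : 1 + Complex.I * s / 2 ∈ Complex.slitPlane :=
  Or.inl (by simp)

lemma one_le_norm_one_add_I_mul (s : ℝ) : 1 ≤ ‖1 + Complex.I * s / 2‖ := by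
  refine le_trans (by simp) (Complex.abs_re_le_norm _)

lemma half_le_norm_one_add_I_mul (s : ℝ) : |s| / 2 ≤ ‖1 + Complex.I * s / 2‖ := by
  refine le_trans (by simp [abs_div]) (Complex.abs_im_le_norm _)

lemma norm_one_add_I_mul_cpow (s : ℝ) (a : ℝ) :
    ‖(1 + Complex.I * s / 2) ^ (a : ℂ)‖ = ‖1 + Complex.I * s / 2‖ ^ a := by
  rw [Complex.norm_cpow_of_ne_zero (Complex.slitPlane_ne_zero (one_add_I_mul_mem_slitPlane s))]
  simp

lemma norm_one_add_I_mul_cpow_le_one (s : ℝ) {a : ℝ} (ha : a ≤ 0) :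
    ‖(1 + Complex.I * s / 2) ^ (a : ℂ)‖ ≤ 1 := by
  rw [norm_one_add_I_mul_cpow]
  exact Real.rpow_le_one_of_one_le_of_nonpos (one_le_norm_one_add_I_mul s) ha

lemma hasDerivAt_one_add_I_mul_cpow (s : ℝ) (a : ℂ) :
    HasDerivAt (fun s : ℝ => (1 + Complex.I * s / 2) ^ a)
      (a * (1 + Complex.I * s / 2) ^ (a - 1) * (Complex.I / 2)) s := by
  have h : HasDerivAt (fun z : ℂ => 1 + Complex.I * z / 2) (Complex.I / 2) (s : ℂ) := by
    simpa using (((hasDerivAt_id (s : ℂ)).const_mul Complex.I).div_const 2).const_add 1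
  exact (h.cpow_const (one_add_I_mul_mem_slitPlane s)).comp_ofReal

/-- The amplitude `s^{-1/2} (1 + is/2)^{-1/2}` in the Laplace integral for the Hankel function. -/
noncomputable def hankelAmplitude (s : ℝ) : ℂ :=
  (s ^ (-(1 / 2) : ℝ) : ℝ) * (1 + Complex.I * s / 2) ^ (-(1 / 2) : ℂ)

lemma norm_hankelAmplitude_le {s : ℝ} (hs : 0 < s) :
    ‖hankelAmplitude s‖ ≤ s ^ (-(1 / 2) : ℝ) := by
  have h := norm_one_add_I_mul_cpow_le_one s (a := -(1 / 2)) (by norm_num)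
  push_cast at h
  rw [hankelAmplitude, norm_mul, Complex.norm_real, Real.norm_of_nonneg (by positivity)]
  exact mul_le_of_le_one_right (by positivity) h

/-- The bracket is the logarithmic derivative. Multiplied by `s(s - 2i)` it becomes `i - s`, the
first-order equation behind Bessel's equation below. -/
lemma hasDerivAt_hankelAmplitude {s : ℝ} (hs : 0 < s) :
    HasDerivAt hankelAmplitude (hankelAmplitude s *
      (-(1 / (2 * s)) - (Complex.I / 4) / (1 + Complex.I * s / 2))) s := by
  have h1 := (Real.hasDerivAt_rpow_const (x := s) (p := -(1 / 2)) (Or.inl hs.ne')).ofReal_comp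
  have h2 := hasDerivAt_one_add_I_mul_cpow s (-(1 / 2))
  have hz := Complex.slitPlane_ne_zero (one_add_I_mul_mem_slitPlane s)
  have hsC : (s : ℂ) ≠ 0 := Complex.ofReal_ne_zero.2 hs.ne'
  refine (h1.mul h2).congr_deriv ?_
  rw [Real.rpow_sub_one hs.ne', Complex.cpow_sub _ _ hz, Complex.cpow_one, hankelAmplitude]
  push_cast
  field_simp
  ring

/-- The integrand of the `k`-th derivative of the Laplace integral for the Hankel function. -/
noncomputable def hankelKernel (k : ℕ) (r s : ℝ) : ℂ :=
  (Complex.I - s) ^ k * Complex.exp (r * (Complex.I - s)) * hankelAmplitude s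

/-- The Laplace integral for the Hankel function and its derivatives. -/
noncomputable def hankelLaplace (k : ℕ) (r : ℝ) : ℂ :=
  ∫ s in Set.Ioi (0 : ℝ), hankelKernel k r s

lemma norm_exp_mul_I_sub (r s : ℝ) :
    ‖Complex.exp (r * (Complex.I - s))‖ = Real.exp (-(r * s)) := by
  rw [Complex.norm_exp]
  simp

lemma continuousOn_hankelAmplitude : ContinuousOn hankelAmplitude (Set.Ioi 0) := fun _ hs =>
  (hasDerivAt_hankelAmplitude hs).continuousAt.continuousWithinAt

lemma aestronglyMeasurable_hankelKernel (k : ℕ) (r : ℝ) :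
    AEStronglyMeasurable (hankelKernel k r) (volume.restrict (Set.Ioi 0)) := by
  refine ContinuousOn.aestronglyMeasurable ?_ measurableSet_Ioi
  exact (Continuous.continuousOn (by fun_prop)).mul continuousOn_hankelAmplitude

lemma integrableOn_rpow_mul_exp {a b : ℝ} (ha : -1 < a) (hb : 0 < b) :
    IntegrableOn (fun s => s ^ a * Real.exp (-(b * s))) (Set.Ioi 0) := by
  have := integrableOn_rpow_mul_exp_neg_mul_rpow ha one_pos hb
  simpa using this

/-- A dominating function for `hankelKernel`. -/
noncomputable def hankelBound (k : ℕ) (b s : ℝ) : ℝ :=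
  2 ^ (k - 1) * ((1 + s ^ k) * (s ^ (-(1 / 2) : ℝ) * Real.exp (-(b * s))))

lemma integrableOn_hankelBound (k : ℕ) {b : ℝ} (hb : 0 < b) :
    IntegrableOn (hankelBound k b) (Set.Ioi 0) := by
  have h1 := integrableOn_rpow_mul_exp (a := -(1 / 2)) (by norm_num) hb
  have h2 := integrableOn_rpow_mul_exp (a := -(1 / 2) + k)
    (by have : (0 : ℝ) ≤ k := Nat.cast_nonneg k; linarith) hb
  refine IntegrableOn.congr_fun ((h1.add h2).const_mul (2 ^ (k - 1))) (fun s (hs : 0 < s) => ?_)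
    measurableSet_Ioi
  simp only [hankelBound, Pi.add_apply, Real.rpow_add_natCast hs.ne']
  ring

lemma norm_hankelKernel_le (k : ℕ) {b r s : ℝ} (hs : 0 < s) (hbr : b ≤ r) :
    ‖hankelKernel k r s‖ ≤ hankelBound k b s := by
  have h1 : ‖Complex.I - s‖ ≤ 1 + s := by
    refine (norm_sub_le _ _).trans (le_of_eq ?_)
    rw [Complex.norm_I, Complex.norm_real, Real.norm_of_nonneg hs.le]
  rw [hankelKernel, norm_mul, norm_mul, norm_pow, norm_exp_mul_I_sub, hankelBound]
  calc _ ≤ (2 ^ (k - 1) * (1 ^ k + s ^ k)) * Real.exp (-(b * s)) * s ^ (-(1 / 2) : ℝ) := by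
        gcongr
        · exact (pow_le_pow_left₀ (norm_nonneg _) h1 k).trans (add_pow_le zero_le_one hs.le k)
        · exact norm_hankelAmplitude_le hs
    _ = _ := by rw [one_pow]; ring

lemma integrableOn_hankelKernel (k : ℕ) {r : ℝ} (hr : 0 < r) :
    IntegrableOn (hankelKernel k r) (Set.Ioi 0) :=
  (integrableOn_hankelBound k hr).mono' (aestronglyMeasurable_hankelKernel k r) (by
    filter_upwards [ae_restrict_mem measurableSet_Ioi] with s hs
    exact norm_hankelKernel_le k hs le_rfl)

lemma hasDerivAt_hankelLaplace (k : ℕ) {r : ℝ} (hr : 0 < r) :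
    HasDerivAt (hankelLaplace k) (hankelLaplace (k + 1) r) r := by
  refine (hasDerivAt_integral_of_dominated_loc_of_deriv_le (F := hankelKernel k)
    (F' := hankelKernel (k + 1)) (bound := hankelBound (k + 1) (r / 2)) (s := Set.Ioi (r / 2))
    (Ioi_mem_nhds (by linarith)) (Eventually.of_forall fun r => aestronglyMeasurable_hankelKernel k r)
    (integrableOn_hankelKernel k hr) (aestronglyMeasurable_hankelKernel _ _) ?_
    (integrableOn_hankelBound _ (by linarith)) ?_).2
  · filter_upwards [ae_restrict_mem measurableSet_Ioi] with s hs t ht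
    exact norm_hankelKernel_le _ hs (le_of_lt ht)
  · refine Eventually.of_forall fun s t _ => ?_
    have h1 : HasDerivAt (fun t : ℝ => Complex.exp (t * (Complex.I - s)))
        (Complex.exp (t * (Complex.I - s)) * (1 * (Complex.I - s))) t :=
      (((hasDerivAt_id (t : ℂ)).mul_const (Complex.I - (s : ℂ))).cexp).comp_ofReal
    refine ((h1.const_mul ((Complex.I - s) ^ k)).mul_const (hankelAmplitude s)).congr_deriv ?_
    rw [hankelKernel]
    ring

/-- Bessel's equation for the Laplace integral. -/
lemma bessel_hankelLaplace {r : ℝ} (hr : 0 < r) :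
    r * (hankelLaplace 2 r + hankelLaplace 0 r) + hankelLaplace 1 r = 0 := by
  -- Since `(i - s)² + 1 = s(s - 2i)`, the integrand of the Bessel expression is exactly `-W'`. Its
  -- integral vanishes because `W` is zero at `0` and tends to zero at infinity.
  set W : ℝ → ℂ := fun s =>
    Complex.exp (r * (Complex.I - s)) * (s * (s - 2 * Complex.I)) * hankelAmplitude s with hW
  have hWnorm : ∀ s, 0 < s → ‖W s‖ ≤
      s ^ (1 / 2 : ℝ) * (s + 2) * Real.exp (-(r * s)) := by
    intro s hs
    rw [hW, norm_mul, norm_mul, norm_mul, norm_exp_mul_I_sub, Complex.norm_real,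
      Real.norm_of_nonneg hs.le]
    have h1 : ‖(s : ℂ) - 2 * Complex.I‖ ≤ s + 2 := by
      refine (norm_sub_le _ _).trans (le_of_eq ?_)
      simp [abs_of_pos hs]
    calc _ ≤ Real.exp (-(r * s)) * (s * (s + 2)) * s ^ (-(1 / 2) : ℝ) := by
          gcongr
          exact norm_hankelAmplitude_le hs
      _ = _ := by
          have : s * s ^ (-(1 / 2) : ℝ) = s ^ (1 / 2 : ℝ) := by
            rw [← Real.rpow_one_add' hs.le (by norm_num)]
            norm_num
          rw [← this]
          ring
  have hW0 : W 0 = 0 := by simp [hW]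
  have hcont : ContinuousWithinAt W (Set.Ici 0) 0 := by
    rw [ContinuousWithinAt, hW0]
    refine squeeze_zero_norm' (a := fun s => s ^ (1 / 2 : ℝ) * (s + 2) * Real.exp (-(r * s))) ?_ ?_
    · filter_upwards [self_mem_nhdsWithin] with s (hs : 0 ≤ s)
      rcases hs.eq_or_lt with rfl | hs
      · simp [hW0]
      · exact hWnorm s hs
    · have : Continuous (fun s : ℝ => s ^ (1 / 2 : ℝ) * (s + 2) * Real.exp (-(r * s))) :=
        ((Real.continuous_rpow_const (by norm_num)).mul (by fun_prop)).mul (by fun_prop)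
      have h0 := this.tendsto 0
      simp only [Real.zero_rpow (by norm_num : (1 / 2 : ℝ) ≠ 0), zero_mul] at h0
      exact h0.mono_left nhdsWithin_le_nhds
  have htop : Tendsto W atTop (𝓝 0) := by
    refine squeeze_zero_norm' (a := fun s => s ^ (3 / 2 : ℝ) * Real.exp (-r * s) +
      2 * (s ^ (1 / 2 : ℝ) * Real.exp (-r * s))) ?_ ?_
    · filter_upwards [eventually_gt_atTop 0] with s hs
      refine (hWnorm s hs).trans (le_of_eq ?_)
      have : s ^ (3 / 2 : ℝ) = s * s ^ (1 / 2 : ℝ) := by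
        rw [← Real.rpow_one_add' hs.le (by norm_num)]
        norm_num
      rw [this, neg_mul]
      ring
    · simpa using (tendsto_rpow_mul_exp_neg_mul_atTop_nhds_zero (3 / 2) r hr).add
        ((tendsto_rpow_mul_exp_neg_mul_atTop_nhds_zero (1 / 2) r hr).const_mul 2)
  have hderiv : ∀ s ∈ Set.Ioi (0 : ℝ), HasDerivAt W
      (-(r * (hankelKernel 2 r s + hankelKernel 0 r s) + hankelKernel 1 r s)) s := by
    intro s hs
    have hs : 0 < s := hs
    have h1 : HasDerivAt (fun s : ℝ => Complex.exp (r * (Complex.I - s)))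
        (Complex.exp (r * (Complex.I - s)) * (r * (-1))) s :=
      ((((hasDerivAt_id (s : ℂ)).const_sub Complex.I).const_mul (r : ℂ)).cexp).comp_ofReal
    have h2 : HasDerivAt (fun s : ℝ => (s : ℂ) * (s - 2 * Complex.I))
        (1 * ((s : ℂ) - 2 * Complex.I) + s * 1) s :=
      ((hasDerivAt_id (s : ℂ)).mul ((hasDerivAt_id (s : ℂ)).sub_const (2 * Complex.I))).comp_ofReal
    refine ((h1.mul h2).mul (hasDerivAt_hankelAmplitude hs)).congr_deriv ?_
    have hz := Complex.slitPlane_ne_zero (one_add_I_mul_mem_slitPlane s)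
    have hsC : (s : ℂ) ≠ 0 := Complex.ofReal_ne_zero.2 hs.ne'
    have hfac : (s : ℂ) - 2 * Complex.I = -2 * Complex.I * (1 + Complex.I * s / 2) := by
      linear_combination (s : ℂ) * Complex.I_sq
    have hq : ((s : ℂ) * (s - 2 * Complex.I)) *
        (-(1 / (2 * s)) - (Complex.I / 4) / (1 + Complex.I * s / 2)) = Complex.I - s := by
      have e1 : ((s : ℂ) * (s - 2 * Complex.I)) * (1 / (2 * s)) = (s - 2 * Complex.I) / 2 := by
        field_simp
      have e2 : ((s : ℂ) * (s - 2 * Complex.I)) * ((Complex.I / 4) / (1 + Complex.I * s / 2)) =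
          s / 2 := by
        rw [hfac]
        generalize 1 + Complex.I * (s : ℂ) / 2 = u at hz
        rw [show (s : ℂ) * (-2 * Complex.I * u) * (Complex.I / 4 / u) =
          -(Complex.I ^ 2) * s / 2 * (u * u⁻¹) by ring, mul_inv_cancel₀ hz, Complex.I_sq]
        ring
      linear_combination -e1 - e2
    simp only [hankelKernel, pow_zero, pow_one, Pi.mul_apply]
    linear_combination (Complex.exp (r * (Complex.I - s)) * hankelAmplitude s) * hq +
      (r * Complex.exp (r * (Complex.I - s)) * hankelAmplitude s) * Complex.I_sq
  have hI := integrableOn_hankelKernel (r := r)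
  have hint := integral_Ioi_of_hasDerivAt_of_tendsto hcont hderiv
    (((((hI 2 hr).add (hI 0 hr)).const_mul (r : ℂ)).add (hI 1 hr)).neg) htop
  rw [hW0, sub_zero, integral_neg, neg_eq_zero] at hint
  rw [← hint]
  simp only [hankelLaplace]
  rw [← integral_add (hI 2 hr) (hI 0 hr), ← integral_const_mul, ← integral_add _ (hI 1 hr)]
  exact ((hI 2 hr).add (hI 0 hr)).const_mul (r : ℂ)

lemma norm_hankelLaplace_zero_le {r : ℝ} (hr : 0 < r) :
    ‖hankelLaplace 0 r‖ ≤ r ^ (-(1 / 2) : ℝ) * Real.Gamma (1 / 2) := by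
  have h := Real.integral_rpow_mul_exp_neg_mul_Ioi (a := 1 / 2) (by norm_num) hr
  rw [show (1 / 2 - 1 : ℝ) = -(1 / 2) by norm_num, one_div r, Real.inv_rpow hr.le,
    ← Real.rpow_neg hr.le] at h
  rw [← h]
  refine norm_integral_le_of_norm_le (integrableOn_rpow_mul_exp (by norm_num) hr) ?_
  filter_upwards [ae_restrict_mem measurableSet_Ioi] with s hs
  rw [hankelKernel, pow_zero, one_mul, norm_mul, norm_exp_mul_I_sub, mul_comm]
  gcongr
  exact norm_hankelAmplitude_le hs

/-- Mean value inequality: the derivative has norm at most `1/4`, and the cruder constant `1`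
suffices. -/
lemma norm_cpow_sub_one_le {s : ℝ} (hs : 0 ≤ s) :
    ‖(1 + Complex.I * s / 2) ^ (-(1 / 2) : ℂ) - 1‖ ≤ s := by
  have h := norm_image_sub_le_of_norm_deriv_le_segment' (a := 0) (b := s) (C := 1)
    (fun t _ => (hasDerivAt_one_add_I_mul_cpow t (-(1 / 2))).hasDerivWithinAt) (fun t _ => by
      have h1 := norm_one_add_I_mul_cpow_le_one t (a := -(1 / 2) - 1) (by norm_num)
      push_cast at h1
      rw [norm_mul, norm_mul]
      have h2 : ‖(-(1 / 2) : ℂ)‖ = 1 / 2 := by simp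
      have h3 : ‖Complex.I / 2‖ = 1 / 2 := by simp
      rw [h2, h3]
      linarith) s ⟨hs, le_rfl⟩
  simpa using h

lemma integral_rpow_half {r : ℝ} (hr : 0 < r) :
    ∫ s in Set.Ioi (0 : ℝ), s ^ (1 / 2 : ℝ) * Real.exp (-(r * s)) =
      r ^ (-(3 / 2) : ℝ) * Real.Gamma (3 / 2) := by
  have h := Real.integral_rpow_mul_exp_neg_mul_Ioi (a := 3 / 2) (by norm_num) hr
  rwa [show (3 / 2 - 1 : ℝ) = 1 / 2 by norm_num, one_div r, Real.inv_rpow hr.le,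
    ← Real.rpow_neg hr.le] at h

/-- Subtracting `i` from the factor `i - s` leaves `-s`, and each extra power of `s` under a Laplace
integral gains a power of `r⁻¹`. -/
lemma norm_hankelLaplace_one_sub_le {r : ℝ} (hr : 0 < r) :
    ‖hankelLaplace 1 r - Complex.I * hankelLaplace 0 r‖ ≤
      r ^ (-(3 / 2) : ℝ) * Real.Gamma (3 / 2) := by
  simp only [hankelLaplace]
  rw [← integral_rpow_half hr, ← integral_const_mul, ← integral_sub (integrableOn_hankelKernel 1 hr)
    ((integrableOn_hankelKernel 0 hr).const_mul _)]
  refine norm_integral_le_of_norm_le (integrableOn_rpow_mul_exp (by norm_num) hr) ?_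
  filter_upwards [ae_restrict_mem measurableSet_Ioi] with s hs
  have hs : 0 < s := hs
  have h1 : hankelKernel 1 r s - Complex.I * hankelKernel 0 r s =
      -(Complex.exp (r * (Complex.I - s)) * (s * hankelAmplitude s)) := by
    simp only [hankelKernel, pow_one, pow_zero]
    ring
  rw [h1, norm_neg, norm_mul, norm_mul, norm_exp_mul_I_sub, mul_comm, Complex.norm_real,
    Real.norm_of_nonneg hs.le]
  gcongr
  calc s * ‖hankelAmplitude s‖ ≤ s * s ^ (-(1 / 2) : ℝ) := by
        gcongr
        exact norm_hankelAmplitude_le hs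
    _ = s ^ (1 / 2 : ℝ) := by
        rw [← Real.rpow_one_add' hs.le (by norm_num)]
        norm_num

/-- Watson's lemma to first order: replacing `(1 + is/2)^{-1/2}` by its value at `s = 0` leaves a
Gamma integral and costs one power of `s`. -/
lemma norm_hankelLaplace_zero_sub_le {r : ℝ} (hr : 0 < r) :
    ‖hankelLaplace 0 r - Complex.exp (Complex.I * r) * (r ^ (-(1 / 2) : ℝ) * √Real.pi : ℝ)‖ ≤
      r ^ (-(3 / 2) : ℝ) * Real.Gamma (3 / 2) := by
  have h := Real.integral_rpow_mul_exp_neg_mul_Ioi (a := 1 / 2) (by norm_num) hr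
  rw [show (1 / 2 - 1 : ℝ) = -(1 / 2) by norm_num, one_div r, Real.inv_rpow hr.le,
    ← Real.rpow_neg hr.le, Real.Gamma_one_half_eq] at h
  have hi := integrableOn_rpow_mul_exp (a := -(1 / 2)) (by norm_num) hr
  have hi' : IntegrableOn (fun s : ℝ => ((s ^ (-(1 / 2) : ℝ) * Real.exp (-(r * s)) : ℝ) : ℂ))
    (Set.Ioi 0) := hi.ofReal
  rw [← h, ← integral_complex_ofReal, ← integral_const_mul, hankelLaplace, ← integral_rpow_half hr,
    ← integral_sub (integrableOn_hankelKernel 0 hr) (hi'.const_mul _)]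
  refine norm_integral_le_of_norm_le (integrableOn_rpow_mul_exp (by norm_num) hr) ?_
  filter_upwards [ae_restrict_mem measurableSet_Ioi] with s hs
  have hs : 0 < s := hs
  have h1 : hankelKernel 0 r s - Complex.exp (Complex.I * r) *
      ((s ^ (-(1 / 2) : ℝ) * Real.exp (-(r * s)) : ℝ) : ℂ) =
      Complex.exp (r * (Complex.I - s)) * ((s ^ (-(1 / 2) : ℝ) : ℝ) *
        ((1 + Complex.I * s / 2) ^ (-(1 / 2) : ℂ) - 1)) := by
    have : Complex.exp (r * (Complex.I - s)) =
        Complex.exp (Complex.I * r) * Complex.exp (-(r * s)) := by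
      rw [← Complex.exp_add]
      congr 1
      ring
    rw [hankelKernel, this, hankelAmplitude, pow_zero]
    push_cast
    ring
  rw [h1, norm_mul, norm_mul, norm_exp_mul_I_sub, mul_comm, Complex.norm_real,
    Real.norm_of_nonneg (by positivity)]
  gcongr
  calc s ^ (-(1 / 2) : ℝ) * ‖(1 + Complex.I * s / 2) ^ (-(1 / 2) : ℂ) - 1‖
      ≤ s ^ (-(1 / 2) : ℝ) * s := by
        gcongr
        exact norm_cpow_sub_one_le hs.le
    _ = s ^ (1 / 2 : ℝ) := by
        rw [← Real.rpow_add_one' hs.le (by norm_num)]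
        norm_num

/-- Pulling the positive factor `s` out of the principal power makes the behaviour as `s → ∞`
visible. -/
lemma hankelAmplitude_eq {s : ℝ} (hs : 0 < s) :
    hankelAmplitude s = (s⁻¹ : ℝ) * ((s⁻¹ : ℝ) + Complex.I / 2) ^ (-(1 / 2) : ℂ) := by
  have hsC : (s : ℂ) ≠ 0 := Complex.ofReal_ne_zero.2 hs.ne'
  have hne : ((s⁻¹ : ℝ) : ℂ) + Complex.I / 2 ≠ 0 := by
    intro h
    have := congrArg Complex.re h
    simp at this
    exact hs.ne' this
  have h1 : 1 + Complex.I * s / 2 = (s : ℝ) * (((s⁻¹ : ℝ) : ℂ) + Complex.I / 2) := by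
    push_cast
    field_simp
  have h2 : (1 + Complex.I * s / 2) ^ (-(1 / 2) : ℂ) =
      (s ^ (-(1 / 2) : ℝ) : ℝ) * (((s⁻¹ : ℝ) : ℂ) + Complex.I / 2) ^ (-(1 / 2) : ℂ) := by
    rw [h1, Complex.cpow_def_of_ne_zero (mul_ne_zero hsC hne), Complex.log_ofReal_mul hs hne,
      add_mul, Complex.exp_add, ← Complex.cpow_def_of_ne_zero hne, Complex.ofReal_cpow hs.le,
      Complex.cpow_def_of_ne_zero hsC, Complex.ofReal_log hs.le]
    push_cast
    rfl
  rw [hankelAmplitude, h2, ← mul_assoc, ← Complex.ofReal_mul, ← Real.rpow_add hs]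
  norm_num [Real.rpow_neg_one]

lemma tendsto_mul_hankelAmplitude :
    Tendsto (fun s : ℝ => (Complex.I - s) * hankelAmplitude s) atTop
      (𝓝 (-(Complex.I / 2) ^ (-(1 / 2) : ℂ))) := by
  have h0 : Tendsto (fun s : ℝ => ((s⁻¹ : ℝ) : ℂ)) atTop (𝓝 0) := by
    have := (Complex.continuous_ofReal.tendsto 0).comp (tendsto_inv_atTop_zero (𝕜 := ℝ))
    rwa [Complex.ofReal_zero] at this
  have h1 : Tendsto (fun s : ℝ => ((s⁻¹ : ℝ) + Complex.I / 2) ^ (-(1 / 2) : ℂ)) atTop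
      (𝓝 ((Complex.I / 2) ^ (-(1 / 2) : ℂ))) := by
    have hc : ContinuousAt (fun z : ℂ => z ^ (-(1 / 2) : ℂ)) (Complex.I / 2) :=
      continuousAt_cpow_const (Or.inr (by simp))
    refine hc.tendsto.comp ?_
    simpa using h0.add_const (Complex.I / 2)
  have h2 : Tendsto (fun s : ℝ => Complex.I * ((s⁻¹ : ℝ) : ℂ) - 1) atTop (𝓝 (-1)) := by
    simpa using (h0.const_mul Complex.I).sub_const 1
  have h3 := h2.mul h1
  rw [neg_one_mul] at h3
  refine h3.congr' ?_
  filter_upwards [eventually_gt_atTop 0] with s hs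
  have hsC : (s : ℂ) ≠ 0 := Complex.ofReal_ne_zero.2 hs.ne'
  rw [hankelAmplitude_eq hs]
  push_cast
  field_simp

/-- The term `s^{-1/2}` accounts for small `s`. For large `s`, `‖1 + is/2‖ ≥ s/2` gives
`s‖hankelAmplitude s‖ ≤ √2 ≤ 2`. -/
lemma norm_mul_hankelAmplitude_le {s : ℝ} (hs : 0 < s) :
    ‖(Complex.I - s) * hankelAmplitude s‖ ≤ s ^ (-(1 / 2) : ℝ) + 2 := by
  have h1 : ‖Complex.I - s‖ ≤ 1 + s := by
    refine (norm_sub_le _ _).trans (le_of_eq ?_)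
    rw [Complex.norm_I, Complex.norm_real, Real.norm_of_nonneg hs.le]
  have h2 : s * ‖hankelAmplitude s‖ ≤ 2 := by
    have h3 := norm_one_add_I_mul_cpow s (-(1 / 2))
    push_cast at h3
    have h4 := half_le_norm_one_add_I_mul s
    rw [abs_of_pos hs] at h4
    rw [hankelAmplitude, norm_mul, h3, Complex.norm_real, Real.norm_of_nonneg (by positivity)]
    have h5 : ‖1 + Complex.I * s / 2‖ ^ (-(1 / 2) : ℝ) ≤ (s / 2) ^ (-(1 / 2) : ℝ) :=
      Real.rpow_le_rpow_of_nonpos (by positivity) h4 (by norm_num)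
    calc s * (s ^ (-(1 / 2) : ℝ) * ‖1 + Complex.I * s / 2‖ ^ (-(1 / 2) : ℝ))
        ≤ s * (s ^ (-(1 / 2) : ℝ) * (s / 2) ^ (-(1 / 2) : ℝ)) := by gcongr
      _ = (s * (s ^ (-(1 / 2) : ℝ) * s ^ (-(1 / 2) : ℝ))) * 2 ^ (1 / 2 : ℝ) := by
          rw [Real.div_rpow hs.le (by norm_num), Real.rpow_neg (by norm_num : (0 : ℝ) ≤ 2)]
          field_simp
      _ = 2 ^ (1 / 2 : ℝ) := by
          rw [← Real.rpow_add hs]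
          norm_num [Real.rpow_neg_one, hs.ne']
      _ ≤ 2 ^ (1 : ℝ) := Real.rpow_le_rpow_of_exponent_le (by norm_num) (by norm_num)
      _ = 2 := Real.rpow_one 2
  rw [norm_mul]
  calc _ ≤ (1 + s) * ‖hankelAmplitude s‖ := by gcongr
    _ = ‖hankelAmplitude s‖ + s * ‖hankelAmplitude s‖ := by ring
    _ ≤ _ := add_le_add (norm_hankelAmplitude_le hs) h2

lemma mul_hankelLaplace_one {r : ℝ} (hr : 0 < r) :
    r * hankelLaplace 1 r = Complex.exp (Complex.I * r) * ∫ t in Set.Ioi (0 : ℝ),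
      ((Real.exp (-t) : ℝ) : ℂ) * ((Complex.I - (r⁻¹ * t : ℝ)) * hankelAmplitude (r⁻¹ * t)) := by
  have h := integral_comp_mul_left_Ioi (fun t : ℝ => ((Real.exp (-t) : ℝ) : ℂ) *
    ((Complex.I - (r⁻¹ * t : ℝ)) * hankelAmplitude (r⁻¹ * t))) 0 hr
  rw [mul_zero] at h
  have hrC : (r : ℂ) ≠ 0 := Complex.ofReal_ne_zero.2 hr.ne'
  have h2 : hankelLaplace 1 r = Complex.exp (Complex.I * r) * ∫ s in Set.Ioi (0 : ℝ),
      ((Real.exp (-(r * s)) : ℝ) : ℂ) * ((Complex.I - (r⁻¹ * (r * s) : ℝ)) *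
        hankelAmplitude (r⁻¹ * (r * s))) := by
    rw [← integral_const_mul, hankelLaplace]
    refine setIntegral_congr_fun measurableSet_Ioi fun s _ => ?_
    have : Complex.exp (r * (Complex.I - s)) =
        Complex.exp (Complex.I * r) * Complex.exp (-(r * s)) := by
      rw [← Complex.exp_add]
      congr 1
      ring
    simp only [hankelKernel]
    rw [inv_mul_cancel_left₀ hr.ne', this]
    push_cast
    ring
  rw [h2, h, Complex.real_smul]
  push_cast
  field_simp

/-- As `r → 0` the substitution `s = t/r` pushes the amplitude to infinity, where `(i - s)` times it
has a limit. Dominated convergence leaves that limit times `∫ e^{-t} dt = 1`. -/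
lemma tendsto_mul_hankelLaplace_one :
    Tendsto (fun r : ℝ => r * hankelLaplace 1 r) (𝓝[>] 0)
      (𝓝 (-(Complex.I / 2) ^ (-(1 / 2) : ℂ))) := by
  have hint : Tendsto (fun r : ℝ => ∫ t in Set.Ioi (0 : ℝ),
      ((Real.exp (-t) : ℝ) : ℂ) * ((Complex.I - (r⁻¹ * t : ℝ)) * hankelAmplitude (r⁻¹ * t)))
      (𝓝[>] 0) (𝓝 (∫ t in Set.Ioi (0 : ℝ),
        ((Real.exp (-t) : ℝ) : ℂ) * (-(Complex.I / 2) ^ (-(1 / 2) : ℂ)))) := by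
    refine tendsto_integral_filter_of_dominated_convergence
      -- For `0 < r < 1` one has `(t/r)^{-1/2} ≤ t^{-1/2}`, so this dominating function does not
      -- depend on `r`.
      (fun t => t ^ (-(1 / 2) : ℝ) * Real.exp (-(1 * t)) + 2 * Real.exp (-t)) ?_ ?_ ?_ ?_
    · filter_upwards [self_mem_nhdsWithin] with r (hr : 0 < r)
      refine ContinuousOn.aestronglyMeasurable ?_ measurableSet_Ioi
      refine ContinuousOn.mul (by fun_prop) (ContinuousOn.mul (by fun_prop) ?_)
      exact continuousOn_hankelAmplitude.comp (by fun_prop) fun t (ht : 0 < t) =>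
        mul_pos (inv_pos.2 hr) ht
    · filter_upwards [Ioo_mem_nhdsGT one_pos] with r hr
      filter_upwards [ae_restrict_mem measurableSet_Ioi] with t ht
      have ht : 0 < t := ht
      have hr0 : 0 < r := hr.1
      have h1 := norm_mul_hankelAmplitude_le (mul_pos (inv_pos.2 hr0) ht)
      have h2 : (r⁻¹ * t) ^ (-(1 / 2) : ℝ) ≤ t ^ (-(1 / 2) : ℝ) :=
        Real.rpow_le_rpow_of_nonpos ht
          (le_mul_of_one_le_left ht.le ((one_le_inv₀ hr0).2 hr.2.le)) (by norm_num)
      rw [norm_mul, Complex.norm_real, Real.norm_of_nonneg (Real.exp_pos _).le]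
      calc _ ≤ Real.exp (-t) * (t ^ (-(1 / 2) : ℝ) + 2) := by
            gcongr
            linarith
        _ = _ := by rw [one_mul]; ring
    · exact (integrableOn_rpow_mul_exp (by norm_num) one_pos).add
        ((integrableOn_exp_neg_Ioi 0).const_mul 2)
    · filter_upwards [ae_restrict_mem measurableSet_Ioi] with t ht
      refine Tendsto.const_mul _ ?_
      exact tendsto_mul_hankelAmplitude.comp
        (tendsto_inv_nhdsGT_zero.atTop_mul_const (show 0 < t from ht))
  rw [integral_mul_const, integral_complex_ofReal, integral_exp_neg_Ioi_zero, Complex.ofReal_one,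
    one_mul] at hint
  have hexp : Tendsto (fun r : ℝ => Complex.exp (Complex.I * r)) (𝓝[>] 0) (𝓝 1) := by
    have : Continuous (fun r : ℝ => Complex.exp (Complex.I * r)) := by fun_prop
    simpa using (this.tendsto 0).mono_left nhdsWithin_le_nhds
  have := hexp.mul hint
  rw [one_mul] at this
  refine this.congr' ?_
  filter_upwards [self_mem_nhdsWithin] with r hr using (mul_hankelLaplace_one hr).symm

lemma tendsto_mul_hankelLaplace_zero :
    Tendsto (fun r : ℝ => r * hankelLaplace 0 r) (𝓝[>] 0) (𝓝 0) := by
  refine squeeze_zero_norm' (a := fun r : ℝ => r ^ (1 / 2 : ℝ) * Real.Gamma (1 / 2)) ?_ ?_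
  · filter_upwards [self_mem_nhdsWithin] with r (hr : 0 < r)
    rw [norm_mul, Complex.norm_real, Real.norm_of_nonneg hr.le]
    calc _ ≤ r * (r ^ (-(1 / 2) : ℝ) * Real.Gamma (1 / 2)) := by
          gcongr
          exact norm_hankelLaplace_zero_le hr
      _ = _ := by
          rw [← mul_assoc, ← Real.rpow_one_add' hr.le (by norm_num)]
          norm_num
  · have : Continuous (fun r : ℝ => r ^ (1 / 2 : ℝ) * Real.Gamma (1 / 2)) :=
      (Real.continuous_rpow_const (by norm_num)).mul continuous_const
    have h0 := this.tendsto 0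
    simp only [Real.zero_rpow (by norm_num : (1 / 2 : ℝ) ≠ 0), zero_mul] at h0
    exact h0.mono_left nhdsWithin_le_nhds

/-- The constant in front of the Laplace integral for the Hankel function. -/
noncomputable def hankelConst : ℂ :=
  (√(2 / Real.pi) : ℝ) * Complex.exp (-(Complex.I * (Real.pi / 4))) * ((√Real.pi : ℝ) : ℂ)⁻¹

lemma hankelH0_eq {r : ℝ} (hr : 0 < r) : hankelH0 r = hankelConst * hankelLaplace 0 r := by
  have hrC : (r : ℂ) ≠ 0 := Complex.ofReal_ne_zero.2 hr.ne'
  have h := integral_comp_mul_left_Ioi (fun t : ℝ => ((Real.exp (-t) * t ^ (-(1 / 2) : ℝ) : ℝ) : ℂ)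
        * (1 + Complex.I * t / (2 * r)) ^ (-(1 / 2) : ℂ)) 0 hr
  rw [mul_zero] at h
  have h1 : hankelLaplace 0 r = Complex.exp (Complex.I * r) * ((r ^ (1 / 2 : ℝ) : ℝ) *
      ∫ s in Set.Ioi (0 : ℝ), ((Real.exp (-(r * s)) * (r * s) ^ (-(1 / 2) : ℝ) : ℝ) : ℂ)
        * (1 + Complex.I * (r * s : ℝ) / (2 * r)) ^ (-(1 / 2) : ℂ)) := by
    rw [← integral_const_mul, ← integral_const_mul, hankelLaplace]
    refine setIntegral_congr_fun measurableSet_Ioi fun s hs => ?_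
    have hs : 0 < s := hs
    have e1 : Complex.exp (r * (Complex.I - s)) =
        Complex.exp (Complex.I * r) * Complex.exp (-(r * s)) := by
      rw [← Complex.exp_add]
      congr 1
      ring
    have e2 : Complex.I * (r * s : ℝ) / (2 * r) = Complex.I * s / 2 := by
      push_cast
      field_simp
    have e3 : (r ^ (1 / 2 : ℝ)) * (r * s) ^ (-(1 / 2) : ℝ) = s ^ (-(1 / 2) : ℝ) := by
      rw [Real.mul_rpow hr.le hs.le, ← mul_assoc, ← Real.rpow_add hr]
      norm_num
    simp only [hankelKernel, hankelAmplitude, pow_zero, one_mul]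
    rw [e1, e2, ← e3]
    push_cast
    ring
  have h2 : √(2 / (Real.pi * r)) = √(2 / Real.pi) * (r ^ (1 / 2 : ℝ) * r⁻¹) := by
    rw [← div_div, Real.sqrt_div' _ hr.le, ← Real.sqrt_eq_rpow, div_eq_mul_inv]
    congr 1
    have := Real.mul_self_sqrt hr.le
    have h0 : √r ≠ 0 := (Real.sqrt_pos.2 hr).ne'
    field_simp
    nlinarith
  have h3 : Complex.exp (Complex.I * (r - Real.pi / 4)) =
      Complex.exp (Complex.I * r) * Complex.exp (-(Complex.I * (Real.pi / 4))) := by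
    rw [← Complex.exp_add]
    congr 1
    ring
  rw [h1, h, hankelH0, h2, h3, hankelConst, Complex.real_smul]
  push_cast
  ring

lemma I_half_cpow : (Complex.I / 2) ^ (-(1 / 2) : ℂ) =
    (√2 : ℝ) * Complex.exp (-(Complex.I * (Real.pi / 4))) := by
  have h : Complex.I / 2 = ((1 / 2 : ℝ) : ℂ) * Complex.I := by push_cast; ring
  rw [h, Complex.cpow_def_of_ne_zero (by simp), Complex.log_ofReal_mul (by norm_num)
    Complex.I_ne_zero, Complex.log_I, add_mul, Complex.exp_add]
  have h1 : Complex.exp (((Real.log (1 / 2) : ℝ) : ℂ) * (-(1 / 2))) = (√2 : ℝ) := by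
    rw [show ((Real.log (1 / 2) : ℝ) : ℂ) * (-(1 / 2)) = ((Real.log 2 * (1 / 2) : ℝ) : ℂ) by
      rw [one_div, Real.log_inv]; push_cast; ring, ← Complex.ofReal_exp, Real.sqrt_eq_rpow,
      Real.rpow_def_of_pos (by norm_num)]
  rw [h1]
  congr 2
  ring

lemma exp_neg_I_pi_div_four_sq :
    Complex.exp (-(Complex.I * (Real.pi / 4))) * Complex.exp (-(Complex.I * (Real.pi / 4))) =
      -Complex.I := by
  rw [← Complex.exp_add, show -(Complex.I * (Real.pi / 4)) + -(Complex.I * (Real.pi / 4)) =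
    -((Real.pi / 2 : ℝ) * Complex.I) by push_cast; ring, Complex.exp_neg, Complex.exp_mul_I,
    ← Complex.ofReal_cos, ← Complex.ofReal_sin, Real.cos_pi_div_two, Real.sin_pi_div_two]
  simp

/-- Up to sign this is the limit of `r` times the derivative of `hankelH0` at `0`, namely `2i/π`:
the strength of the logarithmic singularity. -/
lemma hankelConst_mul_I_half_cpow :
    hankelConst * (Complex.I / 2) ^ (-(1 / 2) : ℂ) = -(2 / Real.pi * Complex.I) := by
  rw [I_half_cpow, hankelConst]
  have hpi := Real.pi_pos
  have h1 : √(2 / Real.pi) * (√Real.pi)⁻¹ * √2 = 2 / Real.pi := by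
    rw [Real.sqrt_div' _ hpi.le]
    have h2 := Real.mul_self_sqrt hpi.le
    have h3 := Real.mul_self_sqrt (show (0 : ℝ) ≤ 2 by norm_num)
    have h0 : √Real.pi ≠ 0 := (Real.sqrt_pos.2 hpi).ne'
    calc √2 / √Real.pi * (√Real.pi)⁻¹ * √2 = (√2 * √2) / (√Real.pi * √Real.pi) := by
          field_simp
      _ = _ := by rw [h2, h3]
  have h1C := congrArg (fun t : ℝ => (t : ℂ)) h1
  push_cast at h1C
  linear_combination (√(2 / Real.pi) * (√Real.pi : ℂ)⁻¹ * √2) * exp_neg_I_pi_div_four_sq -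
    Complex.I * h1C

/-! ### The outgoing profiles in dimensions two and three -/

lemma sphereArea_two : sphereArea 2 = 2 * Real.pi := by
  rw [sphereArea, Measure.toSphere_real_apply_univ, measureReal_def,
    EuclideanSpace.volume_ball_fin_two]
  simp [Real.pi_pos.le]

lemma sphereArea_three : sphereArea 3 = 4 * Real.pi := by
  rw [sphereArea, Measure.toSphere_real_apply_univ, measureReal_def,
    EuclideanSpace.volume_ball_fin_three]
  have := Real.pi_pos.le
  simp
  rw [ENNReal.toReal_ofReal (by positivity)]
  ring

/-- The radial profile of the fundamental solution. -/
noncomputable def profile (d : ℕ) (κ r : ℝ) : ℂ :=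
  if d = 2 then Complex.I / 4 * hankelH0 (κ * r)
  else Complex.exp (Complex.I * (κ * r : ℝ)) / (4 * Real.pi * r : ℝ)

/-- The constant factor of the far-field kernel. -/
noncomputable def farFieldConst (d : ℕ) (κ : ℝ) : ℂ :=
  if d = 2 then Complex.exp (Complex.I * Real.pi / 4) / (Real.sqrt (8 * Real.pi * κ) : ℝ)
  else 1 / (4 * Real.pi : ℝ)

/-- Everything is explicit: the profile equals its leading term, hence the constant `0` in the
asymptotics, and `f' - iκf = -f/r`. -/
lemma isOutgoingProfile_three {κ : ℝ} : IsOutgoingProfile 3 κ (farFieldConst 3 κ) (profile 3 κ)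
    (fun r => (Complex.I * κ - (r⁻¹ : ℝ)) * profile 3 κ r) := by
  have hpi : (Real.pi : ℂ) ≠ 0 := Complex.ofReal_ne_zero.2 Real.pi_ne_zero
  have hp : ∀ r, profile 3 κ r = Complex.exp (Complex.I * (κ * r : ℝ)) / (4 * Real.pi * r : ℝ) :=
    fun r => by simp [profile]
  have hpn : ∀ r, 0 < r → ‖profile 3 κ r‖ = (4 * Real.pi)⁻¹ * r⁻¹ := by
    intro r hr
    rw [hp, norm_div, norm_exp_I_mul_ofReal, Complex.norm_real, Real.norm_of_nonneg
      (by have := Real.pi_pos; positivity), one_div, mul_inv]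
  have hd : ∀ r, 0 < r → HasDerivAt (profile 3 κ)
      ((Complex.I * κ - (r⁻¹ : ℝ)) * profile 3 κ r) r := by
    intro r hr
    have hrC : (r : ℂ) ≠ 0 := Complex.ofReal_ne_zero.2 hr.ne'
    have h1 : HasDerivAt (fun r : ℝ => Complex.exp (Complex.I * (κ * r : ℝ)))
        (Complex.exp (Complex.I * (κ * r : ℝ)) * (Complex.I * κ)) r := by
      have := (((hasDerivAt_id (r : ℂ)).const_mul (Complex.I * κ)).cexp).comp_ofReal
      simp only [id, mul_one] at this
      refine (this.congr_deriv ?_).congr_of_eventuallyEq (Eventually.of_forall fun t => ?_)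
      · push_cast; rw [mul_assoc]
      · push_cast; rw [mul_assoc]
    have h2 : HasDerivAt (fun r : ℝ => ((4 * Real.pi * r : ℝ) : ℂ)) ((4 * Real.pi : ℝ) : ℂ) r := by
      simpa using ((hasDerivAt_id r).const_mul (4 * Real.pi)).ofReal_comp
    have h3 := h1.div h2 (Complex.ofReal_ne_zero.2
      (mul_ne_zero (mul_ne_zero four_ne_zero Real.pi_ne_zero) hr.ne'))
    refine (h3.congr_deriv ?_).congr_of_eventuallyEq (Eventually.of_forall fun t => hp t)
    rw [hp]
    push_cast
    field_simp
  have hexp : Tendsto (fun r : ℝ => Complex.exp (Complex.I * (κ * r : ℝ))) (𝓝[>] 0) (𝓝 1) := by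
    have : Continuous (fun r : ℝ => Complex.exp (Complex.I * (κ * r : ℝ))) := by fun_prop
    simpa using (this.tendsto 0).mono_left nhdsWithin_le_nhds
  have hid : Tendsto (fun r : ℝ => (r : ℂ)) (𝓝[>] 0) (𝓝 0) := by
    simpa using (Complex.continuous_ofReal.tendsto 0).mono_left nhdsWithin_le_nhds
  refine ⟨hd, fun r hr => ?_, ?_, ?_, ⟨0, fun r hr => ?_⟩, ⟨(4 * Real.pi)⁻¹, fun r hr => ?_⟩⟩
  · have hrC : (r : ℂ) ≠ 0 := Complex.ofReal_ne_zero.2 hr.ne'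
    refine (((hasDerivAt_inv hr.ne').ofReal_comp.const_sub (Complex.I * κ)).mul
      (hd r hr)).congr_deriv ?_
    push_cast
    field_simp
    linear_combination (κ ^ 2 * r ^ 2 : ℂ) * profile 3 κ r * Complex.I_sq
  · have := (hid.mul hexp).const_mul ((4 * Real.pi : ℂ)⁻¹)
    rw [zero_mul, mul_zero] at this
    refine this.congr' ?_
    filter_upwards [self_mem_nhdsWithin] with r (hr : 0 < r)
    have hrC : (r : ℂ) ≠ 0 := Complex.ofReal_ne_zero.2 hr.ne'
    rw [hp, Complex.real_smul]
    push_cast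
    field_simp
  · have := ((hid.const_mul (Complex.I * κ)).sub_const 1).mul hexp
    rw [mul_zero, zero_sub, mul_one] at this
    refine this.congr' ?_
    filter_upwards [self_mem_nhdsWithin] with r (hr : 0 < r)
    have hrC : (r : ℂ) ≠ 0 := Complex.ofReal_ne_zero.2 hr.ne'
    rw [hp, Complex.real_smul, sphereArea_three]
    push_cast
    field_simp
  · have h1 : (((3 : ℕ) : ℝ) - 1) / 2 = 1 := by norm_num
    rw [hp, h1, Real.rpow_neg_one, farFieldConst, if_neg (by norm_num), zero_mul]
    refine le_of_eq (norm_eq_zero.2 ?_)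
    push_cast
    field_simp
    ring
  · have h1 : (((3 : ℕ) : ℝ) + 1) / 2 = (2 : ℕ) := by norm_num
    rw [h1, Real.rpow_neg hr.le, Real.rpow_natCast, sub_mul, sub_sub_cancel_left, norm_neg,
      norm_mul, hpn r hr, Complex.norm_real, Real.norm_of_nonneg (by positivity)]
    refine le_of_eq ?_
    field_simp

/-- The differential equation is Bessel's equation rescaled by `κ`, and the asymptotics are the
first-order estimates of the Laplace integrals. -/
lemma isOutgoingProfile_two {κ : ℝ} (hκ : 0 < κ) :
    IsOutgoingProfile 2 κ (farFieldConst 2 κ) (profile 2 κ)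
    (fun r => κ * (Complex.I / 4 * hankelConst) * hankelLaplace 1 (κ * r)) := by
  have hpi : (Real.pi : ℂ) ≠ 0 := Complex.ofReal_ne_zero.2 Real.pi_ne_zero
  have hκC : (κ : ℂ) ≠ 0 := Complex.ofReal_ne_zero.2 hκ.ne'
  set A : ℂ := Complex.I / 4 * hankelConst with hA
  have hp : ∀ r, 0 < r → profile 2 κ r = A * hankelLaplace 0 (κ * r) := by
    intro r hr
    rw [profile, if_pos rfl, hankelH0_eq (mul_pos hκ hr), hA, mul_assoc]
  have hd : ∀ k r, 0 < r → HasDerivAt (fun r => hankelLaplace k (κ * r))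
      (κ * hankelLaplace (k + 1) (κ * r)) r := by
    intro k r hr
    have h1 : HasDerivAt (fun r : ℝ => κ * r) κ r := by
      simpa using (hasDerivAt_id r).const_mul κ
    have := (hasDerivAt_hankelLaplace k (mul_pos hκ hr)).scomp r h1
    rwa [Complex.real_smul] at this
  have hscale : Tendsto (fun r : ℝ => κ * r) (𝓝[>] 0) (𝓝[>] 0) := by
    refine tendsto_nhdsWithin_iff.2 ⟨?_, ?_⟩
    · have : Continuous (fun r : ℝ => κ * r) := by fun_prop
      simpa using (this.tendsto 0).mono_left nhdsWithin_le_nhds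
    · filter_upwards [self_mem_nhdsWithin] with r (hr : 0 < r) using mul_pos hκ hr
  refine ⟨fun r hr => ?_, fun r hr => ?_, ?_, ?_, ?_, ?_⟩
  · refine (((hd 0 r hr).const_mul A).congr_of_eventuallyEq ?_).congr_deriv (by ring)
    filter_upwards [Ioi_mem_nhds hr] with t ht using hp t ht
  · have hrC : (r : ℂ) ≠ 0 := Complex.ofReal_ne_zero.2 hr.ne'
    refine ((hd 1 r hr).const_mul (κ * A)).congr_deriv ?_
    have hb := bessel_hankelLaplace (mul_pos hκ hr)
    rw [hp r hr]
    push_cast at hb ⊢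
    field_simp
    linear_combination A * hb
  · have := (tendsto_mul_hankelLaplace_zero.comp hscale).const_mul (A * (κ : ℂ)⁻¹)
    rw [mul_zero] at this
    refine this.congr' ?_
    filter_upwards [self_mem_nhdsWithin] with r hr
    rw [hp r hr, Complex.real_smul, Function.comp_apply]
    push_cast
    field_simp
  · have := (tendsto_mul_hankelLaplace_one.comp hscale).const_mul (2 * Real.pi * A)
    -- The normalisation `i/4` is what makes the flux of the singularity `-1`: `2π · (i/4) · (2i/π)
    -- = -1`.
    have hval : 2 * Real.pi * A * (-(Complex.I / 2) ^ (-(1 / 2) : ℂ)) = -1 := by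
      have h2 : (2 / Real.pi : ℂ) * Real.pi = 2 := by field_simp
      rw [hA]
      linear_combination (-(2 * Real.pi * (Complex.I / 4))) * hankelConst_mul_I_half_cpow +
        (Complex.I ^ 2 / 2) * h2 + Complex.I_sq
    rw [hval] at this
    refine this.congr' ?_
    filter_upwards [self_mem_nhdsWithin] with r hr
    rw [Complex.real_smul, Function.comp_apply, sphereArea_two]
    push_cast
    simp
    ring
  · refine ⟨‖A‖ * (κ ^ (-(3 / 2) : ℝ) * Real.Gamma (3 / 2)), fun r hr => ?_⟩
    have hconst : farFieldConst 2 κ = A * (κ ^ (-(1 / 2) : ℝ) * √Real.pi : ℝ) := by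
      rw [farFieldConst, if_pos rfl, hA, hankelConst]
      have h1 : Complex.exp (Complex.I * Real.pi / 4) =
          Complex.I * Complex.exp (-(Complex.I * (Real.pi / 4))) := by
        have h2 : Complex.I * Real.pi / 4 =
            -(Complex.I * (Real.pi / 4)) + ((Real.pi / 2 : ℝ) : ℂ) * Complex.I := by
          push_cast
          ring
        rw [h2, Complex.exp_add, Complex.exp_mul_I, ← Complex.ofReal_cos, ← Complex.ofReal_sin,
          Real.cos_pi_div_two, Real.sin_pi_div_two]
        simp
        ring
      have h3 : (√(8 * Real.pi * κ))⁻¹ = √(2 / Real.pi) / 4 * κ ^ (-(1 / 2) : ℝ) := by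
        rw [Real.rpow_neg hκ.le, ← Real.sqrt_eq_rpow, ← Real.sqrt_inv, ← Real.sqrt_inv,
          show (8 * Real.pi * κ)⁻¹ = (2 / Real.pi) / 4 ^ 2 * κ⁻¹ by
            have := Real.pi_pos
            field_simp
            norm_num,
          Real.sqrt_mul (by have := Real.pi_pos; positivity), Real.sqrt_div' _ (by norm_num),
          Real.sqrt_sq (by norm_num)]
      have h0 : ((√Real.pi : ℝ) : ℂ) ≠ 0 :=
        Complex.ofReal_ne_zero.2 (Real.sqrt_pos.2 Real.pi_pos).ne'
      rw [h1, div_eq_mul_inv, ← Complex.ofReal_inv, h3]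
      push_cast
      field_simp
    have hκr : 0 < κ * r := mul_pos hκ hr
    have e1 : (((2 : ℕ) : ℝ) - 1) / 2 = 1 / 2 := by norm_num
    have e2 : (((2 : ℕ) : ℝ) + 1) / 2 = 3 / 2 := by norm_num
    have h := norm_hankelLaplace_zero_sub_le hκr
    rw [Real.mul_rpow hκ.le hr.le, Real.mul_rpow hκ.le hr.le] at h
    rw [e1, e2, hp r hr, hconst]
    calc _ = ‖A * (hankelLaplace 0 (κ * r) - Complex.exp (Complex.I * (κ * r : ℝ)) *
          ((κ ^ (-(1 / 2) : ℝ) * r ^ (-(1 / 2) : ℝ) * √Real.pi : ℝ) : ℂ))‖ := by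
          congr 1
          push_cast
          ring
      _ ≤ ‖A‖ * (κ ^ (-(3 / 2) : ℝ) * r ^ (-(3 / 2) : ℝ) * Real.Gamma (3 / 2)) := by
          rw [norm_mul]
          gcongr
      _ = _ := by ring
  · refine ⟨‖κ * A‖ * (κ ^ (-(3 / 2) : ℝ) * Real.Gamma (3 / 2)), fun r hr => ?_⟩
    have hκr : 0 < κ * r := mul_pos hκ hr
    have e2 : (((2 : ℕ) : ℝ) + 1) / 2 = 3 / 2 := by norm_num
    have h := norm_hankelLaplace_one_sub_le hκr
    rw [Real.mul_rpow hκ.le hr.le] at h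
    rw [e2, hp r hr]
    calc _ = ‖κ * A * (hankelLaplace 1 (κ * r) - Complex.I * hankelLaplace 0 (κ * r))‖ := by
          congr 1
          ring
      _ ≤ ‖κ * A‖ * (κ ^ (-(3 / 2) : ℝ) * r ^ (-(3 / 2) : ℝ) * Real.Gamma (3 / 2)) := by
          rw [norm_mul]
          gcongr
      _ = _ := by ring

lemma exists_isOutgoingProfile {d : ℕ} (hd : d = 2 ∨ d = 3) {κ : ℝ} (hκ : 0 < κ) :
    ∃ f', IsOutgoingProfile d κ (farFieldConst d κ) (profile d κ) f' := by
  rcases hd with rfl | rfl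
  · exact ⟨_, isOutgoingProfile_two hκ⟩
  · exact ⟨_, isOutgoingProfile_three⟩

/-! ### Kernels and integration on Σ -/

lemma fundamentalSolution_eq {d : ℕ} (κ : ℝ) (x z : Space d) :
    fundamentalSolution κ x z = profile d κ ‖z - x‖ := by
  rw [fundamentalSolution, profile, norm_sub_rev x z]

lemma farFieldKernel_eq {d : ℕ} (κ : ℝ) (xhat z : Space d) : farFieldKernel κ xhat z =
    farFieldConst d κ * Complex.exp (-Complex.I * (κ * inner ℝ xhat z : ℝ)) := by
  rw [farFieldKernel, farFieldConst]
  split_ifs <;> rfl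

lemma contDiff_farFieldKernel {d : ℕ} (κ : ℝ) (xhat : Space d) :
    ContDiff ℝ 2 (farFieldKernel κ xhat) := by
  have : farFieldKernel κ xhat = fun z =>
      farFieldConst d κ * Complex.exp (-Complex.I * (κ * inner ℝ xhat z : ℝ)) :=
    funext (farFieldKernel_eq κ xhat)
  rw [this]
  have h1 : ContDiff ℝ 2 (fun z : Space d => ((κ * inner ℝ xhat z : ℝ) : ℂ)) :=
    Complex.ofRealCLM.contDiff.comp (contDiff_const.mul (contDiff_const.inner ℝ contDiff_id))
  exact contDiff_const.mul (contDiff_const.mul h1).cexp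

lemma radialDeriv_farFieldKernel {d : ℕ} (κ : ℝ) (xhat z : Space d) :
    radialDeriv (farFieldKernel κ xhat) z =
      -Complex.I * (κ * inner ℝ xhat (‖z‖⁻¹ • z) : ℝ) *
        (farFieldConst d κ * Complex.exp (-Complex.I * (κ * inner ℝ xhat z : ℝ))) := by
  have hfun : farFieldKernel κ xhat = fun z =>
      farFieldConst d κ * Complex.exp (-Complex.I * (κ * inner ℝ xhat z : ℝ)) :=
    funext (farFieldKernel_eq κ xhat)
  have h1 : HasFDerivAt (fun z : Space d => ((κ * inner ℝ xhat z : ℝ) : ℂ))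
      (Complex.ofRealCLM.comp (κ • innerSL ℝ xhat)) z :=
    Complex.ofRealCLM.hasFDerivAt.comp z (f := fun z : Space d => κ * inner ℝ xhat z)
      ((innerSL ℝ xhat).hasFDerivAt.const_mul κ)
  have h2 := ((h1.const_mul (-Complex.I)).cexp).const_mul (farFieldConst d κ)
  rw [radialDeriv, hfun, h2.fderiv]
  simp [inner_smul_right]
  ring

lemma measurableEmbedding_smul_sphere {d : ℕ} {R : ℝ} (hR : 0 < R) :
    MeasurableEmbedding (fun ω : Metric.sphere (0 : Space d) 1 => R • (ω : Space d)) :=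
  (Continuous.isClosedEmbedding (by fun_prop) fun _ _ h =>
    Subtype.ext (smul_right_injective _ hR.ne' h)).measurableEmbedding

lemma integral_sphereSurface {d : ℕ} {R : ℝ} (hR : 0 < R) (G : Space d → ℂ) :
    ∫ z, G z ∂(sphereSurface d R) = (R ^ (d - 1) : ℝ) •
      ∫ ω : Metric.sphere (0 : Space d) 1, G (R • (ω : Space d))
        ∂(volume : Measure (Space d)).toSphere := by
  rw [sphereSurface, integral_smul_measure, (measurableEmbedding_smul_sphere hR).integral_map,
    ENNReal.toReal_ofReal (by positivity)]

instance isFiniteMeasure_sphereSurface (d : ℕ) (R : ℝ) : IsFiniteMeasure (sphereSurface d R) :=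
  Measure.smul_finite _ ENNReal.ofReal_ne_top

lemma ae_sphereSurface {d : ℕ} {R : ℝ} (hR : 0 < R) {p : Space d → Prop}
    (h : ∀ ω : Metric.sphere (0 : Space d) 1, p (R • (ω : Space d))) :
    ∀ᵐ z ∂(sphereSurface d R), p z :=
  Measure.ae_smul_measure ((measurableEmbedding_smul_sphere hR).ae_map_iff.2
    (Eventually.of_forall h)) _

lemma aestronglyMeasurable_sphereSurface {d : ℕ} {R : ℝ} (hR : 0 < R) {K : Space d → ℂ}
    (hK : Continuous fun ω : Metric.sphere (0 : Space d) 1 => K (R • (ω : Space d))) :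
    AEStronglyMeasurable K (sphereSurface d R) :=
  ((measurableEmbedding_smul_sphere hR).aestronglyMeasurable_map_iff.2
    hK.aestronglyMeasurable).smul_measure _

lemma exists_bound_sphere {d : ℕ} {R : ℝ} {K : Space d → ℂ}
    (hK : Continuous fun ω : Metric.sphere (0 : Space d) 1 => K (R • (ω : Space d))) :
    ∃ C, ∀ ω : Metric.sphere (0 : Space d) 1, ‖K (R • (ω : Space d))‖ ≤ C := by
  obtain ⟨C, hC⟩ := isCompact_univ.exists_bound_of_continuousOn hK.continuousOn
  exact ⟨C, fun ω => hC ω trivial⟩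

lemma integrable_sphereSurface {d : ℕ} {R : ℝ} (hR : 0 < R) {K : Space d → ℂ}
    (hK : Continuous fun ω : Metric.sphere (0 : Space d) 1 => K (R • (ω : Space d))) :
    Integrable K (sphereSurface d R) := by
  obtain ⟨C, hC⟩ := exists_bound_sphere hK
  exact Integrable.of_bound (aestronglyMeasurable_sphereSurface hR hK) C (ae_sphereSurface hR hC)

/-- Averaging of boundary integrals with a deterministic kernel. -/
lemma integral_boundary_operator {Ω : Type*} [MeasurableSpace Ω] (ℙ : Measure Ω)
    [IsProbabilityMeasure ℙ] {d : ℕ} {R : ℝ} (hR : 0 < R) {K₁ K₂ : Space d → ℂ}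
    (hK₁ : Continuous fun ω : Metric.sphere (0 : Space d) 1 => K₁ (R • (ω : Space d)))
    (hK₂ : Continuous fun ω : Metric.sphere (0 : Space d) 1 => K₂ (R • (ω : Space d)))
    {u₁ u₂ : Ω → Space d → ℂ}
    (hu₁ : Integrable (fun p : Ω × Space d => u₁ p.1 p.2) (ℙ.prod (sphereSurface d R)))
    (hu₂ : Integrable (fun p : Ω × Space d => u₂ p.1 p.2) (ℙ.prod (sphereSurface d R)))
    {F : Ω → ℂ}
    (hF : ∀ᵐ ω ∂ℙ, F ω = ∫ z, (K₁ z * u₁ ω z - K₂ z * u₂ ω z) ∂(sphereSurface d R)) :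
    Integrable F ℙ ∧
    Integrable (fun z => K₁ z * (∫ ω, u₁ ω z ∂ℙ) - K₂ z * (∫ ω, u₂ ω z ∂ℙ)) (sphereSurface d R) ∧
    ∫ ω, F ω ∂ℙ = ∫ z, (K₁ z * (∫ ω, u₁ ω z ∂ℙ) - K₂ z * (∫ ω, u₂ ω z ∂ℙ))
      ∂(sphereSurface d R) := by
  set σ := sphereSurface d R
  have hmul : ∀ {K : Space d → ℂ} {u : Ω → Space d → ℂ},
      (Continuous fun ω : Metric.sphere (0 : Space d) 1 => K (R • (ω : Space d))) →
      Integrable (fun p : Ω × Space d => u p.1 p.2) (ℙ.prod σ) →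
      Integrable (fun p : Ω × Space d => K p.2 * u p.1 p.2) (ℙ.prod σ) := by
    intro K u hK hu
    obtain ⟨C, hC⟩ := exists_bound_sphere hK
    have hb : ∀ᵐ z ∂σ, ‖K z‖ ≤ C := ae_sphereSurface hR hC
    exact hu.bdd_mul (c := C) (aestronglyMeasurable_sphereSurface hR hK).comp_snd
      (Measure.quasiMeasurePreserving_snd.ae hb)
  have hI := (hmul hK₁ hu₁).sub (hmul hK₂ hu₂)
  have hz : ∀ᵐ z ∂σ, ∫ ω, (K₁ z * u₁ ω z - K₂ z * u₂ ω z) ∂ℙ =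
      K₁ z * (∫ ω, u₁ ω z ∂ℙ) - K₂ z * (∫ ω, u₂ ω z ∂ℙ) := by
    -- By Fubini the Cauchy data are integrable in `ω` for almost every point of Σ only, which is
    -- enough under the surface integral.
    filter_upwards [hu₁.prod_left_ae, hu₂.prod_left_ae] with z h1 h2
    rw [integral_sub (h1.const_mul _) (h2.const_mul _), integral_const_mul, integral_const_mul]
  have hF' : F =ᵐ[ℙ] fun ω => ∫ z, (K₁ z * u₁ ω z - K₂ z * u₂ ω z) ∂σ := hF
  refine ⟨hI.integral_prod_left.congr hF'.symm, hI.integral_prod_right.congr hz, ?_⟩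
  rw [integral_congr_ae hF', ← integral_congr_ae hz]
  exact integral_integral_swap hI

/-! ### Representation and far field of the scattered wave -/

/-- A scattered wave solves the Helmholtz equation in a neighbourhood of the closed exterior of a
ball that contains the obstacle. -/
lemma IsScatteredWave.exists_isHelmholtzOn {d : ℕ} {κ R : ℝ} (hR : 0 < R) {θ : Space d}
    {D : Set (Space d)} {v : Space d → ℂ} (h : IsScatteredWave κ θ D v)
    (hD : closure D ⊆ Metric.ball 0 R) :
    ∃ ρ, 0 ≤ ρ ∧ ρ < R ∧ IsHelmholtzOn κ {z : Space d | ρ < ‖z‖} v := by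
  -- A closed set inside an open ball of `ℝ^d` lies in a strictly smaller ball. The radius `r` may
  -- be negative when the set is empty, hence `max r 0`.
  obtain ⟨r, hrR, hr⟩ := exists_lt_subset_ball isClosed_closure hD
  have hsub : {z : Space d | max r 0 < ‖z‖} ⊆ (closure D)ᶜ := by
    intro z hz hzD
    have h1 : ‖z‖ < r := by simpa using hr hzD
    exact absurd ((le_max_left r 0).trans_lt hz) (not_lt.2 h1.le)
  exact ⟨max r 0, le_max_right _ _, max_lt hrR hR, h.contDiffOn.mono hsub,
    fun x hx => h.helmholtz x (hsub hx)⟩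

lemma continuous_fundamentalSolution_sphere {d : ℕ} (hd : d = 2 ∨ d = 3) {κ : ℝ} (hκ : 0 < κ)
    {R : ℝ} (hR : 0 < R) {x : Space d} (hx : R < ‖x‖) :
    (Continuous fun ω : Metric.sphere (0 : Space d) 1 =>
      fundamentalSolution κ x (R • (ω : Space d))) ∧
    Continuous fun ω : Metric.sphere (0 : Space d) 1 =>
      radialDeriv (fun z' => fundamentalSolution κ x z') (R • (ω : Space d)) := by
  obtain ⟨f', hf⟩ := exists_isOutgoingProfile hd hκ
  simp only [fundamentalSolution_eq]
  refine continuous_sphere_of_mem isOpen_compl_singleton (hf.isHelmholtzOn x).contDiffOn hR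
    fun ω h => ?_
  have := norm_smul_sphere hR.le ω
  rw [Set.mem_singleton_iff.1 h] at this
  exact hx.ne' this

/-- Green's representation formula for radiating solutions in the exterior of a ball. -/
lemma eq_integral_sphereSurface {d : ℕ} (hd : d = 2 ∨ d = 3) {κ : ℝ} (hκ : 0 < κ) {ρ R : ℝ}
    (hρ : 0 ≤ ρ) (hρR : ρ < R) {v : Space d → ℂ} (hv : IsHelmholtzOn κ {z : Space d | ρ < ‖z‖} v)
    (hrad : SommerfeldRadiation κ v) {x : Space d} (hx : R < ‖x‖) :
    v x = ∫ z, (radialDeriv (fun z' => fundamentalSolution κ x z') z * v z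
      - fundamentalSolution κ x z * radialDeriv v z) ∂(sphereSurface d R) := by
  have : NeZero d := ⟨by rcases hd with rfl | rfl <;> norm_num⟩
  obtain ⟨f', hf⟩ := exists_isOutgoingProfile hd hκ
  have hR : 0 < R := hρ.trans_lt hρR
  rw [integral_sphereSurface hR, ← hf.flux_eq (by rcases hd with rfl | rfl <;> norm_num) hκ hρ hρR
    hv hrad hx, flux_zero_eq_integral _ _ hR]
  simp only [fundamentalSolution_eq]
  congr 2
  ext ω
  ring

/-- The far-field pattern as a boundary integral. -/
noncomputable def farFieldIntegral {d : ℕ} (κ R : ℝ) (v : Space d → ℂ) (xhat : Space d) : ℂ :=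
  ∫ z, (radialDeriv (fun z' => farFieldKernel κ xhat z') z * v z
      - farFieldKernel κ xhat z * radialDeriv v z) ∂(sphereSurface d R)

lemma continuous_farFieldKernel_sphere {d : ℕ} (κ : ℝ) {R : ℝ} (hR : 0 < R) (xhat : Space d) :
    (Continuous fun ω : Metric.sphere (0 : Space d) 1 =>
      farFieldKernel κ xhat (R • (ω : Space d))) ∧
    Continuous fun ω : Metric.sphere (0 : Space d) 1 =>
      radialDeriv (fun z' => farFieldKernel κ xhat z') (R • (ω : Space d)) :=
  continuous_sphere_of_mem isOpen_univ (contDiff_farFieldKernel κ xhat).contDiffOn hR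
    fun _ => trivial

lemma hasFarField_farFieldIntegral {d : ℕ} (hd : d = 2 ∨ d = 3) {κ : ℝ} (hκ : 0 < κ) {ρ R : ℝ}
    (hρ : 0 ≤ ρ) (hρR : ρ < R) {v : Space d → ℂ} (hv : IsHelmholtzOn κ {z : Space d | ρ < ‖z‖} v)
    (hrad : SommerfeldRadiation κ v) : HasFarField κ v (farFieldIntegral κ R v) := by
  have : NeZero d := ⟨by rcases hd with rfl | rfl <;> norm_num⟩
  have hR : 0 < R := hρ.trans_lt hρR
  obtain ⟨f', hf⟩ := exists_isOutgoingProfile hd hκ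
  obtain ⟨C, r₀, hC⟩ := hf.exists_farField_bounds (by rcases hd with rfl | rfl <;> norm_num) hR
  obtain ⟨cv, cdv⟩ := continuous_sphere hv.contDiffOn hR hρR
  have iv := (integrable_sphereSurface hR cv).norm
  have idv := (integrable_sphereSurface hR cdv).norm
  refine Asymptotics.IsBigO.of_bound (C * ((∫ z, ‖v z‖ ∂(sphereSurface d R)) +
    ∫ z, ‖radialDeriv v z‖ ∂(sphereSurface d R))) ?_
  filter_upwards [tendsto_norm_cobounded_atTop.eventually_gt_atTop (max r₀ R)] with x hx
  have hx₀ : r₀ ≤ ‖x‖ := (le_max_left _ _).trans hx.le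
  have hxR : R < ‖x‖ := (le_max_right _ _).trans_lt hx
  have hx0 : 0 < ‖x‖ := hR.trans hxR
  obtain ⟨c1, c2⟩ := continuous_fundamentalSolution_sphere hd hκ hR hxR
  obtain ⟨c3, c4⟩ := continuous_farFieldKernel_sphere κ hR (‖x‖⁻¹ • x)
  rw [eq_integral_sphereSurface hd hκ hρ hρR hv hrad hxR, farFieldIntegral, ← integral_const_mul,
    ← integral_sub (integrable_sphereSurface hR ((c2.mul cv).sub (c1.mul cdv)))
      ((integrable_sphereSurface hR ((c4.mul cv).sub (c3.mul cdv))).const_mul _),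
    Real.norm_of_nonneg (by positivity)]
  have hA : Complex.exp (Complex.I * (κ * ‖x‖ : ℝ)) / ((‖x‖ ^ (((d : ℝ) - 1) / 2) : ℝ) : ℂ) =
      Complex.exp (Complex.I * (κ * ‖x‖ : ℝ)) * (‖x‖ ^ (-(((d : ℝ) - 1) / 2)) : ℝ) := by
    rw [Real.rpow_neg hx0.le, Complex.ofReal_inv, div_eq_mul_inv]
  rw [hA]
  set A := Complex.exp (Complex.I * (κ * ‖x‖ : ℝ)) * (‖x‖ ^ (-(((d : ℝ) - 1) / 2)) : ℝ)
  set Q := ‖x‖ ^ (-(((d : ℝ) + 1) / 2))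
  have hbound : ∀ᵐ z ∂(sphereSurface d R),
      ‖radialDeriv (fun z' => fundamentalSolution κ x z') z * v z
        - fundamentalSolution κ x z * radialDeriv v z
        - A * (radialDeriv (fun z' => farFieldKernel κ (‖x‖⁻¹ • x) z') z * v z
        - farFieldKernel κ (‖x‖⁻¹ • x) z * radialDeriv v z)‖ ≤
      C * Q * (‖v z‖ + ‖radialDeriv v z‖) := by
    -- The kernel expansion is uniform over Σ, so the error of the integrals is at most `C * Q`
    -- times the `L¹` norms of the Cauchy data, of relative order `1/r`.
    refine ae_sphereSurface hR fun ω => ?_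
    obtain ⟨b1, b2⟩ := hC x (R • (ω : Space d)) hx₀ (norm_smul_sphere hR.le ω)
    rw [← radialDeriv_farFieldKernel] at b2
    rw [← farFieldKernel_eq] at b1
    simp only [fundamentalSolution_eq]
    set z := R • (ω : Space d)
    have hid : ∀ a b c e p q : ℂ, a * p - b * q - A * (c * p - e * q) =
        (a - A * c) * p - (b - A * e) * q := fun a b c e p q => by ring
    rw [hid, mul_add]
    refine (norm_sub_le _ _).trans ?_
    rw [norm_mul, norm_mul]
    gcongr
  refine (norm_integral_le_of_norm_le ((iv.add idv).const_mul (C * Q)) hbound).trans (le_of_eq ?_)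
  rw [integral_const_mul]
  simp only [Pi.add_apply]
  rw [integral_add iv idv]
  ring

/-- Along a ray, multiplying the expansion by `r^{(d-1)/2} e^{-iκr}` leaves `w` plus a remainder
`O(1/r)`, so the limit defining `farField` exists and equals `w`. -/
lemma HasFarField.farField_eq {d : ℕ} {κ : ℝ} {v w : Space d → ℂ} (h : HasFarField κ v w)
    {xhat : Space d} (hx : ‖xhat‖ = 1) : farField κ v xhat = w xhat := by
  refine Tendsto.limUnder_eq ?_
  obtain ⟨C, hC⟩ := Asymptotics.IsBigO.bound h
  rw [← comap_norm_atTop, eventually_comap] at hC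
  rw [tendsto_iff_norm_sub_tendsto_zero]
  refine squeeze_zero' (g := fun r : ℝ => C * r⁻¹) (Eventually.of_forall fun _ => norm_nonneg _)
    ?_ (by simpa using (tendsto_inv_atTop_zero (𝕜 := ℝ)).const_mul C)
  filter_upwards [hC, eventually_gt_atTop 0] with r hr hr0
  have hn : ‖r • xhat‖ = r := by rw [norm_smul, hx, mul_one, Real.norm_of_nonneg hr0.le]
  have h1 := hr _ hn
  rw [hn, smul_smul, inv_mul_cancel₀ hr0.ne', one_smul, Real.norm_of_nonneg (by positivity),
    IsOutgoingProfile.rpow_neg_succ hr0, Real.rpow_neg hr0.le] at h1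
  set p := r ^ (((d : ℝ) - 1) / 2)
  have hp : 0 < p := by positivity
  have hpC : (p : ℂ) ≠ 0 := Complex.ofReal_ne_zero.2 hp.ne'
  set E := Complex.exp (Complex.I * (κ * r : ℝ))
  have hE : Complex.exp (-Complex.I * (κ * r : ℝ)) * E = 1 := by
    rw [← Complex.exp_add]
    simp
  have hEn : ‖Complex.exp (-Complex.I * (κ * r : ℝ))‖ = 1 := by
    rw [neg_mul, ← mul_neg, ← Complex.ofReal_neg, norm_exp_I_mul_ofReal]
  have hid : (p : ℂ) * Complex.exp (-Complex.I * (κ * r : ℝ)) * v (r • xhat) - w xhat =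
      p * (Complex.exp (-Complex.I * (κ * r : ℝ)) * (v (r • xhat) - E / p * w xhat)) := by
    have hpE : (p : ℂ) * (E / p) = E := mul_div_cancel₀ E hpC
    linear_combination Complex.exp (-Complex.I * (κ * r : ℝ)) * w xhat * hpE + w xhat * hE
  rw [hid, norm_mul, norm_mul, hEn, one_mul, Complex.norm_real, Real.norm_of_nonneg hp.le]
  calc _ ≤ p * (C * (p⁻¹ * r⁻¹)) := by gcongr
    _ = _ := by field_simp

/-- The expansion only evaluates the pattern at unit vectors. This passes from the boundary integral
to the pattern defined as a limit. -/
lemma HasFarField.congr {d : ℕ} {κ : ℝ} {v w w' : Space d → ℂ} (h : HasFarField κ v w)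
    (hw : ∀ xhat : Space d, ‖xhat‖ = 1 → w' xhat = w xhat) : HasFarField κ v w' := by
  refine Asymptotics.IsBigO.congr' h ?_ EventuallyEq.rfl
  filter_upwards [tendsto_norm_cobounded_atTop.eventually_gt_atTop 0] with x hx
  rw [hw]
  rw [norm_smul, norm_inv, norm_norm, inv_mul_cancel₀ hx.ne']

end Scattering

theorem mainTheorem1 {Ω : Type*} [MeasurableSpace Ω] (ℙ : Measure Ω) [IsProbabilityMeasure ℙ]
    (d : ℕ) (hd : d = 2 ∨ d = 3)
    (κ : ℝ) (hκ : 0 < κ) (θ : Space d) (hθ : ‖θ‖ = 1)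
    (R : ℝ) (hR : 0 < R)
    (D : Ω → Set (Space d))
    (hD : ∀ᵐ ω ∂ℙ, closure (D ω) ⊆ Metric.ball 0 R)
    (us : Ω → Space d → ℂ)
    (hus : ∀ᵐ ω ∂ℙ, IsScatteredWave κ θ (D ω) (us ω))
    (h_dirichlet : Integrable (fun p : Ω × Space d => us p.1 p.2)
      (ℙ.prod (sphereSurface d R)))
    (h_neumann : Integrable (fun p : Ω × Space d => radialDeriv (us p.1) p.2)
      (ℙ.prod (sphereSurface d R))) :
    (∀ x : Space d, R < ‖x‖ →
      Integrable (fun ω => us ω x) ℙ ∧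
      Integrable (fun z => radialDeriv (fun z' => fundamentalSolution κ x z') z
            * (∫ ω, us ω z ∂ℙ)
          - fundamentalSolution κ x z * (∫ ω, radialDeriv (us ω) z ∂ℙ)) (sphereSurface d R) ∧
      ∫ ω, us ω x ∂ℙ
        = ∫ z, (radialDeriv (fun z' => fundamentalSolution κ x z') z * (∫ ω, us ω z ∂ℙ)
            - fundamentalSolution κ x z * (∫ ω, radialDeriv (us ω) z ∂ℙ))
          ∂(sphereSurface d R)) ∧
    (∀ᵐ ω ∂ℙ, HasFarField κ (us ω) (farField κ (us ω))) ∧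
    (∀ xhat : Space d, ‖xhat‖ = 1 →
      Integrable (fun ω => farField κ (us ω) xhat) ℙ ∧
      Integrable (fun z => radialDeriv (fun z' => farFieldKernel κ xhat z') z
            * (∫ ω, us ω z ∂ℙ)
          - farFieldKernel κ xhat z * (∫ ω, radialDeriv (us ω) z ∂ℙ)) (sphereSurface d R) ∧
      ∫ ω, farField κ (us ω) xhat ∂ℙ
        = ∫ z, (radialDeriv (fun z' => farFieldKernel κ xhat z') z * (∫ ω, us ω z ∂ℙ)
            - farFieldKernel κ xhat z * (∫ ω, radialDeriv (us ω) z ∂ℙ))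
          ∂(sphereSurface d R)) := by
  -- From here on the obstacle enters only through these two properties. The radius `ρ` may vary
  -- with `ω`, which is harmless because all integrals are over the fixed sphere Σ.
  have hgood : ∀ᵐ ω ∂ℙ, SommerfeldRadiation κ (us ω) ∧
      ∃ ρ, 0 ≤ ρ ∧ ρ < R ∧ IsHelmholtzOn κ {z : Space d | ρ < ‖z‖} (us ω) := by
    filter_upwards [hD, hus] with ω h1 h2
    exact ⟨h2.radiation, h2.exists_isHelmholtzOn hR h1⟩
  have hfar : ∀ᵐ ω ∂ℙ, HasFarField κ (us ω) (farFieldIntegral κ R (us ω)) := by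
    filter_upwards [hgood] with ω ⟨hrad, ρ, hρ, hρR, hv⟩
    exact hasFarField_farFieldIntegral hd hκ hρ hρR hv hrad
  refine ⟨fun x hx => ?_, ?_, fun xhat hxhat => ?_⟩
  · obtain ⟨c1, c2⟩ := continuous_fundamentalSolution_sphere hd hκ hR hx
    refine integral_boundary_operator ℙ hR c2 c1 h_dirichlet h_neumann ?_
    filter_upwards [hgood] with ω ⟨hrad, ρ, hρ, hρR, hv⟩
    exact eq_integral_sphereSurface hd hκ hρ hρR hv hrad hx
  · filter_upwards [hfar] with ω h using h.congr fun xhat hxhat => h.farField_eq hxhat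
  · obtain ⟨c1, c2⟩ := continuous_farFieldKernel_sphere κ hR xhat
    refine integral_boundary_operator ℙ hR c2 c1 h_dirichlet h_neumann ?_
    filter_upwards [hfar] with ω h using h.farField_eq hxhat
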